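/- The burning number $b(G)$ of a finite graph $G$ is the least integer $b\ge 0$ such that the vertices of $G$ can be covered by $b$ balls of radii $0,1,\dots,b-1$ (in the graph distance, vertices in different components being at infinite distance). Theorem. There is an absolute constant $C$ such that for every real $\varepsilon>0$ there is an algorithm which, given any forest $G$ on $n$ vertices (by its adjacency matrix), outputs an integer $r$ with $$b(G)\le r\le (1+\varepsilon)\,b(G)$$ after at most $\max(n,2)^{C\max(1,1/\varepsilon)}$ steps; that is, in time $n^{O(1/\varepsilon)}$ for $\varepsilon\le 1$ and $n\ge 2$. Here an algorithm is a program for a random access machine whose unit-cost operations are assignment of constants, copying, addition, truncated subtraction, reading and writing array entries with indirect addressing, and testing whether a register is zero. -/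

import Mathlib

/-- The vertices of `G` can be covered by `b` closed balls of radii `0, 1, …, b - 1`.
Distances are `ℕ∞`-valued, so vertices in different components are at distance `⊤`. -/
def SimpleGraph.CoveredByBalls {V : Type*} (G : SimpleGraph V) (b : ℕ) : Prop :=
  ∃ c : Fin b → V, ∀ v : V, ∃ i : Fin b, G.edist (c i) v ≤ (i : ℕ)

/-- The burning number: the least `b` such that the vertices of `G` can be covered by balls of
radii `0, 1, …, b - 1`. -/
noncomputable def SimpleGraph.burningNumber {V : Type*} (G : SimpleGraph V) : ℕ :=
  sInf {b : ℕ | G.CoveredByBalls b}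

/-- A graph on `n` vertices is covered by `n` balls, so that the infimum above is a minimum. -/
theorem SimpleGraph.coveredByBalls_card {n : ℕ} (G : SimpleGraph (Fin n)) :
    G.CoveredByBalls n :=
  ⟨id, fun v => ⟨v, by simp⟩⟩

namespace RAM

/-- Contents of a random access machine: registers, and arrays that are indexed by natural numbers.
A program names its registers and arrays explicitly, so it uses only finitely many of them. -/
structure State where
  /-- `reg r` is the content of register `r`. -/
  reg : ℕ → ℕ
  /-- `arr a k` is the entry with index `k` of array `a`. -/
  arr : ℕ → ℕ → ℕ

/-- Basic instructions. There is no multiplication, so that charging one time unit for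
each instruction is a reasonable cost measure. -/
inductive Instr where
  /-- `r := k` for a fixed number `k` -/
  | const (r k : ℕ)
  /-- `r := x` -/
  | copy (r x : ℕ)
  /-- `r := x + y` -/
  | add (r x y : ℕ)
  /-- `r := max (x - y) 0` -/
  | sub (r x y : ℕ)
  /-- `r := a[x]` -/
  | load (r a x : ℕ)
  /-- `a[x] := y` -/
  | store (a x y : ℕ)

/-- Effect of a basic instruction. -/
def Instr.exec : Instr → State → State
  | const r k, s => { s with reg := Function.update s.reg r k }
  | copy r x, s => { s with reg := Function.update s.reg r (s.reg x) }
  | add r x y, s => { s with reg := Function.update s.reg r (s.reg x + s.reg y) }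
  | sub r x y, s => { s with reg := Function.update s.reg r (s.reg x - s.reg y) }
  | load r a x, s => { s with reg := Function.update s.reg r (s.arr a (s.reg x)) }
  | store a x y, s =>
    let row := Function.update (s.arr a) (s.reg x) (s.reg y)
    { s with arr := Function.update s.arr a row }

/-- Programs. Branching and loops test whether a register is nonzero. -/
inductive Program where
  | skip
  | instr (i : Instr)
  | seq (p q : Program)
  | ifNonzero (r : ℕ) (p q : Program)
  | whileNonzero (r : ℕ) (p : Program)

/-- `p.Runs s s' t`: started in state `s`, the program `p` halts in state `s'` after exactly `t`
steps, where every basic instruction, every `skip` and every evaluation of a test is one step. -/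
inductive Program.Runs : Program → State → State → ℕ → Prop
  | skip (s : State) : Runs .skip s s 1
  | instr (i : Instr) (s : State) : Runs (.instr i) s (i.exec s) 1
  | seq {p q : Program} {s s' s'' : State} {t t' : ℕ} :
      Runs p s s' t → Runs q s' s'' t' → Runs (.seq p q) s s'' (t + t')
  | ifTrue {r : ℕ} {p q : Program} {s s' : State} {t : ℕ} :
      s.reg r ≠ 0 → Runs p s s' t → Runs (.ifNonzero r p q) s s' (t + 1)
  | ifFalse {r : ℕ} {p q : Program} {s s' : State} {t : ℕ} :
      s.reg r = 0 → Runs q s s' t → Runs (.ifNonzero r p q) s s' (t + 1)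
  | whileTrue {r : ℕ} {p : Program} {s s' s'' : State} {t t' : ℕ} :
      s.reg r ≠ 0 → Runs p s s' t → Runs (.whileNonzero r p) s' s'' t' →
        Runs (.whileNonzero r p) s s'' (t + t' + 1)
  | whileFalse {r : ℕ} {p : Program} {s : State} :
      s.reg r = 0 → Runs (.whileNonzero r p) s s 1

/-- Programs are deterministic: final state and running time are determined by the initial state. -/
theorem Program.Runs.unique {p : Program} {s s₁ s₂ : State} {t₁ t₂ : ℕ}
    (h₁ : p.Runs s s₁ t₁) (h₂ : p.Runs s s₂ t₂) : s₁ = s₂ ∧ t₁ = t₂ := by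
  induction h₁ generalizing s₂ t₂ with
  | skip s => cases h₂; exact ⟨rfl, rfl⟩
  | instr i s => cases h₂; exact ⟨rfl, rfl⟩
  | seq _ _ ih ih' =>
    cases h₂ with
    | seq a b =>
      obtain ⟨rfl, rfl⟩ := ih a
      obtain ⟨rfl, rfl⟩ := ih' b
      exact ⟨rfl, rfl⟩
  | ifTrue h _ ih =>
    cases h₂ with
    | ifTrue _ a => obtain ⟨rfl, rfl⟩ := ih a; exact ⟨rfl, rfl⟩
    | ifFalse h' _ => exact absurd h' h
  | ifFalse h _ ih =>
    cases h₂ with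
    | ifFalse _ a => obtain ⟨rfl, rfl⟩ := ih a; exact ⟨rfl, rfl⟩
    | ifTrue h' _ => exact absurd h h'
  | whileTrue h _ _ ih ih' =>
    cases h₂ with
    | whileTrue _ a b =>
      obtain ⟨rfl, rfl⟩ := ih a
      obtain ⟨rfl, rfl⟩ := ih' b
      exact ⟨rfl, rfl⟩
    | whileFalse h' => exact absurd h' h
  | whileFalse h =>
    cases h₂ with
    | whileFalse _ => exact ⟨rfl, rfl⟩
    | whileTrue h' _ _ => exact absurd h h'

open Classical in
/-- Initial state for the input graph `G` on the vertices `0, …, n - 1`: register `0` holds `n`,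
array `0` holds the adjacency matrix of `G`, row by row, and everything else is `0`. -/
noncomputable def inputState {n : ℕ} (G : SimpleGraph (Fin n)) : State where
  reg := Function.update (fun _ => 0) 0 n
  arr := Function.update (fun _ _ => 0) 0
    (fun k => if ∃ i j : Fin n, G.Adj i j ∧ k = (i : ℕ) * n + (j : ℕ) then 1 else 0)

/-- The output of a halting computation is the content of register `0`. -/
def State.output (s : State) : ℕ := s.reg 0

end RAM

/-! Put `K = ⌈1/ε⌉` and, for a candidate number `b` of balls, `g = b / K + 1`. Sort the radii `i <
b` into classes `j = i / g`. Since `b < g * K`, there are at most `K` classes. Treat every radius of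
class `j` as if it were `(j + 1) * g - 1`, and call `b` good if the balls with these rounded radii
can cover the graph. A genuine cover by `b` balls shows that `b` is good. Conversely, rounding
raises a radius by at most `g - 1`, so a rounded cover yields a genuine one by `b + g - 1 = b + b /
K` balls. Hence the least good `b` is at most the burning number `β`, and `b + b / K` lies between
`β` and `β + β / K`.

Goodness is decided by dynamic programming. A rounded cover is encoded by local data (`Labelling`).
The weight at `v` is `N ^ j` if a ball of class `j` is centred there and `0` otherwise, where `N = n
+ 2`. There are fewer than `N` balls, so the total weight, a number below `N ^ K`, determines how
many balls of each class occur. The level of `v` is a slack with which some ball reaches `v`. It is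
justified either by a ball at `v` itself (the flag) or by a neighbour of higher level. Levels
increase strictly along justifications, so these end at a centre. This gives the two translations
`coveredByBalls_of_labelling` and `labelling_of_coveredByBalls`.

In a forest some remaining vertex `x` has at most one remaining neighbour `u`. The table of labels
of `x` can be merged into that of `u`: weights add up, and the flag of `u` also records that `x`
justifies it (`labelling_erase_iff`). A vertex without remaining neighbours is merged into a dummy
vertex `n`. When only the dummy is left, its table lists the attainable total weights.

The algorithm is written in a language with bounded loops and compiled (`Stmt.runs_compile`). With
`L = (n + 2) ^ (K + 3)` every loop has at most `L ^ 4` rounds, and the shape of the program does not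
depend on `K`, so the time is polynomial in `L`. Tables are never cleared: every elimination step
uses a fresh block of the arrays, and a loop nest only marks entries, so that its effect is a union
(`Marks`). -/

namespace RAM

/-! ### Expressions and their evaluation on the machine -/

/-- The state `s` with register `r` set to `x`. -/
def State.setReg (s : State) (r x : ℕ) : State := { s with reg := Function.update s.reg r x }

/-- The state `s` with entry `k` of array `a` set to `x`. -/
def State.setArr (s : State) (a k x : ℕ) : State :=
  { s with arr := Function.update s.arr a (Function.update (s.arr a) k x) }

@[simp] theorem State.setReg_reg (s : State) (r x r' : ℕ) :
    (s.setReg r x).reg r' = if r' = r then x else s.reg r' := by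
  simp [setReg, Function.update_apply]

@[simp] theorem State.setReg_arr (s : State) (r x : ℕ) : (s.setReg r x).arr = s.arr := rfl

@[simp] theorem State.setArr_reg (s : State) (a k x : ℕ) : (s.setArr a k x).reg = s.reg := rfl

@[simp] theorem State.setArr_arr (s : State) (a k x a' k' : ℕ) :
    (s.setArr a k x).arr a' k' = if a' = a ∧ k' = k then x else s.arr a' k' := by
  by_cases h : a' = a
  · subst h; simp [setArr, Function.update_apply]
  · simp [setArr, h]

/-- Arithmetic expressions over registers and array entries. -/
inductive Expr where
  | var (r : ℕ)
  | lit (k : ℕ)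
  | add (e f : Expr)
  | sub (e f : Expr)
  | load (a : ℕ) (e : Expr)

namespace Expr

/-- The value of an expression. -/
def eval (s : State) : Expr → ℕ
  | var r => s.reg r
  | lit k => k
  | add e f => e.eval s + f.eval s
  | sub e f => e.eval s - f.eval s
  | load a e => s.arr a (e.eval s)

theorem eval_load (s : State) (a : ℕ) (e : Expr) : (load a e).eval s = s.arr a (e.eval s) := rfl

/-- The registers that occur in an expression. -/
def regs : Expr → List ℕ
  | var r => [r]
  | lit _ => []
  | add e f => e.regs ++ f.regs
  | sub e f => e.regs ++ f.regs
  | load _ e => e.regs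

/-- The arrays that occur in an expression. -/
def arrs : Expr → List ℕ
  | var _ => []
  | lit _ => []
  | add e f => e.arrs ++ f.arrs
  | sub e f => e.arrs ++ f.arrs
  | load a e => a :: e.arrs

/-- The number of steps for the evaluation of an expression. -/
def cost : Expr → ℕ
  | var _ => 1
  | lit _ => 1
  | add e f => e.cost + f.cost + 1
  | sub e f => e.cost + f.cost + 1
  | load _ e => e.cost + 1

/-- A program that evaluates an expression into register `d`, using no register below `d`. -/
def compile : Expr → ℕ → Program
  | var r, d => .instr (.copy d r)
  | lit k, d => .instr (.const d k)
  | add e f, d => .seq (.seq (e.compile d) (f.compile (d + 1))) (.instr (.add d d (d + 1)))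
  | sub e f, d => .seq (.seq (e.compile d) (f.compile (d + 1))) (.instr (.sub d d (d + 1)))
  | load a e, d => .seq (e.compile d) (.instr (.load d a d))

theorem eval_congr {s s' : State} {e : Expr} (hr : ∀ r ∈ e.regs, s.reg r = s'.reg r)
    (ha : ∀ a ∈ e.arrs, s.arr a = s'.arr a) : e.eval s = e.eval s' := by
  induction e <;> simp_all [eval, regs, arrs]

/-- The second operand is evaluated from `d + 1` on, so the value of the first survives in `d`. The
expression reads only registers below `d`, which keep their original contents. -/
theorem runs_compile (e : Expr) (d : ℕ) (s : State) (hd : ∀ r ∈ e.regs, r < d) :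
    ∃ s', (e.compile d).Runs s s' e.cost ∧ s'.arr = s.arr ∧ s'.reg d = e.eval s ∧
      ∀ r < d, s'.reg r = s.reg r := by
  induction e generalizing d s with
  | var r =>
    refine ⟨_, .instr _ _, rfl, ?_, ?_⟩
    · simp [Instr.exec, eval]
    · intro r hr; simp [Instr.exec, hr.ne]
  | lit k =>
    refine ⟨_, .instr _ _, rfl, ?_, ?_⟩
    · simp [Instr.exec, eval]
    · intro r hr; simp [Instr.exec, hr.ne]
  | add e f ihe ihf =>
    simp only [regs, List.mem_append] at hd
    obtain ⟨s₁, h₁, ha₁, hv₁, hr₁⟩ := ihe d s (fun r hr => hd r (.inl hr))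
    obtain ⟨s₂, h₂, ha₂, hv₂, hr₂⟩ := ihf (d + 1) s₁ (fun r hr => (hd r (.inr hr)).trans d.lt_succ_self)
    have hf : f.eval s₁ = f.eval s :=
      eval_congr (fun r hr => hr₁ r (hd r (.inr hr))) (fun a _ => by rw [ha₁])
    refine ⟨_, .seq (.seq h₁ h₂) (.instr _ _), ha₂.trans ha₁, ?_, ?_⟩
    · simp [Instr.exec, eval, hv₂, hr₂ d, hv₁, hf]
    · intro r hr
      simp [Instr.exec, hr.ne, hr₂ r (by omega), hr₁ r hr]
  | sub e f ihe ihf =>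
    simp only [regs, List.mem_append] at hd
    obtain ⟨s₁, h₁, ha₁, hv₁, hr₁⟩ := ihe d s (fun r hr => hd r (.inl hr))
    obtain ⟨s₂, h₂, ha₂, hv₂, hr₂⟩ := ihf (d + 1) s₁ (fun r hr => (hd r (.inr hr)).trans d.lt_succ_self)
    have hf : f.eval s₁ = f.eval s :=
      eval_congr (fun r hr => hr₁ r (hd r (.inr hr))) (fun a _ => by rw [ha₁])
    refine ⟨_, .seq (.seq h₁ h₂) (.instr _ _), ha₂.trans ha₁, ?_, ?_⟩
    · simp [Instr.exec, eval, hv₂, hr₂ d, hv₁, hf]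
    · intro r hr
      simp [Instr.exec, hr.ne, hr₂ r (by omega), hr₁ r hr]
  | load a e ihe =>
    obtain ⟨s₁, h₁, ha₁, hv₁, hr₁⟩ := ihe d s hd
    refine ⟨_, .seq h₁ (.instr _ _), ha₁, ?_, ?_⟩
    · simp [Instr.exec, eval, hv₁, ha₁]
    · intro r hr
      simp [Instr.exec, hr.ne, hr₁ r hr]

end Expr

/-! ### Structured programs: semantics, compilation, running time -/

/-- A language of structured programs with bounded loops. `loop i m p` runs `p` for
`i = 0, …, x - 1`, where `x` is the content of register `m` at the start of the loop. -/
inductive Stmt where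
  | skip
  | assign (r : ℕ) (e : Expr)
  | store (a : ℕ) (e f : Expr)
  | seq (p q : Stmt)
  | ite (e : Expr) (p q : Stmt)
  | loop (i m : ℕ) (p : Stmt)

/-- Iteration of `f` with the values `0, …, k - 1` of register `i`. -/
def iter (f : State → State) (i : ℕ) : ℕ → State → State
  | 0, s => s
  | k + 1, s => f ((iter f i k s).setReg i k)

namespace Stmt

/-- The effect of a structured program. -/
def run : Stmt → State → State
  | skip, s => s
  | assign r e, s => s.setReg r (e.eval s)
  | store a e f, s => s.setArr a (e.eval s) (f.eval s)
  | seq p q, s => q.run (p.run s)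
  | ite e p q, s => if e.eval s ≠ 0 then p.run s else q.run s
  | loop i m p, s => iter p.run i (s.reg m) s

/-- The registers that a program may change. -/
def wregs : Stmt → List ℕ
  | skip => []
  | assign r _ => [r]
  | store _ _ _ => []
  | seq p q => p.wregs ++ q.wregs
  | ite _ p q => p.wregs ++ q.wregs
  | loop i _ p => i :: p.wregs

/-- The arrays that a program may change. -/
def warrs : Stmt → List ℕ
  | skip => []
  | assign _ _ => []
  | store a _ _ => [a]
  | seq p q => p.warrs ++ q.warrs
  | ite _ p q => p.warrs ++ q.warrs
  | loop _ _ p => p.warrs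

/-- All registers that occur in a program. -/
def regs : Stmt → List ℕ
  | skip => []
  | assign r e => r :: e.regs
  | store _ e f => e.regs ++ f.regs
  | seq p q => p.regs ++ q.regs
  | ite e p q => e.regs ++ (p.regs ++ q.regs)
  | loop i m p => i :: m :: p.regs

/-- The registers that bound the loops of a program. -/
def bounds : Stmt → List ℕ
  | skip => []
  | assign _ _ => []
  | store _ _ _ => []
  | seq p q => p.bounds ++ q.bounds
  | ite _ p q => p.bounds ++ q.bounds
  | loop _ m p => m :: p.bounds

/-- A bound for the number of steps when no loop has more than `B` rounds. -/
def cost (B : ℕ) : Stmt → ℕ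
  | skip => 1
  | assign _ e => e.cost + 1
  | store _ e f => e.cost + f.cost + 1
  | seq p q => p.cost B + q.cost B
  | ite e p q => e.cost + 1 + (p.cost B + q.cost B)
  | loop _ _ p => 4 + B * (p.cost B + 4)

/-- Translation of structured programs; registers from `d` on serve as auxiliary registers. -/
def compile : Stmt → ℕ → Program
  | skip, _ => .skip
  | assign r e, d => .seq (e.compile d) (.instr (.copy r d))
  | store a e f, d => .seq (.seq (e.compile d) (f.compile (d + 1))) (.instr (.store a d (d + 1)))
  | seq p q, d => .seq (p.compile d) (q.compile d)
  | ite e p q, d => .seq (e.compile d) (.ifNonzero d (p.compile d) (q.compile d))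
  | loop i m p, d =>
    .seq (.instr (.copy d m)) (.seq (.instr (.const (d + 1) 1)) (.seq (.instr (.const (d + 2) 0))
      (.whileNonzero d (.seq (.instr (.copy i (d + 2))) (.seq (p.compile (d + 3))
        (.seq (.instr (.sub d d (d + 1))) (.instr (.add (d + 2) (d + 2) (d + 1)))))))))

theorem run_reg {p : Stmt} {r : ℕ} (h : r ∉ p.wregs) (s : State) :
    (p.run s).reg r = s.reg r := by
  induction p generalizing s with
  | skip => rfl
  | assign r' e => simp [wregs] at h; simp [run, h]
  | store a e f => simp [run]
  | seq p q ihp ihq => simp [wregs] at h; simp [run, ihp h.1, ihq h.2]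
  | ite e p q ihp ihq =>
    simp only [wregs, List.mem_append, not_or] at h
    simp only [run]; split
    · exact ihp h.1 s
    · exact ihq h.2 s
  | loop i m p ih =>
    simp only [wregs, List.mem_cons, not_or] at h
    simp only [run]
    induction s.reg m with
    | zero => rfl
    | succ k hk => simp [iter, ih h.2, h.1, hk]

theorem run_arr {p : Stmt} {a : ℕ} (h : a ∉ p.warrs) (s : State) :
    (p.run s).arr a = s.arr a := by
  induction p generalizing s with
  | skip => rfl
  | assign r' e => simp [run]
  | store a' e f => simp [warrs] at h; ext k; simp [run, h]
  | seq p q ihp ihq => simp [warrs] at h; simp [run, ihp h.1, ihq h.2]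
  | ite e p q ihp ihq =>
    simp only [warrs, List.mem_append, not_or] at h
    simp only [run]; split
    · exact ihp h.1 s
    · exact ihq h.2 s
  | loop i m p ih =>
    simp only [warrs] at h
    simp only [run]
    induction s.reg m with
    | zero => rfl
    | succ k hk => simp [iter, ih h, hk]

theorem bounds_subset_regs (p : Stmt) : ∀ r ∈ p.bounds, r ∈ p.regs := by
  induction p <;> simp_all [bounds, regs] <;> grind

theorem wregs_subset_regs (p : Stmt) : ∀ r ∈ p.wregs, r ∈ p.regs := by
  induction p <;> simp_all [wregs, regs] <;> grind

/-- Compiled code agrees with `run` only below `d`, since higher registers hold scratch values. This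
shows that agreement below `d` suffices for the next statement. -/
theorem run_congr {d : ℕ} (p : Stmt) {s σ : State} (hd : ∀ r ∈ p.regs, r < d)
    (hreg : ∀ r < d, s.reg r = σ.reg r) (harr : s.arr = σ.arr) :
    (p.run s).arr = (p.run σ).arr ∧ ∀ r < d, (p.run s).reg r = (p.run σ).reg r := by
  have hE : ∀ {s σ : State} (e : Expr), (∀ r ∈ e.regs, r < d) → (∀ r < d, s.reg r = σ.reg r) →
      s.arr = σ.arr → e.eval s = e.eval σ := fun e he hr ha =>
    Expr.eval_congr (fun r hr' => hr r (he r hr')) (fun a _ => by rw [ha])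
  induction p generalizing s σ with
  | skip => exact ⟨harr, hreg⟩
  | assign r e =>
    simp only [regs, List.mem_cons, forall_eq_or_imp] at hd
    refine ⟨harr, fun r' hr' => ?_⟩
    simp [run, hE e hd.2 hreg harr, hreg r' hr']
  | store a e f =>
    simp only [regs, List.mem_append, or_imp, forall_and] at hd
    refine ⟨?_, hreg⟩
    simp [run, State.setArr, hE e hd.1 hreg harr, hE f hd.2 hreg harr, harr]
  | seq p q ihp ihq =>
    simp only [regs, List.mem_append, or_imp, forall_and] at hd
    obtain ⟨ha, hr⟩ := ihp hd.1 hreg harr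
    exact ihq hd.2 hr ha
  | ite e p q ihp ihq =>
    simp only [regs, List.mem_append, or_imp, forall_and] at hd
    simp only [run, hE e hd.1 hreg harr]
    split
    · exact ihp hd.2.1 hreg harr
    · exact ihq hd.2.2 hreg harr
  | loop i m p ih =>
    simp only [regs, List.mem_cons, forall_eq_or_imp] at hd
    simp only [run, hreg m hd.2.1]
    induction σ.reg m with
    | zero => exact ⟨harr, hreg⟩
    | succ k hk =>
      refine ih hd.2.2 (fun r hr => ?_) hk.1
      simp [hk.2 r hr]

/-- Correctness of the translation, with a bound for the running time. -/
theorem runs_compile {B : ℕ} (p : Stmt) (d : ℕ) (s : State) (hd : ∀ r ∈ p.regs, r < d)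
    (hw : ∀ r ∈ p.bounds, r ∉ p.wregs) (hB : ∀ r ∈ p.bounds, s.reg r ≤ B) :
    ∃ s' t, (p.compile d).Runs s s' t ∧ t ≤ p.cost B ∧ s'.arr = (p.run s).arr ∧
      ∀ r < d, s'.reg r = (p.run s).reg r := by
  induction p generalizing d s with
  | skip => exact ⟨_, _, .skip s, le_rfl, rfl, fun _ _ => rfl⟩
  | assign r e =>
    simp only [regs, List.mem_cons, forall_eq_or_imp] at hd
    obtain ⟨s₁, h₁, ha₁, hv₁, hr₁⟩ := e.runs_compile d s hd.2
    refine ⟨_, _, .seq h₁ (.instr _ _), le_rfl, ha₁, fun r' hr' => ?_⟩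
    simp [Instr.exec, Function.update_apply, hv₁, hr₁ r' hr', run]
  | store a e f =>
    simp only [regs, List.mem_append, or_imp, forall_and] at hd
    obtain ⟨s₁, h₁, ha₁, hv₁, hr₁⟩ := e.runs_compile d s hd.1
    obtain ⟨s₂, h₂, ha₂, hv₂, hr₂⟩ :=
      f.runs_compile (d + 1) s₁ (fun r hr => (hd.2 r hr).trans d.lt_succ_self)
    have hf : f.eval s₁ = f.eval s :=
      Expr.eval_congr (fun r hr => hr₁ r (hd.2 r hr)) (fun a _ => by rw [ha₁])
    refine ⟨_, _, .seq (.seq h₁ h₂) (.instr _ _), le_rfl, ?_, fun r hr => ?_⟩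
    · simp [Instr.exec, run, State.setArr, ha₂, ha₁, hv₂, hf, hr₂ d, hv₁]
    · simp [Instr.exec, run, hr₂ r (by omega), hr₁ r hr]
  | seq p q ihp ihq =>
    simp only [regs, List.mem_append, or_imp, forall_and] at hd
    simp only [wregs, bounds, List.mem_append, not_or, or_imp, forall_and] at hw hB
    obtain ⟨s₁, t₁, h₁, ht₁, ha₁, hr₁⟩ := ihp d s hd.1 hw.1.1 hB.1
    obtain ⟨s₂, t₂, h₂, ht₂, ha₂, hr₂⟩ := ihq d s₁ hd.2 hw.2.2 (fun r hr => by
      rw [hr₁ r (hd.2 r (bounds_subset_regs q r hr)), run_reg (hw.1.2 r hr)]; exact hB.2 r hr)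
    obtain ⟨hca, hcr⟩ := run_congr q hd.2 hr₁ ha₁
    exact ⟨s₂, _, .seq h₁ h₂, Nat.add_le_add ht₁ ht₂, ha₂.trans hca,
      fun r hr => (hr₂ r hr).trans (hcr r hr)⟩
  | ite e p q ihp ihq =>
    simp only [regs, List.mem_append, or_imp, forall_and] at hd
    simp only [wregs, bounds, List.mem_append, not_or, or_imp, forall_and] at hw hB
    obtain ⟨s₁, h₁, ha₁, hv₁, hr₁⟩ := e.runs_compile d s hd.1
    by_cases he : e.eval s ≠ 0
    · obtain ⟨s₂, t₂, h₂, ht₂, ha₂, hr₂⟩ := ihp d s₁ hd.2.1 hw.1.1 (fun r hr => by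
        rw [hr₁ r (hd.2.1 r (bounds_subset_regs p r hr))]; exact hB.1 r hr)
      obtain ⟨hca, hcr⟩ := run_congr p hd.2.1 hr₁ ha₁
      refine ⟨s₂, _, .seq h₁ (.ifTrue (by rwa [hv₁]) h₂), by simp only [cost]; omega, ?_, ?_⟩
      · simp [run, he, ha₂, hca]
      · intro r hr; simp [run, he, hr₂ r hr, hcr r hr]
    · obtain ⟨s₂, t₂, h₂, ht₂, ha₂, hr₂⟩ := ihq d s₁ hd.2.2 hw.2.2 (fun r hr => by
        rw [hr₁ r (hd.2.2 r (bounds_subset_regs q r hr))]; exact hB.2 r hr)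
      obtain ⟨hca, hcr⟩ := run_congr q hd.2.2 hr₁ ha₁
      rw [ne_eq, not_not] at he
      refine ⟨s₂, _, .seq h₁ (.ifFalse (by rwa [hv₁]) h₂), by simp only [cost]; omega, ?_, ?_⟩
      · simp [run, he, ha₂, hca]
      · intro r hr; simp [run, he, hr₂ r hr, hcr r hr]
  | loop i m p ih =>
    simp only [regs, List.mem_cons, forall_eq_or_imp] at hd
    simp only [wregs, bounds, List.mem_cons, not_or, forall_eq_or_imp] at hw hB
    obtain ⟨hi, hm, hp⟩ := hd
    set body : Program := .seq (.instr (.copy i (d + 2))) (.seq (p.compile (d + 3))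
        (.seq (.instr (.sub d d (d + 1))) (.instr (.add (d + 2) (d + 2) (d + 1))))) with hbody
    -- Register `d` counts the `k` remaining rounds down, `d + 1` holds the constant 1, and `d + 2`
    -- counts the `j` completed rounds. The body is compiled from `d + 3` on and leaves all three
    -- alone.
    have key : ∀ k j : ℕ, ∀ s₀ : State, s₀.reg d = k → s₀.reg (d + 1) = 1 → s₀.reg (d + 2) = j →
        s₀.arr = (iter p.run i j s).arr → (∀ r < d, s₀.reg r = (iter p.run i j s).reg r) →
        ∃ s' t, (Program.whileNonzero d body).Runs s₀ s' t ∧ t ≤ k * (p.cost B + 4) + 1 ∧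
          s'.arr = (iter p.run i (j + k) s).arr ∧
          ∀ r < d, s'.reg r = (iter p.run i (j + k) s).reg r := by
      intro k
      induction k with
      | zero =>
        intro j s₀ h0 _ _ ha hr
        exact ⟨s₀, 1, .whileFalse h0, by simp, ha, hr⟩
      | succ k ihk =>
        intro j s₀ h0 h1 h2 ha hr
        set s₁ := (Instr.copy i (d + 2)).exec s₀ with hs₁
        have hs₁d : ∀ x, d ≤ x → s₁.reg x = s₀.reg x := fun x hx => by
          simp [hs₁, Instr.exec, (hi.trans_le hx).ne']
        have hs₁r : ∀ r < d, s₁.reg r = ((iter p.run i j s).setReg i j).reg r := fun r hr' => by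
          simp [hs₁, Instr.exec, Function.update_apply, h2, hr r hr']
        have hs₁a : s₁.arr = ((iter p.run i j s).setReg i j).arr := ha
        have hiter : ∀ r, r ≠ i → r ∉ p.wregs → ∀ j, (iter p.run i j s).reg r = s.reg r := by
          intro r hri hrp j
          induction j with
          | zero => rfl
          | succ j ihj => rw [iter, run_reg hrp]; simp [hri, ihj]
        obtain ⟨s₂, t₂, hx₂, ht₂, ha₂, hr₂⟩ := ih (d + 3) s₁ (fun r hr => (hp r hr).trans (by omega))
          (fun r hr => (hw.2 r hr).2) (fun r hr' => by
            rw [hs₁r r (hp r (bounds_subset_regs p r hr'))]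
            simp [(hw.2 r hr').1, hiter r (hw.2 r hr').1 (hw.2 r hr').2, hB.2 r hr'])
        have hpd : ∀ x, d ≤ x → x ∉ p.wregs := fun x hx h =>
          absurd (hp x (wregs_subset_regs p x h)) (by omega)
        have hs₂d : ∀ x, d ≤ x → x < d + 3 → s₂.reg x = s₀.reg x := fun x hx hx' => by
          rw [hr₂ x hx', run_reg (hpd x hx), hs₁d x hx]
        obtain ⟨hca, hcr⟩ := run_congr p hp hs₁r hs₁a
        set s₃ := (Instr.add (d + 2) (d + 2) (d + 1)).exec ((Instr.sub d d (d + 1)).exec s₂) with hs₃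
        obtain ⟨s', t', hx', ht', ha', hr'⟩ := ihk (j + 1) s₃
          (by simp [hs₃, Instr.exec, hs₂d, h0, h1])
          (by simp [hs₃, Instr.exec, hs₂d, h1])
          (by simp [hs₃, Instr.exec, hs₂d, h1, h2])
          (by rw [iter, ← hca, ← ha₂]; rfl)
          (fun r hr' => by
            rw [iter, ← hcr r hr', ← hr₂ r (by omega)]
            simp [hs₃, Instr.exec, hr'.ne, (show r ≠ d + 2 by omega)])
        refine ⟨s', _, .whileTrue (by omega) (.seq (.instr _ _) (.seq hx₂ (.seq (.instr _ _)
          (.instr _ _)))) hx', ?_, ?_, ?_⟩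
        · rw [add_mul]; omega
        · rw [ha', show j + 1 + k = j + (k + 1) by omega]
        · intro r hr; rw [hr' r hr, show j + 1 + k = j + (k + 1) by omega]
    obtain ⟨s', t, hx, ht, ha, hr⟩ := key (s.reg m) 0
      ((Instr.const (d + 2) 0).exec ((Instr.const (d + 1) 1).exec ((Instr.copy d m).exec s)))
      (by simp [Instr.exec]) (by simp [Instr.exec]) (by simp [Instr.exec]) rfl
      (fun r hr => by
        simp [Instr.exec, iter, hr.ne, (show r ≠ d + 2 by omega),
          (show r ≠ d + 1 by omega)])
    refine ⟨s', _, .seq (.instr _ _) (.seq (.instr _ _) (.seq (.instr _ _) hx)), ?_, ?_, ?_⟩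
    · have := Nat.mul_le_mul_right (p.cost B + 4) hB.1
      simp only [cost]; omega
    · simpa [run] using ha
    · simpa [run] using hr

/-- Each loop contributes one factor `B + 1`. Exponents are added in sequences and branches as well,
which is wasteful but harmless because only their independence of `B` matters. -/
theorem exists_cost_le (p : Stmt) : ∃ c d, ∀ B, p.cost B ≤ c * (B + 1) ^ d := by
  induction p with
  | skip => exact ⟨1, 0, fun B => by simp [cost]⟩
  | assign r e => exact ⟨e.cost + 1, 0, fun B => by simp [cost]⟩
  | store a e f => exact ⟨e.cost + f.cost + 1, 0, fun B => by simp [cost]⟩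
  | seq p q ihp ihq =>
    obtain ⟨c, d, h⟩ := ihp
    obtain ⟨c', d', h'⟩ := ihq
    refine ⟨c + c', d + d', fun B => ?_⟩
    have h₁ : (B + 1) ^ d ≤ (B + 1) ^ (d + d') := Nat.pow_le_pow_right (by omega) (by omega)
    have h₂ : (B + 1) ^ d' ≤ (B + 1) ^ (d + d') := Nat.pow_le_pow_right (by omega) (by omega)
    calc p.cost B + q.cost B ≤ c * (B + 1) ^ d + c' * (B + 1) ^ d' := Nat.add_le_add (h B) (h' B)
      _ ≤ (c + c') * (B + 1) ^ (d + d') := by rw [add_mul]; gcongr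
  | ite e p q ihp ihq =>
    obtain ⟨c, d, h⟩ := ihp
    obtain ⟨c', d', h'⟩ := ihq
    refine ⟨e.cost + 1 + (c + c'), d + d', fun B => ?_⟩
    have h₁ : (B + 1) ^ d ≤ (B + 1) ^ (d + d') := Nat.pow_le_pow_right (by omega) (by omega)
    have h₂ : (B + 1) ^ d' ≤ (B + 1) ^ (d + d') := Nat.pow_le_pow_right (by omega) (by omega)
    have h₃ : 1 ≤ (B + 1) ^ (d + d') := Nat.one_le_pow _ _ (by omega)
    calc e.cost + 1 + (p.cost B + q.cost B)
        ≤ (e.cost + 1) * 1 + (c * (B + 1) ^ d + c' * (B + 1) ^ d') := by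
          have := h B; have := h' B; omega
      _ ≤ (e.cost + 1 + (c + c')) * (B + 1) ^ (d + d') := by
          rw [add_mul (e.cost + 1), add_mul c]; gcongr
  | loop i m p ih =>
    obtain ⟨c, d, h⟩ := ih
    refine ⟨4 + (c + 4), d + 1, fun B => ?_⟩
    have h₁ : 1 ≤ (B + 1) ^ d := Nat.one_le_pow _ _ (by omega)
    have h₂ : 1 ≤ (B + 1) ^ (d + 1) := Nat.one_le_pow _ _ (by omega)
    calc 4 + B * (p.cost B + 4) ≤ 4 * 1 + (B + 1) * (c * (B + 1) ^ d + 4 * 1) := by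
          have := h B; gcongr; omega
      _ ≤ 4 * (B + 1) ^ (d + 1) + (B + 1) * (c * (B + 1) ^ d + 4 * (B + 1) ^ d) := by gcongr
      _ = (4 + (c + 4)) * (B + 1) ^ (d + 1) := by ring

/-- A rule for loops: in every round the invariant may be combined with the fact that only the
registers and arrays that occur as targets have changed. -/
theorem run_loop_induction {i m : ℕ} {p : Stmt} {s : State} (I : ℕ → State → Prop) (h0 : I 0 s)
    (hstep : ∀ k < s.reg m, ∀ σ : State, (∀ r ∉ i :: p.wregs, σ.reg r = s.reg r) →
      (∀ a ∉ p.warrs, σ.arr a = s.arr a) → I k σ → I (k + 1) (p.run (σ.setReg i k))) :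
    I (s.reg m) ((Stmt.loop i m p).run s) := by
  simp only [run]
  have key : ∀ k ≤ s.reg m, I k (iter p.run i k s) ∧
      (∀ r ∉ i :: p.wregs, (iter p.run i k s).reg r = s.reg r) ∧
      ∀ a ∉ p.warrs, (iter p.run i k s).arr a = s.arr a := by
    intro k
    induction k with
    | zero => exact fun _ => ⟨h0, fun _ _ => rfl, fun _ _ => rfl⟩
    | succ k ih =>
      intro hk
      obtain ⟨h₁, h₂, h₃⟩ := ih (by omega)
      refine ⟨hstep k (by omega) _ h₂ h₃ h₁, fun r hr => ?_, fun a ha => ?_⟩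
      · have hr' := hr
        simp only [List.mem_cons, not_or] at hr'
        rw [iter, run_reg hr'.2]; simp [hr'.1, h₂ r hr]
      · rw [iter, run_arr ha]; exact h₃ a ha
  exact (key _ le_rfl).1

end Stmt

end RAM

/-! ### Loops that mark entries and loops that search -/

namespace RAM

/-- `Marks p a W X`: the effect of `p` on the array `a` is that the entries with an index in `X s`
become nonzero, no other array changes, only registers in `W` change, and
`X s` depends neither on these registers nor on the array `a`. -/
structure Marks (p : Stmt) (a : ℕ) (W : List ℕ) (X : State → Set ℕ) : Prop where
  run_ne_zero : ∀ s k, (p.run s).arr a k ≠ 0 ↔ s.arr a k ≠ 0 ∨ k ∈ X s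
  congr : ∀ s s' : State, (∀ r ∉ W, s.reg r = s'.reg r) → (∀ a' ≠ a, s.arr a' = s'.arr a') →
    X s = X s'
  wregs : p.wregs ⊆ W
  warrs : p.warrs ⊆ [a]

namespace Marks

variable {a : ℕ} {W : List ℕ} {p : Stmt} {X : State → Set ℕ}

theorem store (e : Expr) (he : a ∉ e.arrs) :
    Marks (.store a e (.lit 1)) a [] (fun s => {e.eval s}) where
  run_ne_zero s k := by
    simp only [Stmt.run, Expr.eval, State.setArr_arr, Set.mem_singleton_iff, true_and]
    split <;> simp_all
  congr s s' hr ha := by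
    rw [Expr.eval_congr (fun r _ => hr r (by simp)) fun a' ha' => ha a' (fun h => he (h ▸ ha'))]
  wregs := by simp [Stmt.wregs]
  warrs := by simp [Stmt.warrs]

theorem cond (h : Marks p a W X) (e : Expr) (he : a ∉ e.arrs) (hW : ∀ r ∈ e.regs, r ∉ W) :
    Marks (.ite e p .skip) a W (fun s => {k | e.eval s ≠ 0 ∧ k ∈ X s}) where
  run_ne_zero s k := by
    simp only [Stmt.run, Set.mem_ofPred_eq]
    split
    · rename_i h'; simp [h.run_ne_zero, h']
    · rename_i h'; simp [h']
  congr s s' hr ha := by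
    rw [Expr.eval_congr (fun r hr' => hr r (hW r hr')) fun a' ha' => ha a' (fun h => he (h ▸ ha')),
      h.congr s s' hr ha]
  wregs := by simpa [Stmt.wregs] using h.wregs
  warrs := by simpa [Stmt.warrs] using h.warrs

/-- The set `X` does not depend on anything the body changes, and `i` is reset in each round. So
every round marks what it would mark from the initial state, and the loop marks the union. -/
theorem loop (h : Marks p a W X) (i m : ℕ) (hm : m ∉ i :: W) :
    Marks (.loop i m p) a (i :: W) (fun s => {k | ∃ x < s.reg m, k ∈ X (s.setReg i x)}) where
  run_ne_zero s k := by
    refine Stmt.run_loop_induction (m := m) (i := i) (p := p) (s := s)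
      (fun j σ => σ.arr a k ≠ 0 ↔ s.arr a k ≠ 0 ∨ k ∈ {k | ∃ x < j, k ∈ X (s.setReg i x)})
      (by simp) ?_
    intro j _ σ hr ha hI
    have hX : X (σ.setReg i j) = X (s.setReg i j) := by
      refine h.congr _ _ (fun r hr' => ?_) (fun a' ha' => ?_)
      · by_cases hri : r = i
        · simp [hri]
        · simp only [State.setReg_reg, hri, if_false]
          refine hr r ?_
          simp only [List.mem_cons, not_or]
          exact ⟨hri, fun h' => hr' (h.wregs h')⟩
      · exact ha a' fun h' => ha' (by simpa using h.warrs h')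
    simp only [h.run_ne_zero, hX, State.setReg_arr, hI, Set.mem_ofPred_eq, Nat.lt_succ_iff_lt_or_eq,
      or_and_right, exists_or, exists_eq_left, or_assoc]
  congr s s' hr ha := by
    simp only [List.mem_cons, not_or] at hr hm
    have hX : ∀ x, X (s.setReg i x) = X (s'.setReg i x) := by
      refine fun x => h.congr _ _ (fun r hr' => ?_) ha
      by_cases hri : r = i
      · simp [hri]
      · simp [hri, hr r ⟨hri, hr'⟩]
    simp only [hr m hm, hX]
  wregs := by simpa [Stmt.wregs] using List.cons_subset_cons i h.wregs
  warrs := by simpa [Stmt.warrs] using h.warrs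

end Marks

/-- A loop that searches for an index `i` with `e ≠ 0` and stores it in register `r`. -/
theorem run_search {i m r : ℕ} {e : Expr} (hi : i ≠ r) (hr : r ∉ e.regs) (s : State) :
    let s' := (Stmt.loop i m (.ite e (.assign r (.var i)) .skip)).run s
    (s'.reg r = s.reg r ∧ ∀ x < s.reg m, e.eval (s.setReg i x) = 0) ∨
      (s'.reg r < s.reg m ∧ e.eval (s.setReg i (s'.reg r)) ≠ 0) := by
  intro s'
  refine Stmt.run_loop_induction (i := i) (m := m) (s := s) (fun j σ =>
    (σ.reg r = s.reg r ∧ ∀ x < j, e.eval (s.setReg i x) = 0) ∨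
      (σ.reg r < j ∧ e.eval (s.setReg i (σ.reg r)) ≠ 0)) (.inl ⟨rfl, by simp⟩) ?_
  intro j _ σ hσ ha hI
  have he : e.eval (σ.setReg i j) = e.eval (s.setReg i j) := by
    refine Expr.eval_congr (fun x hx => ?_) (fun a _ => ?_)
    · by_cases hxi : x = i
      · simp [hxi]
      · simp only [State.setReg_reg, hxi, if_false]
        refine hσ x ?_
        simp only [Stmt.wregs, List.mem_cons, List.mem_append, not_or]
        exact ⟨hxi, ⟨fun h => hr (h ▸ hx), by simp⟩, by simp⟩
    · exact ha a (by simp [Stmt.warrs])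
  simp only [Stmt.run, he]
  split
  · rename_i h'
    right
    simpa [Expr.eval] using h'
  · rename_i h'
    simp only [ne_eq, not_not] at h'
    rcases hI with ⟨h₁, h₂⟩ | ⟨h₁, h₂⟩
    · left
      refine ⟨by simp [hi.symm, h₁], fun x hx => ?_⟩
      rcases Nat.lt_succ_iff_lt_or_eq.1 hx with h | rfl
      · exact h₂ x h
      · exact h'
    · right
      simp only [State.setReg_reg, hi.symm, if_false]
      exact ⟨by omega, h₂⟩

end RAM

/-! ### Labellings, elimination of a leaf, and uniqueness of digits -/

/-- `Labelling A D U m`: every `v ∈ U` can be given a weight `w v`, a level `t v` and a flag `b v`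
that are admitted by `D v`, with total weight `m`, such that every `v` without a flag has an
`A`-neighbour in `U` of a higher level. -/
def Labelling (A : ℕ → ℕ → Prop) (D : ℕ → ℕ → ℕ → ℕ → Prop) (U : Finset ℕ) (m : ℕ) : Prop :=
  ∃ w t b : ℕ → ℕ, (∀ v ∈ U, D v (w v) (t v) (b v)) ∧ ∑ v ∈ U, w v = m ∧
    ∀ v ∈ U, b v ≠ 0 ∨ ∃ u ∈ U, A v u ∧ t v < t u

/-- Elimination of a vertex `x` whose only neighbour in `U` is `u`. -/
theorem labelling_erase_iff {A : ℕ → ℕ → Prop} {D D' : ℕ → ℕ → ℕ → ℕ → Prop} {U : Finset ℕ}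
    {m L x u : ℕ} (hsymm : ∀ v w, A v w → A w v) (hx : x ∈ U) (hu : u ∈ U) (hxu : x ≠ u)
    (hN : ∀ w ∈ U, A x w → w = u) (hd : A x u ∨ ∀ s t b, D u s t b → t = 0 ∧ b = 1) (hm : m < L)
    (hD : ∀ v ∈ U, v ≠ u → v ≠ x → ∀ s t b, D' v s t b ↔ D v s t b)
    (hD' : ∀ s t b, D' u s t b ↔ ∃ s₁ s₂ b₁ b₂ t₂, D u s₁ t b₁ ∧ D x s₂ t₂ b₂ ∧
      (b₂ ≠ 0 ∨ t₂ < t) ∧ s = s₁ + s₂ ∧ s < L ∧ b = 1 - (1 - (b₁ + (t₂ - t)))) :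
    Labelling A D U m ↔ Labelling A D' (U.erase x) m := by
  have hsum : ∀ w : ℕ → ℕ, ∑ v ∈ U, w v = w x + (w u + ∑ v ∈ (U.erase x).erase u, w v) := by
    intro w
    rw [Finset.add_sum_erase _ _ (Finset.mem_erase.2 ⟨hxu.symm, hu⟩), Finset.add_sum_erase _ _ hx]
  have hsum' : ∀ w : ℕ → ℕ, ∑ v ∈ U.erase x, w v = w u + ∑ v ∈ (U.erase x).erase u, w v := by
    intro w
    rw [Finset.add_sum_erase _ _ (Finset.mem_erase.2 ⟨hxu.symm, hu⟩)]
  constructor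
  · rintro ⟨w, t, b, h₁, h₂, h₃⟩
    -- `u` takes over the weight of `x`. Its new flag, normalised to 0 or 1, says that `u` was
    -- flagged or that `x` has a higher level than `u`.
    refine ⟨Function.update w u (w u + w x), t,
      Function.update b u (1 - (1 - (b u + (t x - t u)))), ?_, ?_, ?_⟩
    · intro v hv
      obtain ⟨hvx, hvU⟩ := Finset.mem_erase.1 hv
      by_cases hvu : v = u
      · subst hvu
        simp only [Function.update_self]
        refine (hD' _ _ _).2 ⟨_, _, _, _, _, h₁ v hvU, h₁ x hx, ?_, rfl, ?_, rfl⟩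
        · refine (h₃ x hx).imp_right ?_
          rintro ⟨y, hy, hAy, hty⟩
          rwa [hN y hy hAy] at hty
        · have := hsum w; omega
      · simp only [Function.update_of_ne hvu]
        exact (hD v hvU hvu hvx _ _ _).2 (h₁ v hvU)
    · rw [hsum', ← h₂, hsum w, Function.update_self]
      rw [Finset.sum_congr rfl fun v hv => Function.update_of_ne (Finset.ne_of_mem_erase hv) _ _]
      ring
    · intro v hv
      obtain ⟨hvx, hvU⟩ := Finset.mem_erase.1 hv
      by_cases hvu : v = u
      · subst hvu
        simp only [Function.update_self]
        rcases h₃ v hvU with h | ⟨y, hy, hAy, hty⟩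
        · left; omega
        · by_cases hyx : y = x
          · left; subst hyx; omega
          · exact .inr ⟨y, Finset.mem_erase.2 ⟨hyx, hy⟩, hAy, hty⟩
      · simp only [Function.update_of_ne hvu]
        refine (h₃ v hvU).imp_right ?_
        rintro ⟨y, hy, hAy, hty⟩
        refine ⟨y, Finset.mem_erase.2 ⟨?_, hy⟩, hAy, hty⟩
        rintro rfl
        exact hvu (hN v hvU (hsymm _ _ hAy))
  · rintro ⟨w, t, b, h₁, h₂, h₃⟩
    have huE : u ∈ U.erase x := Finset.mem_erase.2 ⟨hxu.symm, hu⟩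
    obtain ⟨s₁, s₂, b₁, b₂, t₂, hDu, hDx, hc, hs, -, hb⟩ := (hD' _ _ _).1 (h₁ u huE)
    -- The merged label of `u` comes from a pair of labels of `u` and `x`, which are put back.
    refine ⟨Function.update (Function.update w u s₁) x s₂, Function.update t x t₂,
      Function.update (Function.update b u b₁) x b₂, ?_, ?_, ?_⟩
    · intro v hv
      by_cases hvx : v = x
      · subst hvx; simpa using hDx
      · by_cases hvu : v = u
        · subst hvu; simpa [hvx] using hDu
        · simpa [hvx, hvu] using
            (hD v hv hvu hvx _ _ _).1 (h₁ v (Finset.mem_erase.2 ⟨hvx, hv⟩))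
    · rw [hsum, ← h₂, hsum' w, hs]
      have : ∑ v ∈ (U.erase x).erase u, Function.update (Function.update w u s₁) x s₂ v =
          ∑ v ∈ (U.erase x).erase u, w v := by
        refine Finset.sum_congr rfl fun v hv => ?_
        simp only [Finset.mem_erase] at hv
        simp [hv.1, hv.2.1]
      rw [this]
      simp [hxu.symm]
      ring
    · intro v hv
      by_cases hvx : v = x
      · subst hvx
        simp only [Function.update_self]
        refine hc.imp_right fun h => ⟨u, hu, ?_, ?_⟩
        -- If `x` and `u` are not joined by an edge, `u` has level 0, so `t₂ < t u` is impossible.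
        · rcases hd with hd | hd
          · exact hd
          · have := (hd _ _ _ hDu).1; omega
        · simpa [hxu.symm] using h
      · have hvE := Finset.mem_erase.2 ⟨hvx, hv⟩
        by_cases hvu : v = u
        · subst hvu
          simp only [ne_eq, hvx, not_false_eq_true, Function.update_of_ne, Function.update_self]
          rcases h₃ v hvE with h | ⟨y, hy, hAy, hty⟩
          -- If only the merged flag is set, it was set because `t u < t₂`, so `x` justifies `u`.
          -- Without an edge this cannot happen, as then `b₁ = 1`.
          · by_cases hb₁ : b₁ = 0
            · right
              refine ⟨x, hx, ?_, by simp; omega⟩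
              rcases hd with hd | hd
              · exact hsymm _ _ hd
              · have := (hd _ _ _ hDu).2; omega
            · exact .inl hb₁
          · right
            obtain ⟨hyx, hyU⟩ := Finset.mem_erase.1 hy
            exact ⟨y, hyU, hAy, by simpa [hyx] using hty⟩
        · simp only [ne_eq, hvx, not_false_eq_true, Function.update_of_ne, hvu]
          refine (h₃ v hvE).imp_right ?_
          rintro ⟨y, hy, hAy, hty⟩
          obtain ⟨hyx, hyU⟩ := Finset.mem_erase.1 hy
          exact ⟨y, hyU, hAy, by simpa [hyx] using hty⟩

/-- A nonempty set of vertices of a forest contains a vertex with at most one neighbour in it. -/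
theorem SimpleGraph.IsAcyclic.exists_mem_subsingleton_neighbors {V : Type*} {G : SimpleGraph V}
    (hG : G.IsAcyclic) (U : Finset V) (hU : U.Nonempty) :
    ∃ v ∈ U, ∀ w₁ ∈ U, ∀ w₂ ∈ U, G.Adj v w₁ → G.Adj v w₂ → w₁ = w₂ := by
  classical
  obtain ⟨v₀, hv₀⟩ := hU
  have : Nonempty (U : Set V) := ⟨⟨v₀, hv₀⟩⟩
  have hH := hG.induce (U : Set V)
  -- Take an endpoint of a longest path. A neighbour off the path would extend it, and a neighbour
  -- on it other than the second vertex would close a cycle.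
  obtain ⟨u, v, p, hp, hmax⟩ :=
    SimpleGraph.Walk.exists_isPath_forall_isPath_length_le_length (G.induce (U : Set V))
  have huniq : ∀ w, (G.induce (U : Set V)).Adj u w → w = p.snd := by
    intro w hw
    refine hH.eq_snd_of_adj_start hp hw ?_
    by_contra hws
    have := hmax _ _ (.cons hw.symm p) (hp.cons hws)
    simp at this
  refine ⟨u, u.2, fun w₁ h₁ w₂ h₂ ha₁ ha₂ => ?_⟩
  have e₁ := huniq ⟨w₁, h₁⟩ ha₁
  have e₂ := huniq ⟨w₂, h₂⟩ ha₂
  exact congrArg Subtype.val (e₁.trans e₂.symm)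

/-- Uniqueness of base-`N` digits: the lowest digit is the residue modulo `N`, and cancelling `N`
leaves the others. -/
theorem sum_mul_pow_injective {N : ℕ} (J : ℕ) {c d : ℕ → ℕ} (hc : ∀ j, c j < N)
    (hd : ∀ j, d j < N)
    (h : ∑ j ∈ Finset.range J, c j * N ^ j = ∑ j ∈ Finset.range J, d j * N ^ j) :
    ∀ j < J, c j = d j := by
  induction J generalizing c d with
  | zero => simp
  | succ J ih =>
    have hs : ∀ c : ℕ → ℕ, ∑ j ∈ Finset.range (J + 1), c j * N ^ j =
        c 0 + N * ∑ j ∈ Finset.range J, c (j + 1) * N ^ j := by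
      intro c
      rw [Finset.sum_range_succ', Finset.mul_sum, add_comm]
      simp only [pow_zero, mul_one, pow_succ]
      congr 1
      exact Finset.sum_congr rfl fun j _ => by ring
    rw [hs, hs] at h
    have h0 : c 0 = d 0 := by
      have := congrArg (· % N) h
      simpa [Nat.add_mul_mod_self_left, Nat.mod_eq_of_lt, hc, hd] using this
    have hN : 0 < N := (Nat.zero_le _).trans_lt (hc 0)
    have h1 := Nat.eq_of_mul_eq_mul_left hN (Nat.add_left_cancel (h0 ▸ h))
    have h2 := ih (fun j => hc (j + 1)) (fun j => hd (j + 1)) h1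
    intro j hj
    cases j with
    | zero => exact h0
    | succ j => exact h2 j (by omega)

/-- If two families of fewer than `N` powers of `N` have the same sum, then one is a rearrangement
of the other. -/
theorem exists_injOn_of_sum_pow_eq {N : ℕ} {S T : Finset ℕ} {f f' : ℕ → ℕ} (hS : S.card < N)
    (hT : T.card < N) (h : ∑ v ∈ S, N ^ f v = ∑ i ∈ T, N ^ f' i) :
    ∃ e : ℕ → ℕ, (∀ v ∈ S, e v ∈ T ∧ f' (e v) = f v) ∧ Set.InjOn e S := by
  obtain ⟨J, hJS, hJT⟩ : ∃ J, (∀ v ∈ S, f v < J) ∧ ∀ i ∈ T, f' i < J :=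
    ⟨S.sup f + T.sup f' + 1, fun v hv => by have := Finset.le_sup (f := f) hv; omega,
      fun i hi => by have := Finset.le_sup (f := f') hi; omega⟩
  -- Grouping by exponent gives a base-`N` expansion whose digits are the sizes of the fibres. Equal
  -- digits then allow a matching fibre by fibre.
  have hsum : ∀ (S : Finset ℕ) (f : ℕ → ℕ), (∀ v ∈ S, f v < J) →
      ∑ v ∈ S, N ^ f v = ∑ j ∈ Finset.range J, (S.filter (f · = j)).card * N ^ j := by
    intro S f hf
    rw [← Finset.sum_fiberwise_of_maps_to (t := Finset.range J) (g := f)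
      (fun v hv => Finset.mem_range.2 (hf v hv))]
    refine Finset.sum_congr rfl fun j _ => ?_
    rw [Finset.sum_congr rfl (g := fun _ => N ^ j) fun v hv => by rw [(Finset.mem_filter.1 hv).2]]
    simp
  rw [hsum S f hJS, hsum T f' hJT] at h
  have hcard := sum_mul_pow_injective J
    (fun j => (Finset.card_filter_le _ _).trans_lt hS)
    (fun j => (Finset.card_filter_le _ _).trans_lt hT) h
  have he : ∀ j, ∃ e : ℕ → ℕ, j < J → Set.MapsTo e (S.filter (f · = j)) (T.filter (f' · = j)) ∧
      Set.InjOn e (S.filter (f · = j)) := by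
    intro j
    by_cases hj : j < J
    · obtain ⟨e, he, he'⟩ := Set.Finite.exists_injOn_of_encard_le
        (s := (S.filter (f · = j) : Set ℕ)) (t := (T.filter (f' · = j) : Set ℕ))
        (Finset.finite_toSet _) (by
          rw [Set.encard_coe_eq_coe_finsetCard, Set.encard_coe_eq_coe_finsetCard, hcard j hj])
      exact ⟨e, fun _ => ⟨he, he'⟩⟩
    · exact ⟨id, fun h => absurd h hj⟩
  choose e he using he
  have hmem : ∀ v ∈ S, e (f v) v ∈ T ∧ f' (e (f v) v) = f v := fun v hv => by
    simpa using (he (f v) (hJS v hv)).1 (show v ∈ _ by simpa using hv)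
  refine ⟨fun v => e (f v) v, hmem, ?_⟩
  intro v hv v' hv' heq
  simp only at heq
  have hf : f v = f v' := by rw [← (hmem v hv).2, ← (hmem v' hv').2, heq]
  refine (he (f v) (hJS v hv)).2 (by simpa using hv) (by simpa [hf] using hv') ?_
  rw [heq, hf]

/-! ### Labellings versus covers by balls -/

/-- The adjacency relation of a graph on `Fin n`, as a relation between natural numbers. -/
def SimpleGraph.natAdj {n : ℕ} (G : SimpleGraph (Fin n)) (v w : ℕ) : Prop :=
  ∃ (hv : v < n) (hw : w < n), G.Adj ⟨v, hv⟩ ⟨w, hw⟩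

theorem SimpleGraph.natAdj_symm {n : ℕ} {G : SimpleGraph (Fin n)} (v w : ℕ) (h : G.natAdj v w) :
    G.natAdj w v := by
  obtain ⟨hv, hw, h⟩ := h
  exact ⟨hw, hv, h.symm⟩

/-- Labels admitted at a vertex: a vertex `v < n` bears no ball, or a ball of class `j`, that is,
one of the balls whose radius `i < b` satisfies `i / g = j`; then the weight is `N ^ j` and the flag
says whether the level is at most the largest radius in this class. The vertex `n` is a dummy. -/
def InitLabel (n N g b L v s t f : ℕ) : Prop :=
  s < L ∧ t < L ∧ ((v < n ∧ ((s = 0 ∧ f = 0) ∨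
    ∃ j, j * g < b ∧ s = N ^ j ∧ f = if t < (j + 1) * g then 1 else 0)) ∨
      (v = n ∧ s = 0 ∧ t = 0 ∧ f = 1))

/-- The weight of `b` balls of radii `0, …, b - 1`. -/
def targetWeight (N g b : ℕ) : ℕ := ∑ i ∈ Finset.range b, N ^ (i / g)

/-- Passing from a vertex to neighbours of higher level leads to a centre whose rounded ball reaches
the vertex. The total weight has the right digits, so centres can be matched with radii `i < b` of
the same class, and radius `i + (g - 1)` is at least the rounded one. -/
theorem coveredByBalls_of_labelling {n N g b L : ℕ} {G : SimpleGraph (Fin n)} (hg : 0 < g)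
    (hbg : b = 0 → g = 1) (hN : n < N) (hbn : b ≤ n)
    (h : Labelling G.natAdj (InitLabel n N g b L) (Finset.range (n + 1)) (targetWeight N g b)) :
    G.CoveredByBalls (b + g - 1) := by
  obtain ⟨w, t, f, h₁, h₂, h₃⟩ := h
  have hpos : ∀ j, 0 < N ^ j := fun j => Nat.pow_pos (by omega)
  set S := (Finset.range n).filter (w · ≠ 0) with hS
  have hj : ∀ v, ∃ j, v < n → w v ≠ 0 →
      j * g < b ∧ w v = N ^ j ∧ f v = if t v < (j + 1) * g then 1 else 0 := by
    intro v
    by_cases hv : v < n ∧ w v ≠ 0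
    · obtain ⟨-, -, ⟨-, h | ⟨j, hj⟩⟩ | h⟩ := h₁ v (by simp; omega)
      · exact absurd h.1 hv.2
      · exact ⟨j, fun _ _ => hj⟩
      · omega
    · exact ⟨0, fun h h' => absurd ⟨h, h'⟩ hv⟩
  choose j hj using hj
  have hwn : w n = 0 := by
    obtain ⟨-, -, h | h⟩ := h₁ n (by simp)
    · omega
    · exact h.2.1
  -- Induction along increasing levels. In `d + t v < (j u + 1) * g`, the extra edge towards `v` is
  -- paid for by the drop of the level.
  have hcov : ∀ k, ∀ v (hv : v < n), L - t v ≤ k → ∃ u, ∃ (hu : u < n) (d : ℕ), w u ≠ 0 ∧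
      G.edist ⟨u, hu⟩ ⟨v, hv⟩ ≤ d ∧ d + t v < (j u + 1) * g := by
    intro k
    induction k with
    | zero => intro v hv hk; have := (h₁ v (by simp; omega)).2.1; omega
    | succ k ih =>
      intro v hv hk
      rcases h₃ v (by simp; omega) with hf | ⟨y, -, ⟨hv', hy, hvy⟩, hty⟩
      · have hw : w v ≠ 0 := by
          obtain ⟨-, -, ⟨-, h | ⟨j, hj⟩⟩ | h⟩ := h₁ v (by simp; omega)
          · exact absurd h.2 hf
          · rw [hj.2.1]; exact (hpos j).ne'
          · omega
        refine ⟨v, hv, 0, hw, by simp, ?_⟩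
        have := (hj v hv hw).2.2
        by_contra hcon
        rw [if_neg (by omega)] at this
        exact hf this
      · obtain ⟨u, hu, d, hwu, hd, hlt⟩ := ih y hy (by
          have := (h₁ y (by simp; omega)).2.1; omega)
        refine ⟨u, hu, d + 1, hwu, ?_, by omega⟩
        calc G.edist ⟨u, hu⟩ ⟨v, hv⟩ ≤ G.edist ⟨u, hu⟩ ⟨y, hy⟩ + G.edist ⟨y, hy⟩ ⟨v, hv⟩ :=
              SimpleGraph.edist_triangle
          _ ≤ d + 1 := by
              rw [SimpleGraph.edist_eq_one_iff_adj.2 hvy.symm]; gcongr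
          _ = ((d + 1 : ℕ) : ℕ∞) := by simp
  have hsum : ∑ v ∈ S, N ^ j v = ∑ i ∈ Finset.range b, N ^ (i / g) := by
    rw [targetWeight, Finset.sum_range_succ, hwn, add_zero] at h₂
    rw [← h₂, hS, Finset.sum_filter]
    refine Finset.sum_congr rfl fun v hv => ?_
    split
    · rename_i hw; exact (hj v (by simpa using hv) hw).2.1.symm
    · rename_i hw; simpa [eq_comm] using hw
  -- There are at most `n < N` centres and `b ≤ n < N` radii, so the digits determine the classes
  -- and `e` sends each centre to a radius of its class.
  obtain ⟨e, he, hinj⟩ := exists_injOn_of_sum_pow_eq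
    ((Finset.card_filter_le _ _).trans_lt (by simpa using hN)) (by simp; omega) hsum
  -- The empty graph has no vertex to serve as a centre, so the family of balls must be empty. This
  -- is where `g = 1` for `b = 0` is needed.
  rcases Nat.eq_zero_or_pos n with rfl | hn
  · have : b = 0 := by omega
    rw [hbg this, this]
    exact ⟨Fin.elim0, fun v => v.elim0⟩
  classical
  -- The vertex matched with radius `i` becomes the centre of the ball of radius `i + (g - 1)`.
  -- Indices that are not attained get the vertex 0 as a default.
  refine ⟨fun i => if h : ∃ v, ∃ (_ : v < n), w v ≠ 0 ∧ e v + (g - 1) = i then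
    ⟨h.choose, h.choose_spec.choose⟩ else ⟨0, hn⟩, fun v => ?_⟩
  obtain ⟨u, hu, d, hwu, hd, hlt⟩ := hcov _ v.1 v.2 le_rfl
  have huS : u ∈ S := by simp [hS, hu, hwu]
  obtain ⟨hub, huj⟩ := he u huS
  have hub' := Finset.mem_range.1 hub
  refine ⟨⟨e u + (g - 1), by omega⟩, ?_⟩
  have hex : ∃ v, ∃ (_ : v < n), w v ≠ 0 ∧ e v + (g - 1) = e u + (g - 1) := ⟨u, hu, hwu, rfl⟩
  have hch : hex.choose = u := by
    obtain ⟨h1, h2, h3⟩ := hex.choose_spec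
    exact hinj (Finset.mem_filter.2 ⟨Finset.mem_range.2 h1, h2⟩) huS (by omega)
  simp only [hex, dif_pos, hch]
  refine hd.trans ?_
  have : j u * g ≤ e u := by rw [← huj]; exact Nat.div_mul_le_self _ _
  rw [add_mul] at hlt
  exact_mod_cast (by omega : d ≤ e u + (g - 1))

/-- The centres of a cover by at most `n` balls may be taken to be distinct. -/
theorem SimpleGraph.CoveredByBalls.exists_injective {n b : ℕ} {G : SimpleGraph (Fin n)}
    (h : G.CoveredByBalls b) (hb : b ≤ n) :
    ∃ c : Fin b → Fin n, Function.Injective c ∧ ∀ v, ∃ i : Fin b, G.edist (c i) v ≤ (i : ℕ) := by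
  classical
  obtain ⟨c, hc⟩ := h
  -- Of all balls with a common centre only the largest stays. It contains the others, which may
  -- move to free vertices because `b ≤ n`.
  set S : Finset (Fin b) := Finset.univ.filter fun i => ∀ k, c k = c i → k ≤ i with hS
  have hinj : Set.InjOn c S := fun i hi k hk hik => by
    simp only [hS, Finset.coe_filter, Finset.mem_univ, true_and, Set.mem_ofPred_eq] at hi hk
    exact le_antisymm (hk i hik) (hi k hik.symm)
  have hmax : ∀ i, ∃ k ∈ S, i ≤ k ∧ c k = c i := by
    intro i
    obtain ⟨k, hk, hk'⟩ := (Finset.univ.filter fun k => c k = c i).exists_max_image id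
      ⟨i, by simp⟩
    simp only [Finset.mem_filter, Finset.mem_univ, true_and, id] at hk hk'
    exact ⟨k, by simpa [hS] using fun l hl => hk' l (hl.trans hk), hk' i rfl, hk⟩
  obtain ⟨t, hSt, ht⟩ := Finset.exists_superset_card_eq (s := S.image c) (n := b)
    (Finset.card_image_le.trans ((Finset.card_le_univ S).trans (by simp))) (by simpa using hb)
  obtain ⟨e, he⟩ := Finset.exists_equiv_extend_of_card_eq (by simpa using ht.symm) hSt hinj
  refine ⟨fun i => e i, fun i k hik => e.injective (Subtype.ext hik), fun v => ?_⟩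
  obtain ⟨i, hi⟩ := hc v
  obtain ⟨k, hk, hik, hck⟩ := hmax i
  refine ⟨k, ?_⟩
  simp only [he k hk, hck]
  exact hi.trans (by exact_mod_cast hik)

/-- Take as level of `v` the largest slack with which a ball covers `v`. If a ball attaining it is
centred at `v`, the level is at most its radius and the flag is set; otherwise the next vertex
towards the centre has a larger slack. Distinct centres ensure that each weight is 0 or a single
power of `N`. -/
theorem labelling_of_coveredByBalls {n N g b L : ℕ} {G : SimpleGraph (Fin n)} (hg : 0 < g) (hbn : b ≤ n) (hL : targetWeight N g b < L) (hbL : b < L)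
    (h : G.CoveredByBalls b) :
    Labelling G.natAdj (InitLabel n N g b L) (Finset.range (n + 1)) (targetWeight N g b) := by
  classical
  obtain ⟨c, hinj, hc⟩ := h.exists_injective hbn
  set W : Fin n → ℕ := fun v => ∑ i, if c i = v then N ^ ((i : ℕ) / g) else 0 with hW
  have hWc : ∀ i, W (c i) = N ^ ((i : ℕ) / g) := fun i => by
    simp [hW, hinj.eq_iff]
  have hWsum : ∑ v, W v = targetWeight N g b := by
    rw [hW, Finset.sum_comm, targetWeight, Finset.sum_range]
    simp
  set P : Fin n → ℕ → Prop := fun v k => ∃ i, G.edist (c i) v + k ≤ (i : ℕ) with hP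
  set T : Fin n → ℕ := fun v => Nat.findGreatest (P v) b with hT
  have hPb : ∀ v k, P v k → k < b := by
    rintro v k ⟨i, hi⟩
    have : (k : ℕ∞) ≤ (i : ℕ) := le_add_self.trans hi
    exact (by exact_mod_cast this : k ≤ i).trans_lt i.2
  have hTP : ∀ v, P v (T v) := fun v => by
    obtain ⟨i, hi⟩ := hc v
    exact Nat.findGreatest_spec (P := P v) (Nat.zero_le b) ⟨i, by simpa using hi⟩
  have hTle : ∀ v k, P v k → k ≤ T v := fun v k hk =>
    Nat.le_findGreatest (hPb v k hk).le hk
  set F : Fin n → ℕ := fun v => if ∃ i, c i = v ∧ T v < ((i : ℕ) / g + 1) * g then 1 else 0 with hF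
  have hlt : ∀ i, i < (i / g + 1) * g := fun i => by
    rw [mul_comm]; exact Nat.lt_mul_div_succ i hg
  have hstep : ∀ {x y : Fin n} (q : G.Walk x y), x = y ∨
      ∃ (z : Fin n) (r : G.Walk z y), G.Adj x z ∧ q.length = r.length + 1 := by
    intro x y q
    cases q with
    | nil => exact .inl rfl
    | cons h r => exact .inr ⟨_, r, h, rfl⟩
  refine ⟨fun v => if h : v < n then W ⟨v, h⟩ else 0, fun v => if h : v < n then T ⟨v, h⟩ else 0,
    fun v => if h : v < n then F ⟨v, h⟩ else 1, ?_, ?_, ?_⟩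
  · intro v hv
    by_cases hvn : v < n
    · simp only [hvn, dif_pos]
      refine ⟨?_, (hPb _ _ (hTP _)).trans hbL, .inl ⟨hvn, ?_⟩⟩
      · rw [← hWsum] at hL
        exact (Finset.single_le_sum (fun _ _ => Nat.zero_le _) (Finset.mem_univ _)).trans_lt hL
      · by_cases hex : ∃ i, c i = ⟨v, hvn⟩
        · obtain ⟨i, hi⟩ := hex
          refine .inr ⟨(i : ℕ) / g, (Nat.div_mul_le_self _ _).trans_lt i.2, by rw [← hi, hWc], ?_⟩
          simp only [hF]
          refine if_congr ⟨?_, fun h => ⟨i, hi, h⟩⟩ rfl rfl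
          rintro ⟨k, hk, h⟩
          rwa [hinj (hk.trans hi.symm)] at h
        · left
          push Not at hex
          constructor
          · simp [hW, hex]
          · simp [hF, hex]
    · simp only [hvn, dif_neg, not_false_eq_true]
      simp only [Finset.mem_range] at hv
      exact ⟨by omega, by omega, .inr ⟨by omega, rfl, rfl, rfl⟩⟩
  · rw [Finset.sum_range_succ, ← hWsum, Finset.sum_range]
    simp
  · intro v hv
    by_cases hvn : v < n
    · simp only [hvn, dif_pos]
      obtain ⟨i, hi⟩ := hTP ⟨v, hvn⟩
      have hne : G.edist (c i) ⟨v, hvn⟩ ≠ ⊤ := by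
        intro h; rw [h] at hi; simp at hi
      obtain ⟨q, hq⟩ := SimpleGraph.exists_walk_of_edist_ne_top hne
      rw [← hq] at hi
      have hi' : q.length + T ⟨v, hvn⟩ ≤ i := by exact_mod_cast hi
      -- The reversed geodesic starts at `v`, and its first step leads to a neighbour one closer to
      -- the centre.
      rcases hstep q.reverse with hvc | ⟨y, r, hadj, hlen⟩
      · left
        have hex : ∃ k, c k = ⟨v, hvn⟩ ∧ T ⟨v, hvn⟩ < ((k : ℕ) / g + 1) * g :=
          ⟨i, hvc.symm, (by omega : T ⟨v, hvn⟩ ≤ i).trans_lt (hlt i)⟩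
        simp only [hF, hex, if_true]
        exact one_ne_zero
      · right
        rw [SimpleGraph.Walk.length_reverse] at hlen
        refine ⟨y, by simp, ⟨hvn, y.2, hadj⟩, ?_⟩
        simp only [y.2, dif_pos]
        refine Nat.lt_of_succ_le (hTle y _ ⟨i, ?_⟩)
        calc G.edist (c i) y + ((T ⟨v, hvn⟩).succ : ℕ)
            ≤ r.reverse.length + ((T ⟨v, hvn⟩).succ : ℕ) := by
              gcongr; exact SimpleGraph.edist_le _
          _ ≤ (i : ℕ) := by
              rw [SimpleGraph.Walk.length_reverse]; exact_mod_cast (by omega)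
    · left; simp [hvn]

/-! ### The program -/

namespace RAM

/-! ### Registers and arrays of the program -/

namespace Reg

/-- number of vertices -/ @[simp] abbrev n : ℕ := 1
/-- number of classes of radii -/ @[simp] abbrev K : ℕ := 2
/-- a bound for weights, levels and table numbers -/ @[simp] abbrev L : ℕ := 3
/-- number of vertices, including the dummy -/ @[simp] abbrev n1 : ℕ := 4
/-- the number 2 -/ @[simp] abbrev two : ℕ := 5
/-- length of the multiplication table -/ @[simp] abbrev L4 : ℕ := 6
/-- an accumulator -/ @[simp] abbrev acc : ℕ := 7
/-- exponent of `L` -/ @[simp] abbrev expL : ℕ := 8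
/-- exponent of `L4` -/ @[simp] abbrev expL4 : ℕ := 9
/-- number of balls -/ @[simp] abbrev b : ℕ := 10
/-- number of radii in a class -/ @[simp] abbrev g : ℕ := 11
/-- product of `g` and `K` -/ @[simp] abbrev gK : ℕ := 12
/-- number of the current table -/ @[simp] abbrev tau : ℕ := 13
/-- whether a solution was found -/ @[simp] abbrev found : ℕ := 14
/-- the result -/ @[simp] abbrev res : ℕ := 15
/-- total weight of the balls -/ @[simp] abbrev target : ℕ := 16
/-- the vertex to be eliminated -/ @[simp] abbrev sel : ℕ := 17
/-- its neighbour -/ @[simp] abbrev par : ℕ := 18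
/-- counter of elimination steps -/ @[simp] abbrev step : ℕ := 19
/-- loop variable -/ @[simp] abbrev v : ℕ := 20
/-- loop variable -/ @[simp] abbrev w : ℕ := 21
/-- loop variable -/ @[simp] abbrev x : ℕ := 22
/-- loop variable -/ @[simp] abbrev s₁ : ℕ := 23
/-- loop variable -/ @[simp] abbrev s₂ : ℕ := 24
/-- loop variable -/ @[simp] abbrev t₁ : ℕ := 25
/-- loop variable -/ @[simp] abbrev t₂ : ℕ := 26
/-- loop variable -/ @[simp] abbrev f₁ : ℕ := 27
/-- loop variable -/ @[simp] abbrev f₂ : ℕ := 28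
/-- loop variable -/ @[simp] abbrev j : ℕ := 29

end Reg

namespace Arr

/-- the adjacency matrix -/ @[simp] abbrev adj : ℕ := 0
/-- multiples of `n` -/ @[simp] abbrev row : ℕ := 1
/-- multiples of `L` -/ @[simp] abbrev mul : ℕ := 2
/-- powers of `n + 2` -/ @[simp] abbrev pow : ℕ := 3
/-- multiples of `g` -/ @[simp] abbrev cls : ℕ := 4
/-- the tables of admitted labels -/ @[simp] abbrev D : ℕ := 5
/-- eliminated vertices -/ @[simp] abbrev rem : ℕ := 6
/-- vertices with two neighbours -/ @[simp] abbrev bad : ℕ := 7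
/-- copy of the next table -/ @[simp] abbrev E : ℕ := 8

end Arr

/-- Index of the entry `(e, f)` in a two-dimensional array. -/
def index₂ (e f : Expr) : Expr := .add (.load Arr.mul e) f

/-- Index of an entry in a five-dimensional array. -/
def index₅ (e₁ e₂ e₃ e₄ e₅ : Expr) : Expr := index₂ (index₂ (index₂ (index₂ e₁ e₂) e₃) e₄) e₅

/-- The sequential composition of a list of programs. -/
def block : List Stmt → Stmt
  | [] => .skip
  | [p] => p
  | p :: ps => .seq p (block ps)

/-- Conditional execution. -/
def when (e : Expr) (p : Stmt) : Stmt := .ite e p .skip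

/-- Adjacency of `v` and `w`. -/
def adjE (v w : Expr) : Expr := .load Arr.adj (.add (.load Arr.row v) w)

/-- Whether `v` has been eliminated. -/
def remE (v : Expr) : Expr := .load Arr.rem (index₂ (.var Reg.b) v)

/-- The number of the next table. -/
def nextE : Expr := .add (.var Reg.tau) (.lit 1)

/-- Marks the vertices with two remaining neighbours. -/
def markBad : Stmt :=
  .loop Reg.v Reg.n (.loop Reg.w Reg.n (.loop Reg.x Reg.n
    (when (.sub (adjE (.var Reg.v) (.var Reg.w)) (remE (.var Reg.w)))
      (when (.sub (adjE (.var Reg.v) (.var Reg.x)) (remE (.var Reg.x)))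
        (when (.sub (.var Reg.x) (.var Reg.w))
          (.store Arr.bad (index₂ (.var Reg.tau) (.var Reg.v)) (.lit 1)))))))

/-- Searches a remaining vertex without two remaining neighbours. -/
def findSel : Stmt :=
  .loop Reg.v Reg.n (.ite (.sub (.lit 1) (.add (remE (.var Reg.v))
      (.load Arr.bad (index₂ (.var Reg.tau) (.var Reg.v)))))
    (.assign Reg.sel (.var Reg.v)) .skip)

/-- Searches the neighbour of the selected vertex. -/
def findPar : Stmt :=
  .loop Reg.w Reg.n (.ite (.sub (adjE (.var Reg.sel) (.var Reg.w)) (remE (.var Reg.w)))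
    (.assign Reg.par (.var Reg.w)) .skip)

/-- Entries of the next table for all vertices but the neighbour. -/
def keepLabels : Stmt :=
  .loop Reg.v Reg.n1 (.loop Reg.s₁ Reg.L (.loop Reg.t₁ Reg.L (.loop Reg.f₁ Reg.two
    (when (.load Arr.D (index₅ (.var Reg.tau) (.var Reg.v) (.var Reg.s₁) (.var Reg.t₁)
        (.var Reg.f₁)))
      (when (.add (.sub (.var Reg.v) (.var Reg.par)) (.sub (.var Reg.par) (.var Reg.v)))
        (.store Arr.E (index₅ nextE (.var Reg.v) (.var Reg.s₁) (.var Reg.t₁) (.var Reg.f₁))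
          (.lit 1)))))))

/-- Entries of the next table for the neighbour. -/
def mergeLabels : Stmt :=
  .loop Reg.s₁ Reg.L (.loop Reg.s₂ Reg.L (.loop Reg.t₁ Reg.L (.loop Reg.t₂ Reg.L
    (.loop Reg.f₁ Reg.two (.loop Reg.f₂ Reg.two
      (when (.load Arr.D (index₅ (.var Reg.tau) (.var Reg.par) (.var Reg.s₁) (.var Reg.t₁)
          (.var Reg.f₁)))
        (when (.load Arr.D (index₅ (.var Reg.tau) (.var Reg.sel) (.var Reg.s₂) (.var Reg.t₂)
            (.var Reg.f₂)))
          (when (.add (.var Reg.f₂) (.sub (.var Reg.t₁) (.var Reg.t₂)))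
            (when (.sub (.var Reg.L) (.add (.var Reg.s₁) (.var Reg.s₂)))
              (.store Arr.E (index₅ nextE (.var Reg.par) (.add (.var Reg.s₁) (.var Reg.s₂))
                (.var Reg.t₁) (.sub (.lit 1) (.sub (.lit 1)
                  (.add (.var Reg.f₁) (.sub (.var Reg.t₂) (.var Reg.t₁)))))) (.lit 1)))))))))))

/-- Moves the next table into its place. -/
def moveLabels : Stmt :=
  .loop Reg.v Reg.n1 (.loop Reg.s₁ Reg.L (.loop Reg.t₁ Reg.L (.loop Reg.f₁ Reg.two
    (when (.load Arr.E (index₅ nextE (.var Reg.v) (.var Reg.s₁) (.var Reg.t₁) (.var Reg.f₁)))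
      (.store Arr.D (index₅ nextE (.var Reg.v) (.var Reg.s₁) (.var Reg.t₁) (.var Reg.f₁))
        (.lit 1))))))

/-- Elimination of one vertex. -/
def elimStep : Stmt := block [markBad, findSel, .assign Reg.par (.var Reg.n), findPar, keepLabels,
  mergeLabels, moveLabels,
  .store Arr.rem (index₂ (.var Reg.b) (.var Reg.sel)) (.lit 1), .assign Reg.tau nextE]

/-- The first table: labels of vertices without balls. -/
def initPlain : Stmt :=
  .loop Reg.v Reg.n (.loop Reg.t₁ Reg.L
    (.store Arr.D (index₅ (.var Reg.tau) (.var Reg.v) (.lit 0) (.var Reg.t₁) (.lit 0)) (.lit 1)))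

/-- The first table: labels of vertices with balls. -/
def initBalls : Stmt :=
  .loop Reg.v Reg.n (.loop Reg.t₁ Reg.L (.loop Reg.j Reg.K
    (when (.sub (.var Reg.b) (.load Arr.cls (.var Reg.j)))
      (.store Arr.D (index₅ (.var Reg.tau) (.var Reg.v) (.load Arr.pow (.var Reg.j)) (.var Reg.t₁)
        (.sub (.lit 1) (.sub (.lit 1)
          (.sub (.load Arr.cls (.add (.var Reg.j) (.lit 1))) (.var Reg.t₁))))) (.lit 1)))))

/-- The first table: the label of the dummy. -/
def initDummy : Stmt :=
  .store Arr.D (index₅ (.var Reg.tau) (.var Reg.n) (.lit 0) (.lit 0) (.lit 1)) (.lit 1)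

/-- The bounds of the classes of radii. -/
def fillClasses : Stmt :=
  .loop Reg.j Reg.K (.store Arr.cls (.add (.var Reg.j) (.lit 1))
    (.add (.load Arr.cls (.var Reg.j)) (.var Reg.g)))

/-- The total weight of the balls. -/
def sumTarget : Stmt :=
  .loop Reg.j Reg.K (.loop Reg.v Reg.n
    (when (.sub (.var Reg.b) (.var Reg.v))
      (when (.sub (.add (.var Reg.v) (.lit 1)) (.load Arr.cls (.var Reg.j)))
        (when (.sub (.load Arr.cls (.add (.var Reg.j) (.lit 1))) (.var Reg.v))
          (.assign Reg.target (.add (.var Reg.target) (.load Arr.pow (.var Reg.j))))))))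

/-- The size of the classes. -/
def updateSize : Stmt :=
  when (.sub (.add (.var Reg.b) (.lit 1)) (.var Reg.gK))
    (.seq (.assign Reg.g (.add (.var Reg.g) (.lit 1)))
      (.assign Reg.gK (.add (.var Reg.gK) (.var Reg.K))))

/-- Evaluation of the last table. -/
def readResult : Stmt :=
  .ite (.var Reg.found) .skip
    (when (.load Arr.D (index₅ (.var Reg.tau) (.var Reg.n) (.var Reg.target) (.lit 0) (.lit 1)))
      (.seq (.assign Reg.found (.lit 1))
        (.assign Reg.res (.sub (.add (.var Reg.b) (.var Reg.g)) (.lit 1)))))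

/-- The preparations for a given number of balls. -/
def prepare : Stmt := block [updateSize, .store Arr.cls (.lit 0) (.lit 0), fillClasses,
  .assign Reg.target (.lit 0), sumTarget]

/-- The first table for a given number of balls. -/
def initLabels : Stmt := block [initPlain, initBalls, initDummy]

/-- Decides whether there is a solution with a given number of balls. -/
def tryBalls : Stmt := block [prepare, initLabels, .loop Reg.step Reg.n elimStep, readResult,
  .assign Reg.tau nextE]

/-- Stores the multiples of register `d` in array `a`. -/
def fillMultiples (a m d : ℕ) : Stmt :=
  .seq (.assign Reg.acc (.lit 0)) (.loop Reg.v m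
    (.seq (.store a (.var Reg.v) (.var Reg.acc))
      (.assign Reg.acc (.add (.var Reg.acc) (.var d)))))

/-- The multiplication tables. -/
def fillTables : Stmt :=
  .seq (fillMultiples Arr.row Reg.n Reg.n) (fillMultiples Arr.mul Reg.L4 Reg.L)

/-- Constants. -/
def setConstants (K : ℕ) : Stmt := block [
  .assign Reg.K (.lit K),
  .assign Reg.n (.var 0),
  .assign Reg.n1 (.add (.var Reg.n) (.lit 1)),
  .assign Reg.two (.lit 2),
  .assign Reg.expL (.add (.var Reg.K) (.lit 3)),
  .assign Reg.acc (.add (.var Reg.expL) (.var Reg.expL)),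
  .assign Reg.expL4 (.add (.var Reg.acc) (.var Reg.acc)),
  .store Arr.pow (.lit 0) (.lit 1)]

/-- The table of powers. -/
def fillPowers : Stmt := block [
  .loop Reg.j Reg.expL4 (block [
    .assign Reg.acc (.add (.load Arr.pow (.var Reg.j)) (.load Arr.pow (.var Reg.j))),
    .loop Reg.x Reg.n (.assign Reg.acc (.add (.var Reg.acc) (.load Arr.pow (.var Reg.j)))),
    .store Arr.pow (.add (.var Reg.j) (.lit 1)) (.var Reg.acc)]),
  .assign Reg.L (.load Arr.pow (.var Reg.expL)),
  .assign Reg.L4 (.load Arr.pow (.var Reg.expL4))]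

/-- The main part of the program. -/
def mainLoop : Stmt := block [
  fillTables,
  .assign Reg.g (.lit 1),
  .assign Reg.gK (.var Reg.K),
  .loop Reg.b Reg.n1 tryBalls,
  .assign 0 (.var Reg.res)]

/-! ### Constants, tables and addressing -/

/-- What the elimination steps need to know about the constants and tables. -/
structure Env (n K L : ℕ) (A : ℕ → ℕ → Prop) (s : State) : Prop where
  reg_n : s.reg Reg.n = n
  reg_K : s.reg Reg.K = K
  reg_L : s.reg Reg.L = L
  reg_n1 : s.reg Reg.n1 = n + 1
  reg_two : s.reg Reg.two = 2
  arr_adj_le : ∀ v < n, ∀ w < n, s.arr Arr.adj (v * n + w) ≤ 1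
  arr_adj : ∀ v < n, ∀ w < n, s.arr Arr.adj (v * n + w) ≠ 0 ↔ A v w
  arr_row : ∀ v < n, s.arr Arr.row v = v * n
  arr_mul : ∀ k < L ^ 4, s.arr Arr.mul k = k * L
  arr_pow : ∀ j < K, s.arr Arr.pow j = (n + 2) ^ j

theorem Env.congr {n K L : ℕ} {A : ℕ → ℕ → Prop} {s s' : State} (h : Env n K L A s)
    (hr : ∀ r ∈ [Reg.n, Reg.K, Reg.L, Reg.n1, Reg.two], s'.reg r = s.reg r)
    (ha : ∀ a ∈ [Arr.adj, Arr.row, Arr.mul, Arr.pow], s'.arr a = s.arr a) : Env n K L A s' := by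
  simp only [List.mem_cons, List.not_mem_nil, or_false, forall_eq_or_imp, forall_eq] at hr ha
  obtain ⟨h1, h2, h3, h4, h5⟩ := hr
  obtain ⟨a1, a2, a3, a4⟩ := ha
  constructor
  · rw [h1, h.reg_n]
  · rw [h2, h.reg_K]
  · rw [h3, h.reg_L]
  · rw [h4, h.reg_n1]
  · rw [h5, h.reg_two]
  · rw [a1]; exact h.arr_adj_le
  · rw [a1]; exact h.arr_adj
  · rw [a2]; exact h.arr_row
  · rw [a3]; exact h.arr_mul
  · rw [a4]; exact h.arr_pow

theorem Env.run {n K L : ℕ} {A : ℕ → ℕ → Prop} {s : State} (h : Env n K L A s) (p : Stmt)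
    (hr : ∀ r ∈ [Reg.n, Reg.K, Reg.L, Reg.n1, Reg.two], r ∉ p.wregs)
    (ha : ∀ a ∈ [Arr.adj, Arr.row, Arr.mul, Arr.pow], a ∉ p.warrs) : Env n K L A (p.run s) :=
  h.congr (fun r hr' => Stmt.run_reg (hr r hr') s) fun a ha' => Stmt.run_arr (ha a ha') s

theorem Env.setReg {n K L : ℕ} {A : ℕ → ℕ → Prop} {s : State} (h : Env n K L A s) {r : ℕ} (x : ℕ)
    (hr : r ∉ [Reg.n, Reg.K, Reg.L, Reg.n1, Reg.two]) : Env n K L A (s.setReg r x) :=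
  h.congr (fun r' hr' => by
    rw [State.setReg_reg, if_neg]; rintro rfl; exact hr hr') fun a _ => rfl

/-- Position of the entry `(τ, v, s, t, f)`. -/
def pos (L τ v s t f : ℕ) : ℕ := (((τ * L + v) * L + s) * L + t) * L + f

theorem mul_add_lt_pow {L k x y : ℕ} (hx : x < L ^ k) (hy : y < L) : x * L + y < L ^ (k + 1) := by
  have : (x + 1) * L ≤ L ^ k * L := Nat.mul_le_mul_right L hx
  rw [pow_succ]
  linarith [add_mul x 1 L]

theorem mul_add_injective {L x y x' y' : ℕ} (hy : y < L) (hy' : y' < L)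
    (h : x * L + y = x' * L + y') : x = x' ∧ y = y' := by
  have hx : x = x' := by
    rcases lt_trichotomy x x' with hlt | rfl | hlt
    · have := Nat.mul_le_mul_right L (Nat.succ_le_of_lt hlt); rw [Nat.succ_mul] at this; omega
    · rfl
    · have := Nat.mul_le_mul_right L (Nat.succ_le_of_lt hlt); rw [Nat.succ_mul] at this; omega
  subst hx
  exact ⟨rfl, by omega⟩

theorem pos_injective {L τ v s t f τ' v' s' t' f' : ℕ} (hv : v < L) (hs : s < L) (ht : t < L)
    (hf : f < L) (hv' : v' < L) (hs' : s' < L) (ht' : t' < L) (hf' : f' < L)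
    (h : pos L τ v s t f = pos L τ' v' s' t' f') :
    τ = τ' ∧ v = v' ∧ s = s' ∧ t = t' ∧ f = f' := by
  unfold pos at h
  obtain ⟨h₁, rfl⟩ := mul_add_injective hf hf' h
  obtain ⟨h₂, rfl⟩ := mul_add_injective ht ht' h₁
  obtain ⟨h₃, rfl⟩ := mul_add_injective hs hs' h₂
  obtain ⟨h₄, rfl⟩ := mul_add_injective hv hv' h₃
  exact ⟨h₄, rfl, rfl, rfl, rfl⟩

/-- Together with `le_pos` this confines table `τ` to a block of length `L ^ 4`, so later blocks are
still untouched when a new table is begun. -/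
theorem pos_lt {L τ v s t f : ℕ} (hv : v < L) (hs : s < L) (ht : t < L) (hf : f < L) :
    pos L τ v s t f < (τ + 1) * L ^ 4 := by
  have step : ∀ {x y k}, y < L → x < (τ + 1) * L ^ k → x * L + y < (τ + 1) * L ^ (k + 1) := by
    intro x y k hy hx
    have := Nat.mul_le_mul_right L (Nat.succ_le_of_lt hx)
    rw [Nat.succ_mul] at this
    rw [pow_succ, ← mul_assoc]
    omega
  have h0 : τ < (τ + 1) * L ^ 0 := by simp
  exact step hf (step ht (step hs (step hv h0)))

theorem le_pos (L τ v s t f : ℕ) : τ * L ^ 4 ≤ pos L τ v s t f := by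
  have : pos L τ v s t f = τ * L ^ 4 + (((v * L + s) * L + t) * L + f) := by
    unfold pos; ring
  omega

section Eval

variable {n K L : ℕ} {A : ℕ → ℕ → Prop} {σ : State}

theorem Env.eval_index₂ (h : Env n K L A σ) {e f : Expr} (he : e.eval σ < L ^ 4) :
    (index₂ e f).eval σ = e.eval σ * L + f.eval σ := by
  simp only [index₂, Expr.eval, h.arr_mul _ he]

/-- The first four coordinates are below `L`, so all numbers that have to be multiplied by `L` are
below `L ^ 4`, the length of the multiplication table. -/
theorem Env.eval_index₅ (h : Env n K L A σ) {e₁ e₂ e₃ e₄ e₅ : Expr} (h₁ : e₁.eval σ < L)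
    (h₂ : e₂.eval σ < L) (h₃ : e₃.eval σ < L) (h₄ : e₄.eval σ < L) :
    (index₅ e₁ e₂ e₃ e₄ e₅).eval σ =
      pos L (e₁.eval σ) (e₂.eval σ) (e₃.eval σ) (e₄.eval σ) (e₅.eval σ) := by
  have hL : 0 < L := by omega
  have hp : ∀ {x k}, k ≤ 4 → x < L ^ k → x < L ^ 4 := fun hk hx =>
    hx.trans_le (Nat.pow_le_pow_right hL hk)
  have a₁ : e₁.eval σ < L ^ 1 := by simpa using h₁
  have a₂ := mul_add_lt_pow a₁ h₂
  have a₃ := mul_add_lt_pow a₂ h₃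
  have a₄ := mul_add_lt_pow a₃ h₄
  have i₂ := h.eval_index₂ (f := e₂) (hp (by omega) a₁)
  have i₃ := h.eval_index₂ (e := index₂ e₁ e₂) (f := e₃) (hp (k := 1 + 1) (by omega) (by rw [i₂]; exact a₂))
  rw [i₂] at i₃
  have i₄ := h.eval_index₂ (e := index₂ (index₂ e₁ e₂) e₃) (f := e₄)
    (hp (k := 1 + 1 + 1) (by omega) (by rw [i₃]; exact a₃))
  rw [i₃] at i₄
  rw [index₅, h.eval_index₂ (hp le_rfl (by rw [i₄]; exact a₄)), i₄, pos]

theorem Env.eval_adjE (h : Env n K L A σ) {e f : Expr} (he : e.eval σ < n) :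
    (adjE e f).eval σ = σ.arr Arr.adj (e.eval σ * n + f.eval σ) := by
  simp only [adjE, Expr.eval, h.arr_row _ he]

theorem Env.eval_remE (h : Env n K L A σ) {e : Expr} (hb : σ.reg Reg.b < L) :
    (remE e).eval σ = σ.arr Arr.rem (σ.reg Reg.b * L + e.eval σ) := by
  have : σ.reg Reg.b < L ^ 4 := hb.trans_le (Nat.le_self_pow (by omega) L)
  rw [remE, Expr.eval, h.eval_index₂ (by simpa [Expr.eval] using this)]
  simp [Expr.eval]

/-- Truncated subtraction acts as "and not": a matrix entry is 0 or 1, and any nonzero removal mark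
cancels it. -/
theorem Env.eval_adj_sub_rem (h : Env n K L A σ) {e f : Expr} (he : e.eval σ < n)
    (hf : f.eval σ < n) (hb : σ.reg Reg.b < L) :
    (Expr.sub (adjE e f) (remE f)).eval σ ≠ 0 ↔
      A (e.eval σ) (f.eval σ) ∧ σ.arr Arr.rem (σ.reg Reg.b * L + f.eval σ) = 0 := by
  rw [Expr.eval, h.eval_adjE he, h.eval_remE hb, ← h.arr_adj _ he _ hf]
  have := h.arr_adj_le _ he _ hf
  omega

end Eval

end RAM

/-! ### Effects of the marking loops -/

namespace RAM

variable {n K L : ℕ} {A : ℕ → ℕ → Prop} {s : State}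

/-- The marked set is read off from the nesting: the rules of `Marks` fill in the placeholders, and
only the guards and indices remain to be evaluated. The other marking nests are treated in the same
way. -/
theorem marks_markBad (h : Env n K L A s) (hτ : s.reg Reg.tau < L)
    (hb : s.reg Reg.b < L) (k : ℕ) :
    (markBad.run s).arr Arr.bad k ≠ 0 ↔ s.arr Arr.bad k ≠ 0 ∨ ∃ v < n, ∃ w < n, ∃ x < n,
      (A v w ∧ s.arr Arr.rem (s.reg Reg.b * L + w) = 0) ∧
      (A v x ∧ s.arr Arr.rem (s.reg Reg.b * L + x) = 0) ∧ w < x ∧ k = s.reg Reg.tau * L + v := by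
  have hM : Marks markBad Arr.bad _ _ := .loop (.loop (.loop (.cond (.cond (.cond (.store _ 
    (by decide)) _ (by decide) (by decide)) _ (by decide) (by decide)) _ (by decide) (by decide))
    _ _ (by decide)) _ _ (by decide)) _ _ (by decide)
  rw [hM.run_ne_zero]
  simp only [Set.mem_ofPred_eq, State.setReg_reg, Reg.n, Reg.v, Reg.w, Reg.x,
    Nat.reduceEqDiff, if_false, h.reg_n, Set.mem_singleton_iff]
  refine or_congr_right (exists_congr fun v => and_congr_right fun hv => exists_congr fun w =>
    and_congr_right fun hw => exists_congr fun x => and_congr_right fun hx => ?_)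
  have hσ : Env n K L A (((s.setReg Reg.v v).setReg Reg.w w).setReg Reg.x x) :=
    ((h.setReg _ (by decide)).setReg _ (by decide)).setReg _ (by decide)
  rw [hσ.eval_adj_sub_rem, hσ.eval_adj_sub_rem, hσ.eval_index₂]
  · simp [Expr.eval, Nat.sub_ne_zero_iff_lt]
  all_goals simp [Expr.eval, *]
  exact hτ.trans_le (Nat.le_self_pow (by omega) L)

/-- The next table is built in the separate array `Arr.E` because `Marks` does not allow the marked
array to influence what is marked. It is copied to `Arr.D` afterwards. -/
theorem marks_keepLabels (h : Env n K L A s) (hn : n < L) (hτ : s.reg Reg.tau + 1 < L) (k : ℕ) :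
    (keepLabels.run s).arr Arr.E k ≠ 0 ↔ s.arr Arr.E k ≠ 0 ∨ ∃ v < n + 1, ∃ a < L, ∃ t < L,
      ∃ f < 2, s.arr Arr.D (pos L (s.reg Reg.tau) v a t f) ≠ 0 ∧ v ≠ s.reg Reg.par ∧
        k = pos L (s.reg Reg.tau + 1) v a t f := by
  have hM : Marks keepLabels Arr.E _ _ := .loop (.loop (.loop (.loop (.cond (.cond (.store _
    (by decide)) _ (by decide) (by decide)) _ (by decide) (by decide))
    _ _ (by decide)) _ _ (by decide)) _ _ (by decide)) _ _ (by decide)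
  rw [hM.run_ne_zero]
  simp only [Set.mem_ofPred_eq, State.setReg_reg, Reg.v, Reg.s₁, Reg.t₁, Reg.f₁, Reg.L, Reg.n1,
    Reg.two, Nat.reduceEqDiff, if_false, h.reg_n1, h.reg_L, h.reg_two, Set.mem_singleton_iff]
  refine or_congr_right (exists_congr fun v => and_congr_right fun hv => exists_congr fun a =>
    and_congr_right fun ha => exists_congr fun t => and_congr_right fun ht => exists_congr fun f =>
    and_congr_right fun hf => ?_)
  have hσ : Env n K L A ((((s.setReg Reg.v v).setReg Reg.s₁ a).setReg Reg.t₁ t).setReg Reg.f₁ f) :=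
    (((h.setReg _ (by decide)).setReg _ (by decide)).setReg _ (by decide)).setReg _ (by decide)
  rw [Expr.eval_load, hσ.eval_index₅, hσ.eval_index₅]
  · refine and_congr (by simp [Expr.eval]) (and_congr ?_ (by simp [Expr.eval, nextE]))
    simp [Expr.eval]; omega
  all_goals simp [Expr.eval, nextE] at hτ ⊢
  all_goals omega

theorem marks_mergeLabels (h : Env n K L A s) (hn : n < L) (hτ : s.reg Reg.tau + 1 < L)
    (hpar : s.reg Reg.par ≤ n) (hsel : s.reg Reg.sel < n) (k : ℕ) :
    (mergeLabels.run s).arr Arr.E k ≠ 0 ↔ s.arr Arr.E k ≠ 0 ∨ ∃ s₁ < L, ∃ s₂ < L, ∃ t₁ < L,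
      ∃ t₂ < L, ∃ f₁ < 2, ∃ f₂ < 2,
        s.arr Arr.D (pos L (s.reg Reg.tau) (s.reg Reg.par) s₁ t₁ f₁) ≠ 0 ∧
        s.arr Arr.D (pos L (s.reg Reg.tau) (s.reg Reg.sel) s₂ t₂ f₂) ≠ 0 ∧
        (f₂ ≠ 0 ∨ t₂ < t₁) ∧ s₁ + s₂ < L ∧
        k = pos L (s.reg Reg.tau + 1) (s.reg Reg.par) (s₁ + s₂) t₁
          (1 - (1 - (f₁ + (t₂ - t₁)))) := by
  have hM : Marks mergeLabels Arr.E _ _ := .loop (.loop (.loop (.loop (.loop (.loop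
    (.cond (.cond (.cond (.cond (.store _ (by decide)) _ (by decide) (by decide))
      _ (by decide) (by decide)) _ (by decide) (by decide)) _ (by decide) (by decide))
    _ _ (by decide)) _ _ (by decide)) _ _ (by decide)) _ _ (by decide)) _ _ (by decide))
    _ _ (by decide)
  rw [hM.run_ne_zero]
  simp only [Set.mem_ofPred_eq, State.setReg_reg, Reg.s₁, Reg.t₁, Reg.f₁, Reg.s₂, Reg.t₂, Reg.f₂,
    Reg.L, Reg.two, Nat.reduceEqDiff, if_false, h.reg_L, h.reg_two, Set.mem_singleton_iff]
  refine or_congr_right (exists_congr fun s₁ => and_congr_right fun hs₁ => exists_congr fun s₂ =>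
    and_congr_right fun hs₂ => exists_congr fun t₁ => and_congr_right fun ht₁ =>
    exists_congr fun t₂ => and_congr_right fun ht₂ => exists_congr fun f₁ =>
    and_congr_right fun hf₁ => exists_congr fun f₂ => and_congr_right fun hf₂ => ?_)
  have hσ : Env n K L A ((((((s.setReg Reg.s₁ s₁).setReg Reg.s₂ s₂).setReg Reg.t₁ t₁).setReg
      Reg.t₂ t₂).setReg Reg.f₁ f₁).setReg Reg.f₂ f₂) :=
    (((((h.setReg _ (by decide)).setReg _ (by decide)).setReg _ (by decide)).setReg _
      (by decide)).setReg _ (by decide)).setReg _ (by decide)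
  -- For larger sums the target index may leave the multiplication table, so nothing is known about
  -- its value, but then the guard fails.
  by_cases hL : s₁ + s₂ < L
  · rw [Expr.eval_load, Expr.eval_load, hσ.eval_index₅, hσ.eval_index₅, hσ.eval_index₅]
    · have := h.reg_L
      simp only [Reg.L] at this
      simp [Expr.eval, nextE, Nat.sub_ne_zero_iff_lt, this]
      omega
    all_goals simp [Expr.eval, nextE] at hτ hpar hsel ⊢
    all_goals omega
  · have h0 := h.reg_L
    simp only [Reg.L] at h0
    have h1 : L - (s₁ + s₂) = 0 := by omega
    simp [Expr.eval, h0, h1, hL]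

theorem marks_moveLabels (h : Env n K L A s) (hn : n < L) (hτ : s.reg Reg.tau + 1 < L) (k : ℕ) :
    (moveLabels.run s).arr Arr.D k ≠ 0 ↔ s.arr Arr.D k ≠ 0 ∨ ∃ v < n + 1, ∃ a < L, ∃ t < L,
      ∃ f < 2, s.arr Arr.E (pos L (s.reg Reg.tau + 1) v a t f) ≠ 0 ∧
        k = pos L (s.reg Reg.tau + 1) v a t f := by
  have hM : Marks moveLabels Arr.D _ _ := .loop (.loop (.loop (.loop (.cond (.store _
    (by decide)) _ (by decide) (by decide))
    _ _ (by decide)) _ _ (by decide)) _ _ (by decide)) _ _ (by decide)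
  rw [hM.run_ne_zero]
  simp only [Set.mem_ofPred_eq, State.setReg_reg, Reg.v, Reg.s₁, Reg.t₁, Reg.f₁, Reg.L, Reg.n1,
    Reg.two, Nat.reduceEqDiff, if_false, h.reg_n1, h.reg_L, h.reg_two, Set.mem_singleton_iff]
  refine or_congr_right (exists_congr fun v => and_congr_right fun hv => exists_congr fun a =>
    and_congr_right fun ha => exists_congr fun t => and_congr_right fun ht => exists_congr fun f =>
    and_congr_right fun hf => ?_)
  have hσ : Env n K L A ((((s.setReg Reg.v v).setReg Reg.s₁ a).setReg Reg.t₁ t).setReg Reg.f₁ f) :=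
    (((h.setReg _ (by decide)).setReg _ (by decide)).setReg _ (by decide)).setReg _ (by decide)
  rw [Expr.eval_load, hσ.eval_index₅]
  · simp [Expr.eval, nextE]
  all_goals simp [Expr.eval, nextE] at hτ ⊢
  all_goals omega

theorem marks_initPlain (h : Env n K L A s) (hn : n < L) (hτ : s.reg Reg.tau < L) (k : ℕ) :
    (initPlain.run s).arr Arr.D k ≠ 0 ↔ s.arr Arr.D k ≠ 0 ∨ ∃ v < n, ∃ t < L,
      k = pos L (s.reg Reg.tau) v 0 t 0 := by
  have hM : Marks initPlain Arr.D _ _ :=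
    .loop (.loop (.store _ (by decide)) _ _ (by decide)) _ _ (by decide)
  rw [hM.run_ne_zero]
  simp only [Set.mem_ofPred_eq, State.setReg_reg, Reg.v, Reg.t₁, Reg.L, Reg.n,
    Nat.reduceEqDiff, if_false, h.reg_n, h.reg_L, Set.mem_singleton_iff]
  refine or_congr_right (exists_congr fun v => and_congr_right fun hv => exists_congr fun t =>
    and_congr_right fun ht => ?_)
  have hσ : Env n K L A ((s.setReg Reg.v v).setReg Reg.t₁ t) :=
    (h.setReg _ (by decide)).setReg _ (by decide)
  rw [hσ.eval_index₅]
  · simp [Expr.eval]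
  all_goals simp [Expr.eval] at hτ ⊢
  all_goals omega

theorem marks_initBalls {g : ℕ} (h : Env n K L A s) (hn : n < L) (hτ : s.reg Reg.tau < L)
    (hK : (n + 2) ^ K ≤ L) (hcls : ∀ j ≤ K, s.arr Arr.cls j = j * g) (k : ℕ) :
    (initBalls.run s).arr Arr.D k ≠ 0 ↔ s.arr Arr.D k ≠ 0 ∨ ∃ v < n, ∃ t < L, ∃ j < K,
      j * g < s.reg Reg.b ∧ k = pos L (s.reg Reg.tau) v ((n + 2) ^ j) t
        (1 - (1 - ((j + 1) * g - t))) := by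
  have hM : Marks initBalls Arr.D _ _ := .loop (.loop (.loop (.cond (.store _ (by decide))
    _ (by decide) (by decide)) _ _ (by decide)) _ _ (by decide)) _ _ (by decide)
  rw [hM.run_ne_zero]
  simp only [Set.mem_ofPred_eq, State.setReg_reg, Reg.v, Reg.t₁, Reg.j, Reg.L, Reg.n, Reg.K,
    Nat.reduceEqDiff, if_false, h.reg_n, h.reg_L, h.reg_K, Set.mem_singleton_iff]
  refine or_congr_right (exists_congr fun v => and_congr_right fun hv => exists_congr fun t =>
    and_congr_right fun ht => exists_congr fun j => and_congr_right fun hj => ?_)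
  have hσ : Env n K L A (((s.setReg Reg.v v).setReg Reg.t₁ t).setReg Reg.j j) :=
    ((h.setReg _ (by decide)).setReg _ (by decide)).setReg _ (by decide)
  have hp := h.arr_pow j hj
  have hc := hcls j hj.le
  have hc' := hcls (j + 1) hj
  have hjL : (n + 2) ^ j < L := (Nat.pow_lt_pow_right (by omega) hj).trans_le hK
  simp only [Arr.pow, Arr.cls] at hp hc hc'
  rw [hσ.eval_index₅]
  · simp [Expr.eval, hp, hc, hc', Nat.sub_ne_zero_iff_lt]
  all_goals simp [Expr.eval, hp] at hτ ⊢
  all_goals omega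

theorem marks_initDummy (h : Env n K L A s) (hn : n < L) (hτ : s.reg Reg.tau < L) (k : ℕ) :
    (initDummy.run s).arr Arr.D k ≠ 0 ↔ s.arr Arr.D k ≠ 0 ∨ k = pos L (s.reg Reg.tau) n 0 0 1 := by
  have hM : Marks initDummy Arr.D _ _ := .store _ (by decide)
  have h0 := h.reg_n
  rw [hM.run_ne_zero, Set.mem_singleton_iff, h.eval_index₅]
  · simp [Expr.eval] at h0 ⊢; rw [h0]
  all_goals simp [Expr.eval] at hτ h0 ⊢
  all_goals omega

end RAM

/-! ### One elimination step -/

namespace RAM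

variable {n K L : ℕ} {A : ℕ → ℕ → Prop} {s : State}

/-- The labels in the current table. -/
def Label (L : ℕ) (s : State) (v a t f : ℕ) : Prop :=
  a < L ∧ t < L ∧ f < 2 ∧ s.arr Arr.D (pos L (s.reg Reg.tau) v a t f) ≠ 0

/-- The vertices that have not been eliminated, including the dummy `n`. -/
def remaining (n L : ℕ) (s : State) : Finset ℕ :=
  (Finset.range (n + 1)).filter fun v => s.arr Arr.rem (s.reg Reg.b * L + v) = 0

/-- The part of the arrays that is still unused, and the state of the dummy. -/
structure StepInv (n L : ℕ) (s : State) : Prop where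
  freshD : ∀ k, (s.reg Reg.tau + 1) * L ^ 4 ≤ k → s.arr Arr.D k = 0
  freshE : ∀ k, (s.reg Reg.tau + 1) * L ^ 4 ≤ k → s.arr Arr.E k = 0
  freshBad : ∀ k, s.reg Reg.tau * L ≤ k → s.arr Arr.bad k = 0
  freshRem : ∀ k, (s.reg Reg.b + 1) * L ≤ k → s.arr Arr.rem k = 0
  rem_dummy : s.arr Arr.rem (s.reg Reg.b * L + n) = 0
  label_dummy : ∀ a t f, Label L s n a t f → t = 0 ∧ f = 1

/-- `A` is the adjacency relation of a forest on the vertices below `n`. -/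
structure IsForest (n : ℕ) (A : ℕ → ℕ → Prop) : Prop where
  symm : ∀ v w, A v w → A w v
  irrefl : ∀ v, ¬ A v v
  lt : ∀ v w, A v w → w < n
  exists_leaf : ∀ U : Finset ℕ, (∀ v ∈ U, v < n) → U.Nonempty →
    ∃ v ∈ U, ∀ w₁ ∈ U, ∀ w₂ ∈ U, A v w₁ → A v w₂ → w₁ = w₂

theorem mem_remaining {v : ℕ} : v ∈ remaining n L s ↔
    v ≤ n ∧ s.arr Arr.rem (s.reg Reg.b * L + v) = 0 := by
  simp [remaining]

/-- The selected vertex remains and has at most one remaining neighbour. -/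
theorem findSel_spec (h : Env n K L A s) (hI : StepInv n L s) (hA : IsForest n A)
    (hτ : s.reg Reg.tau < L) (hb : s.reg Reg.b < L)
    (hcard : 2 ≤ (remaining n L s).card) :
    let x := (findSel.run (markBad.run s)).reg Reg.sel
    x < n ∧ x ∈ remaining n L s ∧ ∀ w₁ ∈ remaining n L s, ∀ w₂ ∈ remaining n L s,
      A x w₁ → A x w₂ → w₁ = w₂ := by
  intro x
  -- Row `tau` was still zero, so all marks in it are new.
  have hbad : ∀ v < n, (markBad.run s).arr Arr.bad (s.reg Reg.tau * L + v) ≠ 0 ↔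
      ∃ w ∈ remaining n L s, ∃ y ∈ remaining n L s, A v w ∧ A v y ∧ w < y := by
    intro v hv
    rw [marks_markBad h hτ hb, hI.freshBad _ (Nat.le_add_right _ _)]
    simp only [ne_eq, not_true, false_or, Nat.add_left_cancel_iff, mem_remaining]
    constructor
    · rintro ⟨v', -, w, hw, y, hy, ⟨h₁, h₂⟩, ⟨h₃, h₄⟩, hwy, rfl⟩
      exact ⟨w, ⟨hw.le, h₂⟩, y, ⟨hy.le, h₄⟩, h₁, h₃, hwy⟩
    · rintro ⟨w, ⟨_, h₂⟩, y, ⟨_, h₄⟩, h₁, h₃, hwy⟩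
      exact ⟨v, hv, w, hA.lt _ _ h₁, y, hA.lt _ _ h₃, ⟨h₁, h₂⟩, ⟨h₃, h₄⟩, hwy, rfl⟩
  have h₁ : Env n K L A (markBad.run s) := h.run markBad (by decide) (by decide)
  have hrb : (markBad.run s).reg Reg.b = s.reg Reg.b := Stmt.run_reg (by decide) s
  have hrt : (markBad.run s).reg Reg.tau = s.reg Reg.tau := Stmt.run_reg (by decide) s
  have hrr : (markBad.run s).arr Arr.rem = s.arr Arr.rem := Stmt.run_arr (by decide) s
  have heval : ∀ v, Expr.eval ((markBad.run s).setReg Reg.v v) (.sub (.lit 1)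
      (.add (remE (.var Reg.v)) (.load Arr.bad (index₂ (.var Reg.tau) (.var Reg.v))))) ≠ 0 ↔
      s.arr Arr.rem (s.reg Reg.b * L + v) = 0 ∧
        (markBad.run s).arr Arr.bad (s.reg Reg.tau * L + v) = 0 := by
    intro v
    have hσ := h₁.setReg (r := Reg.v) v (by decide)
    have hτ4 : s.reg Reg.tau < L ^ 4 := hτ.trans_le (Nat.le_self_pow (by omega) L)
    have e₁ := hσ.eval_remE (e := .var Reg.v) (by simpa [hrb] using hb)
    have e₂ := hσ.eval_index₂ (e := .var Reg.tau) (f := .var Reg.v)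
      (by simpa [Expr.eval, hrt] using hτ4)
    simp only [Expr.eval, e₁, e₂]
    simp [hrb, hrt, hrr]
    omega
  rcases run_search (i := Reg.v) (m := Reg.n) (r := Reg.sel) (e := .sub (.lit 1)
      (.add (remE (.var Reg.v)) (.load Arr.bad (index₂ (.var Reg.tau) (.var Reg.v)))))
      (by decide) (by decide) (markBad.run s) with ⟨-, hs⟩ | ⟨hs, hs'⟩
  · exfalso
    -- A leaf among the remaining vertices other than the dummy would have been found. The dummy is
    -- adjacent to nothing, so leaving it out loses no neighbour.
    obtain ⟨v, hv, hv'⟩ := hA.exists_leaf ((remaining n L s).erase n)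
      (fun v hv => by
        have := (mem_remaining.1 (Finset.mem_of_mem_erase hv)).1
        have := Finset.ne_of_mem_erase hv
        omega)
      (by
        rw [← Finset.card_pos, Finset.card_erase_of_mem (mem_remaining.2 ⟨le_rfl, hI.rem_dummy⟩)]
        omega)
    obtain ⟨hvn, hvr⟩ := Finset.mem_erase.1 hv
    have hvn' : v < n := by have := (mem_remaining.1 hvr).1; omega
    have := hs v (by rwa [h₁.reg_n])
    refine (heval v).2 ⟨(mem_remaining.1 hvr).2, ?_⟩ this
    by_contra hb'
    obtain ⟨w, hw, y, hy, hvw, hvy, hwy⟩ := (hbad v hvn').1 hb'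
    have := hv' w (Finset.mem_erase.2 ⟨(hA.lt _ _ hvw).ne, hw⟩) y
      (Finset.mem_erase.2 ⟨(hA.lt _ _ hvy).ne, hy⟩) hvw hvy
    omega
  · rw [h₁.reg_n] at hs
    obtain ⟨hr, hb'⟩ := (heval _).1 hs'
    refine ⟨hs, mem_remaining.2 ⟨hs.le, hr⟩, fun w hw y hy hxw hxy => ?_⟩
    by_contra hne
    refine absurd hb' ?_
    rw [← ne_eq, hbad _ hs]
    rcases lt_or_gt_of_ne hne with hlt | hlt
    · exact ⟨w, hw, y, hy, hxw, hxy, hlt⟩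
    · exact ⟨y, hy, w, hw, hxy, hxw, hlt⟩

/-- The chosen neighbour of the selected vertex is the dummy if there is no other. -/
theorem findPar_spec (h : Env n K L A s) (hA : IsForest n A) (hb : s.reg Reg.b < L)
    (hsel : s.reg Reg.sel < n) (hpar : s.reg Reg.par = n) :
    let u := (findPar.run s).reg Reg.par
    (u = n ∧ ∀ w ∈ remaining n L s, ¬ A (s.reg Reg.sel) w) ∨
      (u < n ∧ u ∈ remaining n L s ∧ A (s.reg Reg.sel) u) := by
  intro u
  have heval : ∀ w < n, Expr.eval (s.setReg Reg.w w)
      (.sub (adjE (.var Reg.sel) (.var Reg.w)) (remE (.var Reg.w))) ≠ 0 ↔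
      A (s.reg Reg.sel) w ∧ s.arr Arr.rem (s.reg Reg.b * L + w) = 0 := by
    intro w hw
    have hσ := h.setReg (r := Reg.w) w (by decide)
    rw [hσ.eval_adj_sub_rem]
    · simp [Expr.eval]
    all_goals simp [Expr.eval, hw] at hsel hb ⊢
    all_goals omega
  rcases run_search (i := Reg.w) (m := Reg.n) (r := Reg.par)
      (e := .sub (adjE (.var Reg.sel) (.var Reg.w)) (remE (.var Reg.w)))
      (by decide) (by decide) s with ⟨hs, hs'⟩ | ⟨hs, hs'⟩
  · refine .inl ⟨hs.trans hpar, fun w hw hAw => ?_⟩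
    have hwn := hA.lt _ _ hAw
    exact (heval w hwn).2 ⟨hAw, (mem_remaining.1 hw).2⟩ (hs' w (by rwa [h.reg_n]))
  · rw [h.reg_n] at hs
    obtain ⟨h₁, h₂⟩ := (heval _ hs).1 hs'
    exact .inr ⟨hs, mem_remaining.2 ⟨hs.le, h₂⟩, h₁⟩

/-- The labels after the creation of a new table. -/
theorem label_next (h : Env n K L A s) (hn : n < L) (hτ : s.reg Reg.tau + 1 < L)
    (hD : ∀ k, (s.reg Reg.tau + 1) * L ^ 4 ≤ k → s.arr Arr.D k = 0)
    (hE : ∀ k, (s.reg Reg.tau + 1) * L ^ 4 ≤ k → s.arr Arr.E k = 0)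
    (hsel : s.reg Reg.sel < n) (hpar : s.reg Reg.par ≤ n) :
    let s' := moveLabels.run (mergeLabels.run (keepLabels.run s))
    (∀ k, (s.reg Reg.tau + 2) * L ^ 4 ≤ k → s'.arr Arr.D k = 0) ∧
    (∀ k, (s.reg Reg.tau + 2) * L ^ 4 ≤ k → s'.arr Arr.E k = 0) ∧
    ∀ v ≤ n, ∀ a t f,
      (a < L ∧ t < L ∧ f < 2 ∧ s'.arr Arr.D (pos L (s.reg Reg.tau + 1) v a t f) ≠ 0) ↔
      (v ≠ s.reg Reg.par ∧ Label L s v a t f) ∨ (v = s.reg Reg.par ∧ ∃ a₁ a₂ f₁ f₂ t₂,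
        Label L s v a₁ t f₁ ∧ Label L s (s.reg Reg.sel) a₂ t₂ f₂ ∧ (f₂ ≠ 0 ∨ t₂ < t) ∧
        a = a₁ + a₂ ∧ a < L ∧ f = 1 - (1 - (f₁ + (t₂ - t)))) := by
  intro s'
  set s₁ := keepLabels.run s with hs₁
  set s₂ := mergeLabels.run s₁ with hs₂
  have h₁ : Env n K L A s₁ := h.run _ (by decide) (by decide)
  have h₂ : Env n K L A s₂ := h₁.run _ (by decide) (by decide)
  have t₁ : s₁.reg Reg.tau = s.reg Reg.tau := Stmt.run_reg (by decide) s
  have t₂ : s₂.reg Reg.tau = s.reg Reg.tau := (Stmt.run_reg (by decide) s₁).trans t₁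
  have p₁ : s₁.reg Reg.par = s.reg Reg.par := Stmt.run_reg (by decide) s
  have x₁ : s₁.reg Reg.sel = s.reg Reg.sel := Stmt.run_reg (by decide) s
  have D₁ : s₁.arr Arr.D = s.arr Arr.D := Stmt.run_arr (by decide) s
  have D₂ : s₂.arr Arr.D = s.arr Arr.D := (Stmt.run_arr (by decide) s₁).trans D₁
  have E₃ : s'.arr Arr.E = s₂.arr Arr.E := Stmt.run_arr (by decide) s₂
  have m₁ := marks_keepLabels h hn hτ
  have m₂ := marks_mergeLabels h₁ hn (by rwa [t₁]) (by rwa [p₁]) (by rwa [x₁])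
  have m₃ := marks_moveLabels h₂ hn (by rwa [t₂])
  rw [t₁, p₁, x₁, D₁] at m₂
  rw [t₂, D₂] at m₃
  have hfL : ∀ {f}, f < 2 → f < L := fun hf => by omega
  have hflag : ∀ {x}, 1 - (1 - x) < 2 := fun {x} => by omega
  have hlt : ∀ {v a t f}, v ≤ n → a < L → t < L → f < 2 →
      pos L (s.reg Reg.tau + 1) v a t f < (s.reg Reg.tau + 2) * L ^ 4 := fun hv ha ht hf =>
    pos_lt (by omega) ha ht (hfL hf)
  have hge : ∀ {v a t f}, (s.reg Reg.tau + 1) * L ^ 4 ≤ pos L (s.reg Reg.tau + 1) v a t f :=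
    le_pos _ _ _ _ _ _
  have hmono : ∀ {k}, (s.reg Reg.tau + 2) * L ^ 4 ≤ k → (s.reg Reg.tau + 1) * L ^ 4 ≤ k :=
    fun hk => (Nat.mul_le_mul_right _ (by omega)).trans hk
  have hE₂ : ∀ k, (s.reg Reg.tau + 2) * L ^ 4 ≤ k → s₂.arr Arr.E k = 0 := by
    intro k hk
    by_contra hne
    rcases (m₂ k).1 hne with hne | ⟨a₁, -, a₂, -, t₁, ht₁, t₂, -, f₁, -, f₂, -, -, -, -, ha, rfl⟩
    · rcases (m₁ k).1 hne with hne | ⟨v, hv, a, ha, t, ht, f, hf, -, -, rfl⟩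
      · exact hne (hE k (hmono hk))
      · exact absurd hk (not_le.2 (hlt (by omega) ha ht hf))
    · exact absurd hk (not_le.2 (hlt hpar ha ht₁ hflag))
  refine ⟨?_, ?_, ?_⟩
  · intro k hk
    by_contra hne
    rcases (m₃ k).1 hne with hne | ⟨v, hv, a, ha, t, ht, f, hf, -, rfl⟩
    · exact hne (hD k (hmono hk))
    · exact absurd hk (not_le.2 (hlt (by omega) ha ht hf))
  · intro k hk
    rw [E₃]; exact hE₂ k hk
  · intro v hv a t f
    have hv' : v < L := by omega
    constructor
    · rintro ⟨ha, ht, hf, hne⟩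
      rcases (m₃ _).1 hne with hne | ⟨v', hv'', a', ha', t', ht', f', hf', hne, heq⟩
      · exact absurd (hD _ hge) hne
      obtain ⟨-, rfl, rfl, rfl, rfl⟩ := pos_injective hv' ha ht (hfL hf) (by omega) ha' ht'
        (hfL hf') heq
      rcases (m₂ _).1 hne with hne |
        ⟨a₁, ha₁, a₂, ha₂, t₁, ht₁, t₂, ht₂, f₁, hf₁, f₂, hf₂, hD₁, hD₂, hc, haL, heq⟩
      · rcases (m₁ _).1 hne with hne | ⟨v', hv'', a', ha', t', ht', f', hf', hne, hvp, heq⟩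
        · exact absurd (hE _ hge) hne
        obtain ⟨-, rfl, rfl, rfl, rfl⟩ := pos_injective hv' ha ht (hfL hf) (by omega) ha' ht'
          (hfL hf') heq
        exact .inl ⟨hvp, ha, ht, hf, hne⟩
      · obtain ⟨-, rfl, rfl, rfl, rfl⟩ := pos_injective hv' ha ht (hfL hf) (by omega) haL ht₁
          (hfL hflag) heq
        exact .inr ⟨rfl, a₁, a₂, f₁, f₂, t₂, ⟨ha₁, ht, hf₁, hD₁⟩, ⟨ha₂, ht₂, hf₂, hD₂⟩, hc, rfl,
          haL, rfl⟩
    · rintro (⟨hvp, ha, ht, hf, hne⟩ | ⟨rfl, a₁, a₂, f₁, f₂, t₂, ⟨ha₁, ht, hf₁, hD₁⟩,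
        ⟨ha₂, ht₂, hf₂, hD₂⟩, hc, rfl, haL, rfl⟩)
      · exact ⟨ha, ht, hf, (m₃ _).2 (.inr ⟨v, by omega, a, ha, t, ht, f, hf,
          (m₂ _).2 (.inl ((m₁ _).2 (.inr ⟨v, by omega, a, ha, t, ht, f, hf, hne, hvp, rfl⟩))),
          rfl⟩)⟩
      · exact ⟨haL, ht, hflag, (m₃ _).2 (.inr ⟨_, by omega, _, haL, t, ht, _, hflag,
          (m₂ _).2 (.inr ⟨a₁, ha₁, a₂, ha₂, t, ht, t₂, ht₂, f₁, hf₁, f₂, hf₂, hD₁, hD₂, hc, haL,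
            rfl⟩), rfl⟩)⟩

/-- One elimination step keeps the set of possible total weights. -/
theorem elimStep_spec (h : Env n K L A s) (hI : StepInv n L s) (hA : IsForest n A)
    (hn : n < L) (hτ : s.reg Reg.tau + 1 < L) (hb : s.reg Reg.b < L)
    (hcard : 2 ≤ (remaining n L s).card) :
    let s' := elimStep.run s
    s'.reg Reg.tau = s.reg Reg.tau + 1 ∧ StepInv n L s' ∧
      (remaining n L s').card + 1 = (remaining n L s).card ∧
      ∀ m < L, Labelling A (Label L s) (remaining n L s) m ↔
        Labelling A (Label L s') (remaining n L s') m := by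
  intro s'
  set s₁ := markBad.run s with hs₁
  set s₂ := findSel.run s₁ with hs₂
  set s₃ := (Stmt.assign Reg.par (.var Reg.n)).run s₂ with hs₃
  set s₄ := findPar.run s₃ with hs₄
  set s₅ := moveLabels.run (mergeLabels.run (keepLabels.run s₄)) with hs₅
  set x := s₂.reg Reg.sel with hx
  set u := s₄.reg Reg.par with hu
  have hs' : s' = (Stmt.assign Reg.tau nextE).run
    ((Stmt.store Arr.rem (index₂ (.var Reg.b) (.var Reg.sel)) (.lit 1)).run s₅) := rfl
  have h₁ : Env n K L A s₁ := h.run _ (by decide) (by decide)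
  have h₂ : Env n K L A s₂ := h₁.run _ (by decide) (by decide)
  have h₃ : Env n K L A s₃ := h₂.run _ (by decide) (by decide)
  have h₄ : Env n K L A s₄ := h₃.run _ (by decide) (by decide)
  have h₅ : Env n K L A s₅ := ((h₄.run keepLabels (by decide) (by decide)).run mergeLabels
    (by decide) (by decide)).run moveLabels (by decide) (by decide)
  have reg₃ : ∀ r, r ∉ (Stmt.seq markBad (.seq findSel (.assign Reg.par (.var Reg.n)))).wregs →
      s₃.reg r = s.reg r := fun r hr => Stmt.run_reg hr s
  have reg₄ : ∀ r, r ∉ (Stmt.seq markBad (.seq findSel (.seq (.assign Reg.par (.var Reg.n))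
      findPar))).wregs → s₄.reg r = s.reg r := fun r hr => Stmt.run_reg hr s
  have reg₅ : ∀ r, r ∉ (Stmt.seq markBad (.seq findSel (.seq (.assign Reg.par (.var Reg.n))
      (.seq findPar (.seq keepLabels (.seq mergeLabels moveLabels)))))).wregs →
      s₅.reg r = s.reg r := fun r hr => Stmt.run_reg hr s
  have arr₄ : ∀ a, a ∉ (Stmt.seq markBad (.seq findSel (.seq (.assign Reg.par (.var Reg.n))
      findPar))).warrs → s₄.arr a = s.arr a := fun a ha => Stmt.run_arr ha s
  have arr₅ : ∀ a, a ∉ (Stmt.seq markBad (.seq findSel (.seq (.assign Reg.par (.var Reg.n))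
      (.seq findPar (.seq keepLabels (.seq mergeLabels moveLabels)))))).warrs →
      s₅.arr a = s.arr a := fun a ha => Stmt.run_arr ha s
  have hrem : ∀ {σ : State}, σ.reg Reg.b = s.reg Reg.b → σ.arr Arr.rem = s.arr Arr.rem →
      remaining n L σ = remaining n L s := fun h₁ h₂ => by simp only [remaining, h₁, h₂]
  have hrem₃ : remaining n L s₃ = remaining n L s :=
    hrem (reg₃ _ (by decide)) (Stmt.run_arr (p := .seq markBad (.seq findSel
      (.assign Reg.par (.var Reg.n)))) (by decide) s)
  obtain ⟨hxn, hxr, hxu⟩ : x < n ∧ x ∈ remaining n L s ∧ ∀ w₁ ∈ remaining n L s,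
      ∀ w₂ ∈ remaining n L s, A x w₁ → A x w₂ → w₁ = w₂ :=
    findSel_spec h hI hA (by omega) hb hcard
  have hx₃ : s₃.reg Reg.sel = x := Stmt.run_reg (by decide) s₂
  have hx₄ : s₄.reg Reg.sel = x := (Stmt.run_reg (by decide) s₃).trans hx₃
  have hx₅ : s₅.reg Reg.sel = x := (Stmt.run_reg (p := .seq keepLabels (.seq mergeLabels
    moveLabels)) (by decide) s₄).trans hx₄
  have hp : (u = n ∧ ∀ w ∈ remaining n L s₃, ¬ A (s₃.reg Reg.sel) w) ∨
      (u < n ∧ u ∈ remaining n L s₃ ∧ A (s₃.reg Reg.sel) u) := findPar_spec h₃ hA (by rwa [reg₃ _ (by decide)]) (by rwa [hx₃])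
    (by simpa [hs₃, Stmt.run, Expr.eval] using h₂.reg_n)
  rw [hrem₃, hx₃] at hp
  have hun : u ≤ n := by omega
  have hur : u ∈ remaining n L s := by
    rcases hp with ⟨hp, -⟩ | ⟨-, hp, -⟩
    · rw [hp]; exact mem_remaining.2 ⟨le_rfl, hI.rem_dummy⟩
    · exact hp
  have hxne : x ≠ u := by
    rcases hp with ⟨hp, -⟩ | ⟨-, -, hp⟩
    · omega
    · intro hxu'; rw [← hxu'] at hp; exact hA.irrefl _ hp
  have ht₄ : s₄.reg Reg.tau = s.reg Reg.tau := reg₄ _ (by decide)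
  have hD₄ : s₄.arr Arr.D = s.arr Arr.D := arr₄ _ (by decide)
  have hE₄ : s₄.arr Arr.E = s.arr Arr.E := arr₄ _ (by decide)
  obtain ⟨fD, fE, hlab⟩ := label_next h₄ hn (by rwa [ht₄]) (by rw [ht₄, hD₄]; exact hI.freshD)
    (by rw [ht₄, hE₄]; exact hI.freshE) (by rwa [hx₄]) hun
  have hL₄ : Label L s₄ = Label L s := by
    funext v a t f; simp only [Label, ht₄, hD₄]
  rw [hx₄, hL₄, ht₄] at hlab
  rw [ht₄] at fD fE
  have ht' : s'.reg Reg.tau = s.reg Reg.tau + 1 := by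
    have := reg₅ Reg.tau (by decide)
    simp [hs', Stmt.run, nextE, Expr.eval] at this ⊢
    exact this
  have hb' : s'.reg Reg.b = s.reg Reg.b := Stmt.run_reg (by decide) s
  have hr' : ∀ k, s'.arr Arr.rem k = if k = s.reg Reg.b * L + x then 1 else s.arr Arr.rem k := by
    intro k
    have e := h₅.eval_index₂ (e := .var Reg.b) (f := .var Reg.sel)
      (by
        rw [Expr.eval, reg₅ _ (by decide)]
        exact hb.trans_le (Nat.le_self_pow (by omega) L))
    simp only [Expr.eval, hx₅, reg₅ Reg.b (by decide)] at e
    rw [hs', Stmt.run, Stmt.run, State.setReg_arr, State.setArr_arr, e, arr₅ _ (by decide)]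
    simp [Expr.eval]
  have hD' : s'.arr Arr.D = s₅.arr Arr.D :=
    Stmt.run_arr (p := .seq (.store Arr.rem _ _) (.assign Reg.tau nextE)) (by decide) s₅
  have hE' : s'.arr Arr.E = s₅.arr Arr.E :=
    Stmt.run_arr (p := .seq (.store Arr.rem _ _) (.assign Reg.tau nextE)) (by decide) s₅
  have hlab' : ∀ v ≤ n, ∀ a t f, Label L s' v a t f ↔ (v ≠ u ∧ Label L s v a t f) ∨
      (v = u ∧ ∃ a₁ a₂ f₁ f₂ t₂, Label L s v a₁ t f₁ ∧ Label L s x a₂ t₂ f₂ ∧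
        (f₂ ≠ 0 ∨ t₂ < t) ∧ a = a₁ + a₂ ∧ a < L ∧ f = 1 - (1 - (f₁ + (t₂ - t)))) := by
    intro v hv a t f
    rw [← hlab v hv a t f, Label, ht', hD']
  have hrem' : remaining n L s' = (remaining n L s).erase x := by
    ext v
    rw [Finset.mem_erase, mem_remaining, mem_remaining, hb', hr']
    simp only [Nat.add_left_cancel_iff]
    by_cases hvx : v = x <;> simp [hvx]
  refine ⟨ht', ⟨?_, ?_, ?_, ?_, ?_, ?_⟩, ?_, ?_⟩
  · intro k hk
    rw [hD']; rw [ht'] at hk; exact fD k hk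
  · intro k hk
    rw [hE']; rw [ht'] at hk; exact fE k hk
  · intro k hk
    rw [ht'] at hk
    have : s'.arr Arr.bad = s₁.arr Arr.bad := Stmt.run_arr (p := .seq findSel (.seq (.assign Reg.par
      (.var Reg.n)) (.seq findPar (.seq keepLabels (.seq mergeLabels (.seq moveLabels
      (.seq (.store Arr.rem (index₂ (.var Reg.b) (.var Reg.sel)) (.lit 1))
        (.assign Reg.tau nextE)))))))) (by decide) s₁
    rw [this]
    by_contra hne
    rcases (marks_markBad h (by omega) hb k).1 hne with hne | ⟨v, hv, w, -, y, -, -, -, -, rfl⟩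
    · exact hne (hI.freshBad k ((Nat.mul_le_mul_right L (by omega)).trans hk))
    · rw [Nat.succ_mul] at hk; omega
  · intro k hk
    rw [hb'] at hk
    rw [hr', if_neg, hI.freshRem k hk]
    rw [Nat.succ_mul] at hk; omega
  · rw [hr', hb', if_neg (by omega), hI.rem_dummy]
  · intro a t f hl
    rcases (hlab' n le_rfl a t f).1 hl with ⟨-, hl⟩ | ⟨-, a₁, a₂, f₁, f₂, t₂, hl, -, -, -, -, hf⟩
    · exact hI.label_dummy _ _ _ hl
    · obtain ⟨h1, h2⟩ := hI.label_dummy _ _ _ hl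
      exact ⟨h1, by omega⟩
  · rw [hrem', Finset.card_erase_add_one hxr]
  · intro m hm
    rw [hrem']
    refine labelling_erase_iff hA.symm hxr hur hxne ?_ ?_ hm ?_ ?_
    · intro w hw hxw
      rcases hp with ⟨-, hp⟩ | ⟨-, hp, hp'⟩
      · exact absurd hxw (hp w hw)
      · exact hxu w hw u hp hxw hp'
    -- Without a remaining neighbour of `x`, `u` is the dummy, whose labels all have level 0 and
    -- flag 1.
    · rcases hp with ⟨hp, -⟩ | ⟨-, -, hp⟩
      · right; rw [hp]; exact hI.label_dummy
      · exact .inl hp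
    · intro v hv hvu hvx a t f
      rw [hlab' v (mem_remaining.1 hv).1]
      simp [hvu]
    · intro a t f
      rw [hlab' u hun]
      simp

end RAM

/-! ### Classes of radii, target weight and first table -/

namespace RAM

variable {n K L : ℕ} {A : ℕ → ℕ → Prop} {s : State}

/-- With `div_of_lt` this replaces division: from `k - 1` to `k` the quotient grows by at most one,
which a comparison of `k` with the maintained product detects. For `k = 0` both quotients are 0 by
truncation. -/
theorem div_add_one_of_le {k K : ℕ} (hK : 0 < K) (h : ((k - 1) / K + 1) * K ≤ k) :
    k / K = (k - 1) / K + 1 := by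
  refine Nat.div_eq_of_lt_le h ?_
  have := Nat.lt_div_mul_add (a := k - 1) hK
  rw [Nat.succ_mul, Nat.succ_mul]
  omega

theorem div_of_lt {k K : ℕ} (h : k < ((k - 1) / K + 1) * K) : k / K = (k - 1) / K := by
  refine Nat.div_eq_of_lt_le ?_ h
  have := Nat.div_mul_le_self (k - 1) K
  omega

theorem updateSize_spec (hK : 0 < K) (hKs : s.reg Reg.K = K)
    (hg : s.reg Reg.g = (s.reg Reg.b - 1) / K + 1) (hgK : s.reg Reg.gK = s.reg Reg.g * K) :
    (updateSize.run s).reg Reg.g = s.reg Reg.b / K + 1 ∧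
      (updateSize.run s).reg Reg.gK = (updateSize.run s).reg Reg.g * K := by
  by_cases h : Expr.eval s (.sub (.add (.var Reg.b) (.lit 1)) (.var Reg.gK)) ≠ 0
  · have e : updateSize.run s = (Stmt.seq (.assign Reg.g (.add (.var Reg.g) (.lit 1)))
      (.assign Reg.gK (.add (.var Reg.gK) (.var Reg.K)))).run s := if_pos h
    rw [e]
    simp only [Expr.eval, hgK, hg] at h
    have := div_add_one_of_le hK (k := s.reg Reg.b) (by omega)
    simp only [Stmt.run, Expr.eval]
    constructor
    · simp at hg this ⊢; omega
    · simp at hg hgK hKs ⊢; rw [hgK, hKs]; ring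
  · have e : updateSize.run s = s := if_neg h
    rw [e]
    simp only [Expr.eval, hgK, hg] at h
    have := div_of_lt (k := s.reg Reg.b) (K := K) (by omega)
    exact ⟨by rw [hg, this], hgK⟩

theorem fillClasses_spec (hK : s.reg Reg.K = K) (h0 : s.arr Arr.cls 0 = 0) :
    ∀ j ≤ K, (fillClasses.run s).arr Arr.cls j = j * s.reg Reg.g := by
  have := Stmt.run_loop_induction (i := Reg.j) (m := Reg.K) (s := s)
    (p := .store Arr.cls (.add (.var Reg.j) (.lit 1)) (.add (.load Arr.cls (.var Reg.j)) (.var Reg.g)))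
    (fun x σ => ∀ j ≤ x, σ.arr Arr.cls j = j * s.reg Reg.g)
    (fun j hj => by rw [Nat.le_zero.1 hj, h0]; simp)
    (by
      intro k _ σ hr _ hI j hj
      have hg := hr Reg.g (by decide)
      have hk := hI k le_rfl
      simp only [Reg.g] at hg hk hI
      simp [Stmt.run, Expr.eval, hg] at hk ⊢
      split
      · rename_i h; rw [h, hk]; ring
      · exact hI j (by omega))
  rw [hK] at this
  exact this

/-- The class of `v` is found by testing `j * g ≤ v < (j + 1) * g` for every `j < K`. Exchanging the
two sums leaves exactly one term for each `v` below the number of balls. -/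
theorem sumTarget_spec {g : ℕ} (h : Env n K L A s) (h0 : s.reg Reg.target = 0)
    (hcls : ∀ j ≤ K, s.arr Arr.cls j = j * g) (hg : 0 < g) (hb : s.reg Reg.b ≤ n)
    (hbK : s.reg Reg.b < g * K) :
    (sumTarget.run s).reg Reg.target = targetWeight (n + 2) g (s.reg Reg.b) := by
  set c : ℕ → ℕ → ℕ := fun j v => if v < s.reg Reg.b ∧ v / g = j then (n + 2) ^ j else 0 with hc
  have inner : ∀ (σ : State) (j : ℕ), j < K → Env n K L A σ → σ.reg Reg.j = j →
      σ.reg Reg.b = s.reg Reg.b → σ.arr Arr.cls = s.arr Arr.cls →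
      ((Stmt.loop Reg.v Reg.n
        (when (.sub (.var Reg.b) (.var Reg.v))
          (when (.sub (.add (.var Reg.v) (.lit 1)) (.load Arr.cls (.var Reg.j)))
            (when (.sub (.load Arr.cls (.add (.var Reg.j) (.lit 1))) (.var Reg.v))
              (.assign Reg.target (.add (.var Reg.target) (.load Arr.pow (.var Reg.j)))))))).run
        σ).reg Reg.target = σ.reg Reg.target + ∑ v ∈ Finset.range n, c j v := by
    intro σ j hj hσ hσj hσb hσc
    have := Stmt.run_loop_induction (i := Reg.v) (m := Reg.n) (s := σ)
      (p := when (.sub (.var Reg.b) (.var Reg.v))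
          (when (.sub (.add (.var Reg.v) (.lit 1)) (.load Arr.cls (.var Reg.j)))
            (when (.sub (.load Arr.cls (.add (.var Reg.j) (.lit 1))) (.var Reg.v))
              (.assign Reg.target (.add (.var Reg.target) (.load Arr.pow (.var Reg.j)))))))
      (fun x τ => τ.reg Reg.target = σ.reg Reg.target + ∑ v ∈ Finset.range x, c j v)
      (by simp)
      (by
        intro v _ τ hr ha hI
        have e₁ := (hr Reg.j (by decide)).trans hσj
        have e₂ := (hr Reg.b (by decide)).trans hσb
        have e₃ := (ha Arr.cls (by decide)).trans hσc
        have e₄ := ha Arr.pow (by decide)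
        have e₅ := hσ.arr_pow j hj
        have e₆ := hcls j hj.le
        have e₇ := hcls (j + 1) hj
        have hdiv : v / g = j ↔ j * g ≤ v ∧ v < (j + 1) * g := by
          rw [Nat.div_eq_iff hg, Nat.succ_mul]
          omega
        rw [Finset.sum_range_succ, ← add_assoc, ← hI]
        simp only [hc, hdiv]
        simp at e₁ e₂ e₃ e₄ e₅ e₆ e₇
        simp [when, Stmt.run, Expr.eval, e₁, e₂, e₃, e₄, e₅, e₆, e₇, Nat.sub_eq_zero_iff_le]
        split_ifs <;> simp <;> omega)
    rw [hσ.reg_n] at this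
    exact this
  have outer := Stmt.run_loop_induction (i := Reg.j) (m := Reg.K) (s := s)
    (p := .loop Reg.v Reg.n
        (when (.sub (.var Reg.b) (.var Reg.v))
          (when (.sub (.add (.var Reg.v) (.lit 1)) (.load Arr.cls (.var Reg.j)))
            (when (.sub (.load Arr.cls (.add (.var Reg.j) (.lit 1))) (.var Reg.v))
              (.assign Reg.target (.add (.var Reg.target) (.load Arr.pow (.var Reg.j))))))))
    (fun x τ => τ.reg Reg.target = ∑ j ∈ Finset.range x, ∑ v ∈ Finset.range n, c j v)
    (by simpa using h0)
    (by
      intro j hj σ hr ha hI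
      rw [h.reg_K] at hj
      have hσ : Env n K L A σ := h.congr
        (fun r hr' => hr r (by revert r; decide)) (fun a ha' => ha a (by revert a; decide))
      rw [inner (σ.setReg Reg.j j) j hj (hσ.setReg _ (by decide)) (by simp)
        (by have := hr Reg.b (by decide); simpa using this) (ha Arr.cls (by decide)),
        Finset.sum_range_succ, ← hI]
      simp)
  rw [h.reg_K] at outer
  refine Eq.trans outer ?_
  rw [Finset.sum_comm, targetWeight, ← Finset.sum_subset (Finset.range_mono hb)]
  · refine Finset.sum_congr rfl fun v hv => ?_
    have hv' := Finset.mem_range.1 hv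
    have hvK : v / g < K := Nat.div_lt_of_lt_mul (hv'.trans hbK)
    simp [hc, hv', hvK]
  · intro v _ hv
    simp only [Finset.mem_range, not_lt] at hv
    simp [hc, hv]

theorem prepare_spec (h : Env n K L A s) (hK : 0 < K) (hb : s.reg Reg.b ≤ n)
    (hg : s.reg Reg.g = (s.reg Reg.b - 1) / K + 1) (hgK : s.reg Reg.gK = s.reg Reg.g * K) :
    let g := s.reg Reg.b / K + 1
    let s' := prepare.run s
    s'.reg Reg.g = g ∧ s'.reg Reg.gK = g * K ∧ (∀ j ≤ K, s'.arr Arr.cls j = j * g) ∧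
      s'.reg Reg.target = targetWeight (n + 2) g (s.reg Reg.b) := by
  intro g s'
  obtain ⟨h₁, h₂⟩ := updateSize_spec hK h.reg_K hg hgK
  set s₁ := updateSize.run s
  have e₁ : Env n K L A s₁ := h.run _ (by decide) (by decide)
  set s₂ := (Stmt.store Arr.cls (.lit 0) (.lit 0)).run s₁ with hs₂
  have e₂ : Env n K L A s₂ := e₁.run _ (by decide) (by decide)
  have c₂ := fillClasses_spec e₂.reg_K (by simp [hs₂, Stmt.run, Expr.eval])
  set s₃ := fillClasses.run s₂
  have e₃ : Env n K L A s₃ := e₂.run _ (by decide) (by decide)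
  set s₄ := (Stmt.assign Reg.target (.lit 0)).run s₃ with hs₄
  have e₄ : Env n K L A s₄ := e₃.run _ (by decide) (by decide)
  have hs' : s' = sumTarget.run s₄ := rfl
  have hb₄ : s₄.reg Reg.b = s.reg Reg.b := Stmt.run_reg (p := .seq updateSize (.seq (.store Arr.cls
    (.lit 0) (.lit 0)) (.seq fillClasses (.assign Reg.target (.lit 0))))) (by decide) s
  have hg₂ : s₂.reg Reg.g = g := (Stmt.run_reg (by decide) s₁).trans h₁
  rw [hg₂] at c₂
  have hlt : s.reg Reg.b < g * K := by
    have := Nat.lt_div_mul_add (a := s.reg Reg.b) hK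
    rw [Nat.succ_mul]; exact this
  have ht := sumTarget_spec (g := g) e₄ (by simp [hs₄, Stmt.run, Expr.eval]) c₂ (Nat.succ_pos _)
    (by rwa [hb₄]) (by rwa [hb₄])
  rw [hb₄] at ht
  refine ⟨?_, ?_, ?_, ht⟩
  · exact (Stmt.run_reg (p := .seq (.store Arr.cls (.lit 0) (.lit 0)) (.seq fillClasses
      (.seq (.assign Reg.target (.lit 0)) sumTarget))) (by decide) s₁).trans h₁
  · exact (Stmt.run_reg (p := .seq (.store Arr.cls (.lit 0) (.lit 0)) (.seq fillClasses
      (.seq (.assign Reg.target (.lit 0)) sumTarget))) (by decide) s₁).trans (h₂.trans (by rw [h₁]))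
  · rw [hs', Stmt.run_arr (by decide)]
    exact c₂

theorem initLabels_spec {g : ℕ} (h : Env n K L A s) (hn : n < L) (hL : 1 < L)
    (hτ : s.reg Reg.tau < L)
    (hK : (n + 2) ^ K ≤ L) (hcls : ∀ j ≤ K, s.arr Arr.cls j = j * g) (hbK : s.reg Reg.b < g * K)
    (hD : ∀ k, s.reg Reg.tau * L ^ 4 ≤ k → s.arr Arr.D k = 0) :
    let s' := initLabels.run s
    (∀ k, (s.reg Reg.tau + 1) * L ^ 4 ≤ k → s'.arr Arr.D k = 0) ∧
      ∀ v ≤ n, ∀ a t f, Label L s' v a t f ↔ InitLabel n (n + 2) g (s.reg Reg.b) L v a t f := by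
  intro s'
  set s₁ := initPlain.run s
  set s₂ := initBalls.run s₁
  have hs' : s' = initDummy.run s₂ := rfl
  have e₁ : Env n K L A s₁ := h.run _ (by decide) (by decide)
  have e₂ : Env n K L A s₂ := e₁.run _ (by decide) (by decide)
  have t₁ : s₁.reg Reg.tau = s.reg Reg.tau := Stmt.run_reg (by decide) s
  have t₂ : s₂.reg Reg.tau = s.reg Reg.tau := (Stmt.run_reg (by decide) s₁).trans t₁
  have t₃ : s'.reg Reg.tau = s.reg Reg.tau := (Stmt.run_reg (by decide) s₂).trans t₂
  have b₁ : s₁.reg Reg.b = s.reg Reg.b := Stmt.run_reg (by decide) s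
  have c₁ : s₁.arr Arr.cls = s.arr Arr.cls := Stmt.run_arr (by decide) s
  have m : ∀ k, s'.arr Arr.D k ≠ 0 ↔ s.arr Arr.D k ≠ 0 ∨ (∃ v < n, ∃ t < L,
      k = pos L (s.reg Reg.tau) v 0 t 0) ∨ (∃ v < n, ∃ t < L, ∃ j < K, j * g < s.reg Reg.b ∧
        k = pos L (s.reg Reg.tau) v ((n + 2) ^ j) t (1 - (1 - ((j + 1) * g - t)))) ∨
      k = pos L (s.reg Reg.tau) n 0 0 1 := by
    intro k
    rw [hs', marks_initDummy e₂ hn (by rwa [t₂]), marks_initBalls e₁ hn (by rwa [t₁]) hK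
      (by rwa [c₁]), marks_initPlain h hn hτ, t₂, t₁, b₁]
    simp only [or_assoc]
  have hflag : ∀ {x}, 1 - (1 - x) < 2 := fun {x} => by omega
  have hpow : ∀ {j}, j < K → (n + 2) ^ j < L := fun hj =>
    (Nat.pow_lt_pow_right (by omega) hj).trans_le hK
  refine ⟨fun k hk => ?_, fun v hv a t f => ?_⟩
  · by_contra hne
    rcases (m k).1 hne with hne | ⟨v, hv, t, ht, rfl⟩ | ⟨v, hv, t, ht, j, hj, -, rfl⟩ | rfl
    · exact hne (hD k ((Nat.mul_le_mul_right _ (by omega)).trans hk))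
    · exact absurd hk (not_le.2 (pos_lt (by omega) (by omega) ht (by omega)))
    · exact absurd hk (not_le.2 (pos_lt (by omega) (hpow hj) ht (hflag.trans_le (by omega))))
    · exact absurd hk (not_le.2 (pos_lt (by omega) (by omega) (by omega) (by omega)))
  · have hif : ∀ j, (1 - (1 - ((j + 1) * g - t))) = if t < (j + 1) * g then 1 else 0 := by
      intro j; split <;> omega
    rw [Label, InitLabel, t₃, m]
    constructor
    · rintro ⟨ha, ht, hf, hne | ⟨v', hv', t', ht', heq⟩ | ⟨v', hv', t', ht', j, hj, hjb, heq⟩ | heq⟩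
      · exact absurd (hD _ (le_pos _ _ _ _ _ _)) hne
      · obtain ⟨-, rfl, rfl, rfl, rfl⟩ := pos_injective (by omega) ha ht (by omega) (by omega)
          (by omega) ht' (by omega) heq
        exact ⟨ha, ht, .inl ⟨hv', .inl ⟨rfl, rfl⟩⟩⟩
      · obtain ⟨-, rfl, rfl, rfl, rfl⟩ := pos_injective (by omega) ha ht (by omega) (by omega)
          (hpow hj) ht' (hflag.trans_le (by omega)) heq
        exact ⟨ha, ht, .inl ⟨hv', .inr ⟨j, hjb, rfl, hif j⟩⟩⟩
      · obtain ⟨-, rfl, rfl, rfl, rfl⟩ := pos_injective (by omega) ha ht (by omega) (by omega)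
          (by omega) (by omega) (by omega) heq
        exact ⟨ha, ht, .inr ⟨rfl, rfl, rfl, rfl⟩⟩
    · rintro ⟨ha, ht, ⟨hv', ⟨rfl, rfl⟩ | ⟨j, hjb, rfl, rfl⟩⟩ | ⟨rfl, rfl, rfl, rfl⟩⟩
      · exact ⟨ha, ht, by omega, .inr (.inl ⟨v, hv', t, ht, rfl⟩)⟩
      -- The program tries only `j < K`. This loses nothing, since `j * g < b < g * K`.
      · have hj : j < K := by
          by_contra hj
          have := Nat.mul_le_mul_right g (not_lt.1 hj)
          rw [mul_comm g K] at hbK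
          omega
        rw [← hif]
        exact ⟨ha, ht, hflag, .inr (.inr (.inl ⟨v, hv', t, ht, j, hj, hjb, rfl⟩))⟩
      · exact ⟨ha, ht, by omega, .inr (.inr (.inr rfl))⟩

end RAM

/-! ### Elimination of all vertices and the search for the number of balls -/

namespace RAM

variable {n K L : ℕ} {A : ℕ → ℕ → Prop} {s : State}

theorem StepInv.setReg_step (h : StepInv n L s) (i : ℕ) : StepInv n L (s.setReg Reg.step i) where
  freshD := by simpa using h.freshD
  freshE := by simpa using h.freshE
  freshBad := by simpa using h.freshBad
  freshRem := by simpa using h.freshRem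
  rem_dummy := by simpa using h.rem_dummy
  label_dummy := by simpa [Label] using h.label_dummy

/-- After the elimination of all vertices, only the dummy remains. -/
theorem elimLoop_spec (h : Env n K L A s) (hI : StepInv n L s) (hA : IsForest n A)
    (hn : n < L) (hτ : s.reg Reg.tau + n < L) (hb : s.reg Reg.b < L)
    (hrem : remaining n L s = Finset.range (n + 1)) :
    let s' := (Stmt.loop Reg.step Reg.n elimStep).run s
    s'.reg Reg.tau = s.reg Reg.tau + n ∧ StepInv n L s' ∧
      ∀ m < L, Labelling A (Label L s) (Finset.range (n + 1)) m ↔ Label L s' n m 0 1 := by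
  -- After `i` steps `n + 1 - i` vertices remain. As long as `i < n` these are at least two, so one
  -- besides the dummy can be eliminated.
  have key := Stmt.run_loop_induction (i := Reg.step) (m := Reg.n) (s := s) (p := elimStep)
    (fun i σ => σ.reg Reg.tau = s.reg Reg.tau + i ∧ StepInv n L σ ∧
      (remaining n L σ).card + i = n + 1 ∧ ∀ m < L, Labelling A (Label L s) (remaining n L s) m ↔
        Labelling A (Label L σ) (remaining n L σ) m)
    ⟨rfl, hI, by simp [hrem], fun _ _ => Iff.rfl⟩
    (by
      rintro i hi σ hr ha ⟨h₁, h₂, h₃, h₄⟩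
      rw [h.reg_n] at hi
      have hσ : Env n K L A σ := h.congr
        (fun r hr' => hr r (by revert r; decide)) (fun a ha' => ha a (by revert a; decide))
      have hbσ := hr Reg.b (by decide)
      have hrem' : remaining n L (σ.setReg Reg.step i) = remaining n L σ := by simp [remaining]
      have hlab' : Label L (σ.setReg Reg.step i) = Label L σ := by
        funext v a t f; simp [Label]
      have hτ' : (σ.setReg Reg.step i).reg Reg.tau = σ.reg Reg.tau := by simp
      have hb' : (σ.setReg Reg.step i).reg Reg.b = σ.reg Reg.b := by simp
      obtain ⟨e₁, e₂, e₃, e₄⟩ := elimStep_spec (hσ.setReg i (by decide)) (h₂.setReg_step i) hA hn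
        (by rw [hτ', h₁]; omega) (by rw [hb', hbσ]; exact hb) (by rw [hrem']; omega)
      rw [hτ', h₁] at e₁
      rw [hrem'] at e₃
      rw [hrem', hlab'] at e₄
      exact ⟨e₁, e₂, by omega, fun m hm => (h₄ m hm).trans (e₄ m hm)⟩)
  rw [h.reg_n] at key
  obtain ⟨h₁, h₂, h₃, h₄⟩ := key
  refine ⟨h₁, h₂, fun m hm => ?_⟩
  rw [hrem] at h₄
  rw [h₄ m hm]
  set s' := (Stmt.loop Reg.step Reg.n elimStep).run s
  have hr : remaining n L s' = {n} := by
    obtain ⟨x, hx⟩ := Finset.card_eq_one.1 (show (remaining n L s').card = 1 by omega)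
    have : n ∈ remaining n L s' := mem_remaining.2 ⟨le_rfl, h₂.rem_dummy⟩
    rw [hx] at this ⊢
    rw [Finset.mem_singleton.1 this]
  rw [hr]
  constructor
  · rintro ⟨w, t, b, hl, hw, -⟩
    have hl := hl n (by simp)
    obtain ⟨ht, hb⟩ := h₂.label_dummy _ _ _ hl
    simp only [Finset.sum_singleton] at hw
    rwa [hw, ht, hb] at hl
  · intro hl
    exact ⟨fun _ => m, fun _ => 0, fun _ => 1, by simpa using hl, by simp, by simp⟩

/-- All classes are below `K`, so there are `b < N` terms of size at most `N ^ (K - 1)`. -/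
theorem targetWeight_lt {N g b K : ℕ} (hb : b < N) (hbK : b < g * K) :
    targetWeight N g b < N ^ K := by
  have hN : 0 < N := by omega
  rcases Nat.eq_zero_or_pos b with rfl | hb0
  · simpa [targetWeight] using Nat.pow_pos hN
  have hK : 0 < K := Nat.pos_of_ne_zero fun h => by simp [h] at hbK
  calc targetWeight N g b ≤ ∑ i ∈ Finset.range b, N ^ (K - 1) := by
        refine Finset.sum_le_sum fun i hi => Nat.pow_le_pow_right hN ?_
        have : i / g < K := Nat.div_lt_of_lt_mul ((Finset.mem_range.1 hi).trans hbK)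
        omega
    _ = b * N ^ (K - 1) := by simp
    _ < N * N ^ (K - 1) := Nat.mul_lt_mul_of_pos_right hb (Nat.pow_pos hN)
    _ = N ^ K := by rw [← Nat.pow_succ', Nat.succ_eq_add_one, Nat.sub_add_cancel hK]

/-- Whether `b` balls with rounded radii cover the graph. -/
def Good (n K L : ℕ) (A : ℕ → ℕ → Prop) (b : ℕ) : Prop :=
  Labelling A (InitLabel n (n + 2) (b / K + 1) b L) (Finset.range (n + 1))
    (targetWeight (n + 2) (b / K + 1) b)

/-- The state before the trial of `k` balls. -/
structure TryInv (n K L : ℕ) (A : ℕ → ℕ → Prop) (k : ℕ) (s : State) : Prop where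
  g : s.reg Reg.g = (k - 1) / K + 1
  gK : s.reg Reg.gK = s.reg Reg.g * K
  tau : s.reg Reg.tau = k * (n + 1)
  freshD : ∀ i, s.reg Reg.tau * L ^ 4 ≤ i → s.arr Arr.D i = 0
  freshE : ∀ i, s.reg Reg.tau * L ^ 4 ≤ i → s.arr Arr.E i = 0
  freshBad : ∀ i, s.reg Reg.tau * L ≤ i → s.arr Arr.bad i = 0
  freshRem : ∀ i, k * L ≤ i → s.arr Arr.rem i = 0
  result : (s.reg Reg.found = 0 ∧ ∀ b < k, ¬ Good n K L A b) ∨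
    (s.reg Reg.found ≠ 0 ∧ ∃ b < k, Good n K L A b ∧ (∀ b' < b, ¬ Good n K L A b') ∧
      s.reg Reg.res = b + b / K)

theorem labelling_congr {D D' : ℕ → ℕ → ℕ → ℕ → Prop} {U : Finset ℕ} {m : ℕ}
    (h : ∀ v ∈ U, ∀ a t f, D v a t f ↔ D' v a t f) : Labelling A D U m ↔ Labelling A D' U m := by
  simp +contextual only [Labelling, h]

theorem readResult_spec (h : Env n K L A s) (hn : n < L) (hL : 1 < L) (hτ : s.reg Reg.tau < L)
    (ht : s.reg Reg.target < L) :
    let s' := readResult.run s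
    (s.reg Reg.found ≠ 0 → s' = s) ∧
    (s.reg Reg.found = 0 → ¬ Label L s n (s.reg Reg.target) 0 1 → s' = s) ∧
    (s.reg Reg.found = 0 → Label L s n (s.reg Reg.target) 0 1 →
      s'.reg Reg.found ≠ 0 ∧ s'.reg Reg.res = s.reg Reg.b + s.reg Reg.g - 1) := by
  have e := h.eval_index₅ (e₁ := .var Reg.tau) (e₂ := .var Reg.n) (e₃ := .var Reg.target)
    (e₄ := .lit 0) (e₅ := .lit 1) hτ (by simpa [Expr.eval] using h.reg_n ▸ hn) ht
    (by simp [Expr.eval]; omega)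
  have hlab : Expr.eval s (.load Arr.D (index₅ (.var Reg.tau) (.var Reg.n) (.var Reg.target)
      (.lit 0) (.lit 1))) ≠ 0 ↔ Label L s n (s.reg Reg.target) 0 1 := by
    rw [Expr.eval_load, e, Label]
    simp only [Expr.eval, h.reg_n]
    exact ⟨fun h' => ⟨ht, by omega, by omega, h'⟩, fun h' => h'.2.2.2⟩
  refine ⟨fun hf => if_pos hf, fun hf hl => ?_, fun hf hl => ?_⟩
  · exact (if_neg (by simpa [Expr.eval] using hf)).trans (if_neg (mt hlab.1 hl))
  · have e : readResult.run s = (Stmt.seq (.assign Reg.found (.lit 1))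
        (.assign Reg.res (.sub (.add (.var Reg.b) (.var Reg.g)) (.lit 1)))).run s :=
      (if_neg (by simpa [Expr.eval] using hf)).trans (if_pos (hlab.2 hl))
    simp [e, Stmt.run, Expr.eval]

/-- Trial `k` uses the tables `k * (n + 1), …, k * (n + 1) + n`: the first one and one for each
elimination. Over all trials these are `(n + 1) * (n + 1)` tables, so their numbers stay below `L`.
-/
theorem tryBalls_spec {k : ℕ} (h : Env n K L A s) (hI : TryInv n K L A k s) (hA : IsForest n A)
    (hK : 0 < K) (hk : k ≤ n) (hL : (n + 1) * (n + 1) < L) (hKL : (n + 2) ^ K ≤ L) :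
    TryInv n K L A (k + 1) (tryBalls.run (s.setReg Reg.b k)) := by
  have hnL : n < L := by nlinarith
  have h1L : 1 < L := by nlinarith
  have hkn : k * (n + 1) + n < L := by nlinarith
  set s₀ := s.setReg Reg.b k with hs₀
  have e₀ : Env n K L A s₀ := h.setReg _ (by decide)
  have b₀ : s₀.reg Reg.b = k := by simp [hs₀]
  have r₀ : ∀ r, r ≠ Reg.b → s₀.reg r = s.reg r := fun r hr => by simp [hs₀, hr]
  set g := k / K + 1 with hg
  obtain ⟨g₁, gK₁, c₁, t₁⟩ := prepare_spec e₀ hK (by rwa [b₀])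
    (by rw [b₀, r₀ _ (by decide), hI.g])
    (by rw [r₀ _ (by decide), r₀ _ (by decide), hI.gK])
  rw [b₀] at g₁ gK₁ t₁
  simp only [b₀] at c₁
  rw [← hg] at g₁ gK₁ t₁
  simp only [← hg] at c₁
  set s₁ := prepare.run s₀ with hs₁
  have e₁ : Env n K L A s₁ := e₀.run _ (by decide) (by decide)
  have r₁ : ∀ r, r ∉ prepare.wregs → s₁.reg r = s₀.reg r := fun r hr => Stmt.run_reg hr s₀
  have a₁ : ∀ a, a ∉ prepare.warrs → s₁.arr a = s.arr a := fun a ha => Stmt.run_arr ha s₀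
  have b₁ : s₁.reg Reg.b = k := (r₁ _ (by decide)).trans b₀
  have τ₁ : s₁.reg Reg.tau = s.reg Reg.tau := (r₁ _ (by decide)).trans (r₀ _ (by decide))
  have hkg : k < g * K := by
    have := Nat.lt_div_mul_add (a := k) hK
    rw [hg, Nat.succ_mul]; exact this
  obtain ⟨f₂, l₂⟩ := initLabels_spec (g := g) e₁ hnL h1L (by rw [τ₁, hI.tau]; omega) hKL c₁
    (by rwa [b₁]) (by rw [τ₁, a₁ _ (by decide)]; exact hI.freshD)
  rw [τ₁] at f₂
  rw [b₁] at l₂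
  set s₂ := initLabels.run s₁ with hs₂
  have e₂ : Env n K L A s₂ := e₁.run _ (by decide) (by decide)
  have r₂ : ∀ r, r ∉ initLabels.wregs → s₂.reg r = s₁.reg r := fun r hr => Stmt.run_reg hr s₁
  have a₂ : ∀ a, a ∉ (Stmt.seq prepare initLabels).warrs → s₂.arr a = s.arr a :=
    fun a ha => Stmt.run_arr ha s₀
  have b₂ : s₂.reg Reg.b = k := (r₂ _ (by decide)).trans b₁
  have τ₂ : s₂.reg Reg.tau = s.reg Reg.tau := (r₂ _ (by decide)).trans τ₁
  have i₂ : StepInv n L s₂ := by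
    refine ⟨by rwa [τ₂], ?_, ?_, ?_, ?_, ?_⟩
    · intro i hi
      rw [τ₂] at hi
      rw [a₂ _ (by decide)]
      exact hI.freshE i ((Nat.mul_le_mul_right _ (by omega)).trans hi)
    · rw [τ₂, a₂ _ (by decide)]; exact hI.freshBad
    · intro i hi
      rw [b₂] at hi
      rw [a₂ _ (by decide)]
      exact hI.freshRem i ((Nat.mul_le_mul_right _ (by omega)).trans hi)
    · rw [b₂, a₂ _ (by decide)]; exact hI.freshRem _ (Nat.le_add_right _ _)
    · intro a t f hl
      obtain ⟨-, -, h' | h'⟩ := (l₂ n le_rfl a t f).1 hl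
      · omega
      · exact h'.2.2
  have rem₂ : remaining n L s₂ = Finset.range (n + 1) := by
    ext v
    rw [mem_remaining, b₂, a₂ _ (by decide), hI.freshRem _ (Nat.le_add_right _ _)]
    simp
  obtain ⟨τ₃, i₃, l₃⟩ := elimLoop_spec e₂ i₂ hA hnL (by rw [τ₂, hI.tau]; exact hkn)
    (by rw [b₂]; omega) rem₂
  set s₃ := (Stmt.loop Reg.step Reg.n elimStep).run s₂ with hs₃
  have e₃ : Env n K L A s₃ := e₂.run _ (by decide) (by decide)
  have r₃ : ∀ r, r ∉ (Stmt.seq initLabels (.loop Reg.step Reg.n elimStep)).wregs →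
      s₃.reg r = s₁.reg r := fun r hr => Stmt.run_reg hr s₁
  have τ₃' : s₃.reg Reg.tau = k * (n + 1) + n := by rw [τ₃, τ₂, hI.tau]
  have t₃ : s₃.reg Reg.target = targetWeight (n + 2) g k := (r₃ _ (by decide)).trans t₁
  have htL : targetWeight (n + 2) g k < L :=
    (targetWeight_lt (by omega) hkg).trans_le hKL
  have good : Good n K L A k ↔ Label L s₃ n (s₃.reg Reg.target) 0 1 := by
    rw [t₃, ← l₃ _ htL, Good, ← hg]
    exact labelling_congr fun v hv a t f => (l₂ v (by simp at hv; omega) a t f).symm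
  obtain ⟨q₁, q₂, q₃⟩ := readResult_spec e₃ hnL h1L (by rw [τ₃']; exact hkn) (by rw [t₃]; exact htL)
  set s₄ := readResult.run s₃ with hs₄
  have hs' : tryBalls.run s₀ = (Stmt.assign Reg.tau nextE).run s₄ := rfl
  set s' := tryBalls.run s₀
  have τ₄ : s₄.reg Reg.tau = k * (n + 1) + n := (Stmt.run_reg (by decide) s₃).trans τ₃'
  have τ' : s'.reg Reg.tau = (k + 1) * (n + 1) := by
    rw [hs']
    simp [Stmt.run, nextE, Expr.eval] at τ₄ ⊢
    rw [τ₄]; ring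
  have hτ' : s'.reg Reg.tau = s₃.reg Reg.tau + 1 := by rw [τ', τ₃']; ring
  have a' : ∀ a, s'.arr a = s₃.arr a := fun a =>
    Stmt.run_arr (p := .seq readResult (.assign Reg.tau nextE)) (List.not_mem_nil) s₃
  have b₃ : s₃.reg Reg.b = k := (r₃ _ (by decide)).trans b₁
  have g₃ : s₃.reg Reg.g = g := (r₃ _ (by decide)).trans g₁
  have g' : s'.reg Reg.g = g :=
    (Stmt.run_reg (p := .seq readResult (.assign Reg.tau nextE)) (by decide) s₃).trans g₃
  have found' : s'.reg Reg.found = s₄.reg Reg.found := by rw [hs']; exact Stmt.run_reg (by decide) _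
  have res' : s'.reg Reg.res = s₄.reg Reg.res := by rw [hs']; exact Stmt.run_reg (by decide) _
  have rf : s₃.reg Reg.found = s.reg Reg.found :=
    (r₃ _ (by decide)).trans ((r₁ _ (by decide)).trans (r₀ _ (by decide)))
  have rr : s₃.reg Reg.res = s.reg Reg.res :=
    (r₃ _ (by decide)).trans ((r₁ _ (by decide)).trans (r₀ _ (by decide)))
  refine ⟨?_, ?_, τ', ?_, ?_, ?_, ?_, ?_⟩
  · rw [g', hg, Nat.add_sub_cancel]
  · rw [g']
    exact (Stmt.run_reg (p := .seq initLabels (.seq (.loop Reg.step Reg.n elimStep)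
      (.seq readResult (.assign Reg.tau nextE)))) (by decide) s₁).trans gK₁
  · intro i hi
    rw [a']; rw [hτ'] at hi; exact i₃.freshD i hi
  · intro i hi
    rw [a']; rw [hτ'] at hi; exact i₃.freshE i hi
  · intro i hi
    rw [a']; rw [hτ'] at hi
    exact i₃.freshBad i ((Nat.mul_le_mul_right _ (by omega)).trans hi)
  · intro i hi
    rw [a']; exact i₃.freshRem i (by rwa [b₃])
  · rw [found', res']
    rcases hI.result with ⟨hf, hbad⟩ | ⟨hf, b, hb, hgood, hmin, hres⟩
    · by_cases hgk : Good n K L A k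
      · right
        obtain ⟨h₁, h₂⟩ := q₃ (rf.trans hf) (good.1 hgk)
        exact ⟨h₁, k, by omega, hgk, hbad, by rw [h₂, b₃, g₃, hg, ← add_assoc, Nat.add_sub_cancel]⟩
      · left
        rw [q₂ (rf.trans hf) (mt good.2 hgk), rf]
        refine ⟨hf, fun b hb => ?_⟩
        rcases Nat.lt_succ_iff_lt_or_eq.1 hb with hb | rfl
        · exact hbad b hb
        · exact hgk
    · right
      rw [q₁ (by rwa [rf]), rf, rr]
      exact ⟨hf, b, by omega, hgood, hmin, hres⟩

end RAM

/-! ### Computation of the constants and correctness of the whole program -/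

namespace RAM

variable {n K L : ℕ} {s : State}

theorem setConstants_spec (G : SimpleGraph (Fin n)) (K : ℕ) :
    let s := (setConstants K).run (inputState G)
    (s.reg Reg.K = K ∧ s.reg Reg.n = n ∧ s.reg Reg.n1 = n + 1 ∧ s.reg Reg.two = 2 ∧
      s.reg Reg.expL = K + 3 ∧ s.reg Reg.expL4 = 4 * (K + 3)) ∧
    (∀ r ≥ Reg.b, s.reg r = 0) ∧ s.arr Arr.pow 0 = 1 ∧
    ∀ a, a ≠ Arr.pow → s.arr a = (inputState G).arr a := by
  intro s
  refine ⟨⟨?_, ?_, ?_, ?_, ?_, ?_⟩, fun r hr => ?_, ?_, fun a ha => ?_⟩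
  · simp [s, setConstants, block, Stmt.run, Expr.eval]
  · simp [s, setConstants, block, Stmt.run, Expr.eval, inputState]
  · simp [s, setConstants, block, Stmt.run, Expr.eval, inputState]
  · simp [s, setConstants, block, Stmt.run, Expr.eval]
  · simp [s, setConstants, block, Stmt.run, Expr.eval]
  · simp [s, setConstants, block, Stmt.run, Expr.eval]; ring
  · refine (Stmt.run_reg ?_ _).trans ?_
    · simp [setConstants, block, Stmt.wregs] at hr ⊢; omega
    · simp at hr; simp [inputState, Function.update_apply]; omega
  · simp [s, setConstants, block, Stmt.run, Expr.eval]
  · exact Stmt.run_arr (by simpa [setConstants, block, Stmt.warrs] using ha) _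

theorem fillPowers_spec (hn : s.reg Reg.n = n) (h0 : s.arr Arr.pow 0 = 1) :
    let s' := fillPowers.run s
    (∀ j ≤ s.reg Reg.expL4, s'.arr Arr.pow j = (n + 2) ^ j) ∧
      (s.reg Reg.expL ≤ s.reg Reg.expL4 → s'.reg Reg.L = (n + 2) ^ s.reg Reg.expL) ∧
      s'.reg Reg.L4 = (n + 2) ^ s.reg Reg.expL4 := by
  intro s'
  set body : Stmt := block [
    .assign Reg.acc (.add (.load Arr.pow (.var Reg.j)) (.load Arr.pow (.var Reg.j))),
    .loop Reg.x Reg.n (.assign Reg.acc (.add (.var Reg.acc) (.load Arr.pow (.var Reg.j)))),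
    .store Arr.pow (.add (.var Reg.j) (.lit 1)) (.var Reg.acc)] with hbody
  have hpow : ∀ j ≤ s.reg Reg.expL4,
      ((Stmt.loop Reg.j Reg.expL4 body).run s).arr Arr.pow j = (n + 2) ^ j := by
    refine Stmt.run_loop_induction (i := Reg.j) (m := Reg.expL4) (s := s) (p := body)
      (fun x σ => ∀ j ≤ x, σ.arr Arr.pow j = (n + 2) ^ j)
      (fun j hj => by rw [Nat.le_zero.1 hj, h0, pow_zero]) ?_
    intro k _ σ hr _ hI j hj
    set σ₁ := (Stmt.assign Reg.acc (.add (.load Arr.pow (.var Reg.j))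
      (.load Arr.pow (.var Reg.j)))).run (σ.setReg Reg.j k) with hσ₁
    have hk := hI k le_rfl
    have hnσ : σ₁.reg Reg.n = n := by
      have := hr Reg.n (by decide)
      simp at this hn
      simp [hσ₁, Stmt.run, this, hn]
    have hacc := Stmt.run_loop_induction (i := Reg.x) (m := Reg.n) (s := σ₁)
      (p := .assign Reg.acc (.add (.var Reg.acc) (.load Arr.pow (.var Reg.j))))
      -- The accumulator starts at twice the old power, and `n` further additions make it `n + 2`
      -- times that power.
      (fun x τ => τ.reg Reg.acc = (x + 2) * (n + 2) ^ k)
      (by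
        simp at hk
        simp [hσ₁, Stmt.run, Expr.eval, hk]; ring)
      (by
        intro x _ τ hr' ha' hτ
        have e₁ : τ.reg Reg.j = k := (hr' _ (by decide)).trans (by simp [hσ₁, Stmt.run])
        have e₂ : τ.arr Arr.pow k = (n + 2) ^ k := by
          rw [ha' Arr.pow (by decide)]; exact hk
        simp at e₁ e₂ hτ
        simp [Stmt.run, Expr.eval, e₁, e₂, hτ]; ring)
    rw [hnσ] at hacc
    set σ₂ := (Stmt.loop Reg.x Reg.n (.assign Reg.acc (.add (.var Reg.acc)
      (.load Arr.pow (.var Reg.j))))).run σ₁ with hσ₂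
    have hj₂ : σ₂.reg Reg.j = k := (Stmt.run_reg (by decide) σ₁).trans (by simp [hσ₁, Stmt.run])
    have ha₂ : σ₂.arr Arr.pow = σ.arr Arr.pow := Stmt.run_arr (by decide) σ₁
    have : body.run (σ.setReg Reg.j k) =
      (Stmt.store Arr.pow (.add (.var Reg.j) (.lit 1)) (.var Reg.acc)).run σ₂ := rfl
    rw [this]
    simp only [Stmt.run, State.setArr_arr, Expr.eval, hj₂, hacc, true_and, ha₂]
    split
    · rename_i h; rw [h, pow_succ, mul_comm]
    · exact hI j (by omega)
  set s₁ := (Stmt.loop Reg.j Reg.expL4 body).run s with hs₁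
  have hs' : s' = (Stmt.assign Reg.L4 (.load Arr.pow (.var Reg.expL4))).run
    ((Stmt.assign Reg.L (.load Arr.pow (.var Reg.expL))).run s₁) := rfl
  have hL : s₁.reg Reg.expL = s.reg Reg.expL := Stmt.run_reg (by decide) s
  have hL4 : s₁.reg Reg.expL4 = s.reg Reg.expL4 := Stmt.run_reg (by decide) s
  refine ⟨hpow, fun hle => ?_, ?_⟩
  · rw [← hpow _ hle, ← hL, hs']
    simp [Stmt.run, Expr.eval]
  · rw [← hpow _ le_rfl, ← hL4, hs']
    simp [Stmt.run, Expr.eval]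

theorem fillMultiples_spec {a m d : ℕ} (hm : m ∉ [Reg.acc, Reg.v]) (hd : d ∉ [Reg.acc, Reg.v]) :
    ∀ k < s.reg m, ((fillMultiples a m d).run s).arr a k = k * s.reg d := by
  simp only [List.mem_cons, List.not_mem_nil, or_false, not_or] at hm hd
  set s₁ := (Stmt.assign Reg.acc (.lit 0)).run s with hs₁
  have hm₁ : s₁.reg m = s.reg m := by simpa [hs₁, Stmt.run] using fun h => absurd h hm.1
  have hd₁ : s₁.reg d = s.reg d := by simpa [hs₁, Stmt.run] using fun h => absurd h hd.1
  have key := Stmt.run_loop_induction (i := Reg.v) (m := m) (s := s₁)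
    (p := .seq (.store a (.var Reg.v) (.var Reg.acc))
      (.assign Reg.acc (.add (.var Reg.acc) (.var d))))
    (fun x σ => σ.reg Reg.acc = x * s.reg d ∧ ∀ k < x, σ.arr a k = k * s.reg d)
    ⟨by simp [hs₁, Stmt.run, Expr.eval], by simp⟩
    (by
      rintro x _ σ hr - ⟨h₁, h₂⟩
      have hdσ : σ.reg d = s.reg d := (hr d (by simp [Stmt.wregs]; simpa [and_comm] using hd)).trans hd₁
      simp at hd
      simp at h₁
      refine ⟨?_, fun k hk => ?_⟩
      · simp [Stmt.run, Expr.eval, h₁, hd.2, hdσ]; ring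
      · simp [Stmt.run, Expr.eval, h₁]
        split
        · rename_i h; rw [h]
        · exact h₂ k (by omega))
  rw [hm₁] at key
  exact key.2

theorem env_fillTables {A : ℕ → ℕ → Prop} (hK : s.reg Reg.K = K) (hn : s.reg Reg.n = n)
    (hn1 : s.reg Reg.n1 = n + 1) (h2 : s.reg Reg.two = 2) (hL : s.reg Reg.L = L)
    (hL4 : s.reg Reg.L4 = L ^ 4) (hpow : ∀ j < K, s.arr Arr.pow j = (n + 2) ^ j)
    (hadj : ∀ v < n, ∀ w < n, s.arr Arr.adj (v * n + w) ≤ 1)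
    (hadj' : ∀ v < n, ∀ w < n, s.arr Arr.adj (v * n + w) ≠ 0 ↔ A v w) :
    Env n K L A (fillTables.run s) := by
  have hr : ∀ r, r ∉ fillTables.wregs → (fillTables.run s).reg r = s.reg r :=
    fun r hr => Stmt.run_reg hr s
  have ha : ∀ a, a ∉ fillTables.warrs → (fillTables.run s).arr a = s.arr a :=
    fun a ha => Stmt.run_arr ha s
  set s₁ := (fillMultiples Arr.row Reg.n Reg.n).run s with hs₁
  have hs' : fillTables.run s = (fillMultiples Arr.mul Reg.L4 Reg.L).run s₁ := rfl
  refine ⟨?_, ?_, ?_, ?_, ?_, ?_, ?_, ?_, ?_, ?_⟩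
  · rw [hr _ (by decide), hn]
  · rw [hr _ (by decide), hK]
  · rw [hr _ (by decide), hL]
  · rw [hr _ (by decide), hn1]
  · rw [hr _ (by decide), h2]
  · rw [ha _ (by decide)]; exact hadj
  · rw [ha _ (by decide)]; exact hadj'
  · rw [hs', Stmt.run_arr (by decide)]
    have := fillMultiples_spec (s := s) (a := Arr.row) (m := Reg.n) (d := Reg.n) (by decide) (by decide)
    rwa [hn] at this
  · have := fillMultiples_spec (s := s₁) (a := Arr.mul) (m := Reg.L4) (d := Reg.L) (by decide)
      (by decide)
    rwa [Stmt.run_reg (by decide), Stmt.run_reg (by decide), hL, hL4] at this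
  · rw [ha _ (by decide)]; exact hpow

theorem inputState_arr_adj (G : SimpleGraph (Fin n)) {v w : ℕ} (hv : v < n) (hw : w < n) :
    (inputState G).arr Arr.adj (v * n + w) ≤ 1 ∧
      ((inputState G).arr Arr.adj (v * n + w) ≠ 0 ↔ G.natAdj v w) := by
  have : (∃ i j : Fin n, G.Adj i j ∧ v * n + w = (i : ℕ) * n + (j : ℕ)) ↔ G.natAdj v w := by
    constructor
    · rintro ⟨i, j, hij, h⟩
      obtain ⟨rfl, rfl⟩ := mul_add_injective hw j.2 h
      exact ⟨i.2, j.2, hij⟩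
    · rintro ⟨_, _, h⟩
      exact ⟨_, _, h, rfl⟩
  simp only [inputState, Arr.adj, Function.update_self, this]
  split <;> simp_all

theorem isForest_natAdj {G : SimpleGraph (Fin n)} (hG : G.IsAcyclic) : IsForest n G.natAdj where
  symm := SimpleGraph.natAdj_symm
  irrefl := fun v ⟨_, _, h⟩ => G.irrefl h
  lt := fun v w ⟨_, hw, _⟩ => hw
  exists_leaf := by
    intro U hU hne
    classical
    obtain ⟨u, hu⟩ := hne
    obtain ⟨v, hv, hvU⟩ := hG.exists_mem_subsingleton_neighbors
      (Finset.univ.filter fun v : Fin n => (v : ℕ) ∈ U) ⟨⟨u, hU u hu⟩, by simpa using hu⟩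
    refine ⟨v, by simpa using hv, ?_⟩
    rintro w₁ h₁ w₂ h₂ ⟨_, hw₁, ha₁⟩ ⟨_, hw₂, ha₂⟩
    have := hvU ⟨w₁, hw₁⟩ (by simpa using h₁) ⟨w₂, hw₂⟩ (by simpa using h₂) ha₁ ha₂
    simpa using this

/-- The computed number of balls. -/
theorem mainLoop_spec {A : ℕ → ℕ → Prop} (hA : IsForest n A) (hK0 : 0 < K)
    (hK : s.reg Reg.K = K) (hn : s.reg Reg.n = n)
    (hn1 : s.reg Reg.n1 = n + 1) (h2 : s.reg Reg.two = 2) (hL : s.reg Reg.L = L)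
    (hL4 : s.reg Reg.L4 = L ^ 4) (hpow : ∀ j < K, s.arr Arr.pow j = (n + 2) ^ j)
    (hadj : ∀ v < n, ∀ w < n, s.arr Arr.adj (v * n + w) ≤ 1)
    (hadj' : ∀ v < n, ∀ w < n, s.arr Arr.adj (v * n + w) ≠ 0 ↔ A v w)
    (hτ : s.reg Reg.tau = 0) (hf : s.reg Reg.found = 0)
    (ha : ∀ a ∈ [Arr.D, Arr.rem, Arr.bad, Arr.E], s.arr a = fun _ => 0)
    (hnL : (n + 1) * (n + 1) < L) (hKL : (n + 2) ^ K ≤ L) (hgood : Good n K L A n) :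
    ∃ b ≤ n, Good n K L A b ∧ (∀ b' < b, ¬ Good n K L A b') ∧
      (mainLoop.run s).reg 0 = b + b / K := by
  have e₁ := env_fillTables hK hn hn1 h2 hL hL4 hpow hadj hadj'
  set s₁ := fillTables.run s
  set s₂ := (Stmt.assign Reg.g (.lit 1)).run s₁ with hs₂
  have e₂ : Env n K L A s₂ := e₁.run _ (by decide) (by decide)
  set s₃ := (Stmt.assign Reg.gK (.var Reg.K)).run s₂ with hs₃
  have e₃ : Env n K L A s₃ := e₂.run _ (by decide) (by decide)
  have r₃ : ∀ r, r ∉ (Stmt.seq fillTables (.seq (.assign Reg.g (.lit 1))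
      (.assign Reg.gK (.var Reg.K)))).wregs → s₃.reg r = s.reg r := fun r hr => Stmt.run_reg hr s
  have a₃ : ∀ a, a ∉ (Stmt.seq fillTables (.seq (.assign Reg.g (.lit 1))
      (.assign Reg.gK (.var Reg.K)))).warrs → s₃.arr a = s.arr a := fun a ha => Stmt.run_arr ha s
  have g₃ : s₃.reg Reg.g = 1 := by simp [hs₃, hs₂, Stmt.run, Expr.eval]
  have gK₃ : s₃.reg Reg.gK = K := by
    have := e₂.reg_K
    simp at this
    simp [hs₃, Stmt.run, Expr.eval, this]
  have τ₃ : s₃.reg Reg.tau = 0 := (r₃ _ (by decide)).trans hτ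
  have i₀ : TryInv n K L A 0 s₃ := by
    refine ⟨by simpa using g₃, by rw [gK₃, g₃, one_mul], by simpa using τ₃, ?_, ?_, ?_, ?_,
      .inl ⟨(r₃ _ (by decide)).trans hf, by simp⟩⟩
    all_goals intro i _; rw [a₃ _ (by decide), ha _ (by decide)]
  have key := Stmt.run_loop_induction (i := Reg.b) (m := Reg.n1) (s := s₃) (p := tryBalls)
    (fun k σ => TryInv n K L A k σ) i₀
    (by
      intro k hk σ hr ha hI
      rw [e₃.reg_n1] at hk
      have hσ : Env n K L A σ := e₃.congr
        (fun r hr' => hr r (by revert r; decide)) (fun a ha' => ha a (by revert a; decide))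
      exact tryBalls_spec hσ hI hA hK0 (by omega) hnL hKL)
  rw [e₃.reg_n1] at key
  rcases key.result with ⟨-, hb⟩ | ⟨-, b, hb, h₁, h₂, h₃⟩
  · exact absurd hgood (hb n (by omega))
  · refine ⟨b, by omega, h₁, h₂, ?_⟩
    rw [← h₃]
    have : mainLoop.run s = (Stmt.assign 0 (.var Reg.res)).run
      ((Stmt.loop Reg.b Reg.n1 tryBalls).run s₃) := rfl
    simp [this, Stmt.run, Expr.eval]

/-- The whole program. -/
def burningProgram (K : ℕ) : Stmt := .seq (.seq (setConstants K) fillPowers) mainLoop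

/-- The search succeeds because `n` is good. The burning number is good too, so the least good `b`
does not exceed it, and a good `b` gives a cover by `b + (b / K + 1) - 1` balls. -/
theorem burningProgram_spec {G : SimpleGraph (Fin n)} (hG : G.IsAcyclic) (hK : 0 < K) :
    let r := ((burningProgram K).run (inputState G)).reg 0
    G.burningNumber ≤ r ∧ r ≤ G.burningNumber + G.burningNumber / K := by
  intro r
  obtain ⟨⟨c₁, c₂, c₃, c₄, c₅, c₆⟩, c₇, c₈, c₉⟩ := setConstants_spec G K
  set s₁ := (setConstants K).run (inputState G)
  obtain ⟨p₁, p₂, p₃⟩ := fillPowers_spec (s := s₁) c₂ c₈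
  set s₂ := fillPowers.run s₁
  -- Large enough for all weights, which are below `(n + 2) ^ K`, and for the table numbers, which
  -- are below `(n + 1) * (n + 1)`.
  set L := (n + 2) ^ (K + 3) with hL
  have r₂ : ∀ r, r ∉ fillPowers.wregs → s₂.reg r = s₁.reg r := fun r hr => Stmt.run_reg hr s₁
  have a₂ : ∀ a, a ∉ fillPowers.warrs → s₂.arr a = s₁.arr a := fun a ha => Stmt.run_arr ha s₁
  rw [c₅, c₆] at p₂
  rw [c₆] at p₁ p₃
  have hN : ∀ {i j : ℕ}, i ≤ j → (n + 2) ^ i ≤ (n + 2) ^ j := Nat.pow_le_pow_right (by omega)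
  have hKL : (n + 2) ^ K ≤ L := hN (by omega)
  have hnL : (n + 1) * (n + 1) < L := by
    have : (n + 2) ^ 2 ≤ L := hN (by omega)
    nlinarith
  have hA := isForest_natAdj hG
  have hgood : ∀ b ≤ n, G.CoveredByBalls b → Good n K L G.natAdj b := by
    intro b hb hc
    refine labelling_of_coveredByBalls (Nat.succ_pos _) hb ?_ (by nlinarith) hc
    refine (targetWeight_lt (K := K) (by omega) ?_).trans_le hKL
    have := Nat.lt_div_mul_add (a := b) hK
    rw [Nat.succ_mul]; exact this
  have adj₂ : s₂.arr Arr.adj = (inputState G).arr Arr.adj :=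
    (a₂ _ (by decide)).trans (c₉ _ (by decide))
  obtain ⟨b, hbn, hb, hmin, hres⟩ := mainLoop_spec (s := s₂) (L := L) hA hK
    ((r₂ _ (by decide)).trans c₁) ((r₂ _ (by decide)).trans c₂) ((r₂ _ (by decide)).trans c₃)
    ((r₂ _ (by decide)).trans c₄) (p₂ (by omega)) (by rw [p₃, hL, ← pow_mul, mul_comm])
    (fun j hj => p₁ j (by omega))
    (fun v hv w hw => by rw [adj₂]; exact (inputState_arr_adj G hv hw).1)
    (fun v hv w hw => by rw [adj₂]; exact (inputState_arr_adj G hv hw).2)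
    ((r₂ _ (by decide)).trans (c₇ _ (by decide))) ((r₂ _ (by decide)).trans (c₇ _ (by decide)))
    (by
      have h₀ : ∀ a ≠ Arr.adj, (inputState G).arr a = fun _ => 0 := fun a ha => by
        simp [inputState, ha]
      simp only [List.mem_cons, List.not_mem_nil, or_false, forall_eq_or_imp, forall_eq]
      refine ⟨?_, ?_, ?_, ?_⟩ <;> rw [a₂ _ (by decide), c₉ _ (by decide), h₀ _ (by decide)])
    hnL hKL (hgood n le_rfl G.coveredByBalls_card)
  change r = _ at hres
  have hcov : G.CoveredByBalls r := by
    rw [hres]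
    have := coveredByBalls_of_labelling (g := b / K + 1) (Nat.succ_pos _)
      (by rintro rfl; simp) (by omega) hbn hb
    rwa [← add_assoc, Nat.add_sub_cancel] at this
  have hbr : b ≤ G.burningNumber := by
    by_contra hlt
    exact hmin _ (not_le.1 hlt) (hgood _ (by omega) (Nat.sInf_mem (s := {b | G.CoveredByBalls b})
      ⟨n, G.coveredByBalls_card⟩))
  refine ⟨Nat.sInf_le hcov, ?_⟩
  rw [hres]
  exact Nat.add_le_add hbr (Nat.div_le_div_right hbr)

end RAM

/-! ### Running time and conclusion -/

namespace RAM

/-- `Stmt.runs_compile` wants the loop bounds to be in place at the start, but here some of them are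
computed on the way. So the program is run in phases, and the bounds are checked at the beginning of
each. -/
theorem Stmt.runs_compile_seq {B T : ℕ} {p q : Stmt} {d : ℕ} {s : State}
    (hp : ∃ s' t, (p.compile d).Runs s s' t ∧ t ≤ T ∧ s'.arr = (p.run s).arr ∧
      ∀ r < d, s'.reg r = (p.run s).reg r)
    (hd : ∀ r ∈ q.regs, r < d) (hw : ∀ r ∈ q.bounds, r ∉ q.wregs)
    (hB : ∀ r ∈ q.bounds, (p.run s).reg r ≤ B) :
    ∃ s' t, ((Stmt.seq p q).compile d).Runs s s' t ∧ t ≤ T + q.cost B ∧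
      s'.arr = ((Stmt.seq p q).run s).arr ∧ ∀ r < d, s'.reg r = ((Stmt.seq p q).run s).reg r := by
  obtain ⟨s₁, t₁, h₁, ht₁, ha₁, hr₁⟩ := hp
  obtain ⟨s₂, t₂, h₂, ht₂, ha₂, hr₂⟩ := q.runs_compile d s₁ hd hw (B := B)
    (fun r hr => by rw [hr₁ r (hd r (bounds_subset_regs q r hr))]; exact hB r hr)
  obtain ⟨hca, hcr⟩ := run_congr q hd hr₁ ha₁
  exact ⟨s₂, _, .seq h₁ h₂, Nat.add_le_add ht₁ ht₂, ha₂.trans hca,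
    fun r hr => (hr₂ r hr).trans (hcr r hr)⟩

set_option maxRecDepth 20000 in
/-- The program halts after polynomially many steps in the length of the multiplication table. -/
theorem exists_runs_burningProgram : ∃ c d : ℕ, ∀ (K n : ℕ) (G : SimpleGraph (Fin n)),
    ∃ s' t, ((burningProgram K).compile 30).Runs (inputState G) s' t ∧
      t ≤ c * ((n + 2) ^ (4 * (K + 3)) + 1) ^ d ∧
      s'.reg 0 = ((burningProgram K).run (inputState G)).reg 0 := by
  -- `K` occurs in the program only as the value of one literal, which does not affect the cost. So
  -- the constants for `K = 0` serve all `K`.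
  obtain ⟨c, d, hcd⟩ := (burningProgram 0).exists_cost_le
  refine ⟨c, d, fun K n G => ?_⟩
  set B := (n + 2) ^ (4 * (K + 3)) with hB
  obtain ⟨⟨c₁, c₂, c₃, c₄, c₅, c₆⟩, -, c₈, -⟩ := setConstants_spec G K
  obtain ⟨-, p₂, p₃⟩ := fillPowers_spec c₂ c₈
  rw [c₅, c₆] at p₂
  rw [c₆] at p₃
  have hexp : 4 * (K + 3) ≤ B := (Nat.lt_pow_self (by omega)).le
  have hnB : n + 2 ≤ B := Nat.le_self_pow (by omega) _
  have hLB : (n + 2) ^ (K + 3) ≤ B := Nat.pow_le_pow_right (by omega) (by omega)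
  -- The program names only registers below 30, which leaves those from 30 on as scratch space.
  have h₁ := (setConstants K).runs_compile (B := B) 30 (inputState G)
    (by simp [setConstants, block, Stmt.regs, Expr.regs])
    (by simp [setConstants, block, Stmt.bounds]) (by simp [setConstants, block, Stmt.bounds])
  have h₂ := Stmt.runs_compile_seq (q := fillPowers) (B := B) h₁ (by decide) (by decide) (by
    have : ∀ r ∈ fillPowers.bounds, r = Reg.expL4 ∨ r = Reg.n := by decide
    intro r hr
    rcases this r hr with rfl | rfl
    · rw [c₆]; exact hexp
    · rw [c₂]; omega)
  have h₃ := Stmt.runs_compile_seq (q := mainLoop) (B := B) h₂ (by decide) (by decide) (by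
    have : ∀ r ∈ mainLoop.bounds, r = Reg.n ∨ r = Reg.n1 ∨ r = Reg.K ∨ r = Reg.two ∨
      r = Reg.L ∨ r = Reg.L4 := by decide
    have hrun : ∀ r, r ∉ fillPowers.wregs → ((setConstants K).seq fillPowers |>.run
        (inputState G)).reg r = ((setConstants K).run (inputState G)).reg r :=
      fun r hr => Stmt.run_reg hr _
    intro r hr
    rcases this r hr with rfl | rfl | rfl | rfl | rfl | rfl
    · rw [hrun _ (by decide), c₂]; omega
    · rw [hrun _ (by decide), c₃]; omega
    · rw [hrun _ (by decide), c₁]; omega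
    · rw [hrun _ (by decide), c₄]; omega
    · exact (p₂ (by omega)).trans_le hLB
    · exact p₃.trans_le le_rfl)
  obtain ⟨s', t, hr, ht, -, hs'⟩ := h₃
  exact ⟨s', t, hr, ht.trans (hcd B), hs' 0 (by omega)⟩

/-- The factor `c` and the summand 1 are absorbed into the exponent because the base `n + 2` is at
least 2. The factor 2 in the exponent comes from `n + 2 ≤ (max n 2) ^ 2`. -/
theorem mul_pow_succ_pow_le (c d e n : ℕ) :
    c * ((n + 2) ^ e + 1) ^ d ≤ (max n 2) ^ (2 * (c + (e + 1) * d)) := by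
  have hM : 2 ≤ max n 2 := le_max_right _ _
  have hn : n + 2 ≤ max n 2 ^ 2 := by
    have : n ≤ max n 2 := le_max_left _ _
    nlinarith
  have hB : (n + 2) ^ e + 1 ≤ (n + 2) ^ (e + 1) := by
    have h : 1 ≤ (n + 2) ^ e := Nat.one_le_pow _ _ (by omega)
    rw [pow_succ]
    nlinarith
  have hc : c ≤ (n + 2) ^ c := (Nat.lt_pow_self (by omega)).le
  calc c * ((n + 2) ^ e + 1) ^ d ≤ (n + 2) ^ c * ((n + 2) ^ (e + 1)) ^ d :=
        Nat.mul_le_mul hc (Nat.pow_le_pow_left hB d)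
    _ = (n + 2) ^ (c + (e + 1) * d) := by rw [← pow_mul, ← pow_add]
    _ ≤ (max n 2 ^ 2) ^ (c + (e + 1) * d) := Nat.pow_le_pow_left hn _
    _ = max n 2 ^ (2 * (c + (e + 1) * d)) := by rw [← pow_mul]

end RAM

theorem mainTheorem3 :
    ∃ C : ℕ, ∀ ε : ℝ, 0 < ε →
      ∃ P : RAM.Program, ∀ (n : ℕ) (G : SimpleGraph (Fin n)), G.IsAcyclic →
        ∃ (s : RAM.State) (t : ℕ), P.Runs (RAM.inputState G) s t ∧
          G.burningNumber ≤ s.output ∧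
          (s.output : ℝ) ≤ (1 + ε) * (G.burningNumber : ℝ) ∧
          (t : ℝ) ≤ (max (n : ℝ) 2) ^ ((C : ℝ) * max 1 (1 / ε)) := by
  obtain ⟨c, d, hcd⟩ := RAM.exists_runs_burningProgram
  -- With `X = max 1 (1 / ε)` and `K ≤ 2 * X`, the factor `4 * (K + 3) + 1 = 4 * K + 13` of `d` in
  -- the exponent is at most `8 * X + 13 * X = 21 * X`.
  refine ⟨2 * (c + 21 * d), fun ε hε => ?_⟩
  -- `K ≥ 1 / ε` makes the additive error `β / K` at most `ε * β`, where `β` is the burning number.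
  obtain ⟨K, hK⟩ : ∃ K : ℕ, K = ⌈1 / ε⌉₊ := ⟨_, rfl⟩
  have hK0 : 0 < K := hK ▸ Nat.ceil_pos.2 (by positivity)
  have hKε : 1 / ε ≤ K := hK ▸ Nat.le_ceil _
  refine ⟨(RAM.burningProgram K).compile 30, fun n G hG => ?_⟩
  obtain ⟨s, t, hrun, ht, hs⟩ := hcd K n G
  obtain ⟨h₁, h₂⟩ := RAM.burningProgram_spec hG hK0
  rw [← hs] at h₁ h₂
  refine ⟨s, t, hrun, h₁, ?_, ?_⟩
  · have hdiv : ((G.burningNumber / K : ℕ) : ℝ) ≤ ε * G.burningNumber := by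
      refine Nat.cast_div_le.trans ?_
      rw [div_le_iff₀ (by exact_mod_cast hK0)]
      have : 1 ≤ ε * K := by rwa [div_le_iff₀' hε] at hKε
      nlinarith [Nat.cast_nonneg (α := ℝ) G.burningNumber]
    calc (s.output : ℝ) ≤ ((G.burningNumber + G.burningNumber / K : ℕ) : ℝ) := by
          exact_mod_cast h₂
      _ ≤ (1 + ε) * G.burningNumber := by push_cast at hdiv ⊢; linarith
  · set X : ℝ := max 1 (1 / ε) with hX
    have hX1 : 1 ≤ X := le_max_left _ _
    have hKX : (K : ℝ) ≤ 2 * X := by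
      have := Nat.ceil_lt_add_one (a := 1 / ε) (by positivity)
      rw [← hK] at this
      have : 1 / ε ≤ X := le_max_right _ _
      linarith
    have htM : t ≤ (max n 2) ^ (2 * (c + (4 * (K + 3) + 1) * d)) :=
      ht.trans (RAM.mul_pow_succ_pow_le c d (4 * (K + 3)) n)
    have hM1 : (1 : ℝ) ≤ max (n : ℝ) 2 := one_le_two.trans (le_max_right _ _)
    have htR : (t : ℝ) ≤ (max (n : ℝ) 2) ^ (2 * (c + (4 * (K + 3) + 1) * d)) := by
      have := (Nat.cast_le (α := ℝ)).2 htM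
      rwa [Nat.cast_pow, Nat.cast_max, Nat.cast_ofNat] at this
    rw [← Real.rpow_natCast] at htR
    refine htR.trans (Real.rpow_le_rpow_of_exponent_le hM1 ?_)
    push_cast
    have hc : (c : ℝ) ≤ c * X := le_mul_of_one_le_right (Nat.cast_nonneg _) hX1
    have hd : (4 * ((K : ℝ) + 3) + 1) * d ≤ 21 * X * d :=
      mul_le_mul_of_nonneg_right (by linarith) (Nat.cast_nonneg _)
    linarith
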